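/- **Theorem (distPAC boosting).** *Setting.* An evaluation rule is a family $\phi=\{\phi_n:\{0,1\}^*\times\{0,1\}^n\to\{-1,1\}\}_{n\in\mathbb N}$; it induces the concept class $\mathcal C=\{\mathcal C_n\}$, $\mathcal C_n=\{\phi_n(\pi,\cdot):\pi\in\{0,1\}^*\}$. For $s:\mathbb N\to\mathbb N$, $\mathcal C$ is $s(n)$-represented if for every $n$ every $f\in\mathcal C_n$ equals $\phi_n(\pi,\cdot)$ for some $\pi$ of length at most $s(n)$. A target distribution $\mu$ assigns to each $n$ a probability distribution $\mu_n$ on $\mathcal C_n$. For a distribution $\rho$ on $\{0,1\}^n$, the oracle $\mathrm{EX}(f,\rho)$ returns independent labelled examples $\langle x,f(x)\rangle$, $x\sim\rho$. A learner $A$ is a probabilistic algorithm with access to an example oracle, which outputs a description of a hypothesis $h:\{0,1\}^n\to\{-1,1\}$, together with a deterministic algorithm that evaluates $h$ at a point in time polynomial in $n$ and the length of the description. Real parameters $\epsilon,\delta,\eta>0$ are given to it as $\lceil1/\epsilon\rceil,\lceil1/\delta\rceil,\lceil1/\eta\rceil$, and its running time is the worst case over its coins and over all oracle answers labelled by concepts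 of $\mathcal C_n$. "With confidence $1-\delta$, for every $\rho$, the error of $A$ on $f$ is at most $e$" is read in either of two senses: (i) $\displaystyle\Pr_{r}\Bigl[\forall\rho:\ \Pr_{x\sim\rho,\ \text{examples}}\bigl[h(x)\ne f(x): h\leftarrow A^{\mathrm{EX}(f,\rho)}(\cdot\,;r)\bigr]\le e\Bigr]\ge 1-\delta$, where $r$ are the coins of $A$ and "examples" are the answers of the oracle; (ii) $\displaystyle\forall\rho:\ \Pr_{r,\ \text{examples}}\Bigl[\Pr_{x\sim\rho}\bigl[h(x)\ne f(x): h\leftarrow A^{\mathrm{EX}(f,\rho)}(\cdot\,;r)\bigr]\le e\Bigr]\ge 1-\delta$. $(\mathcal C,\mu)$ is *efficiently distPAC-learnable* if some learner $A$, running in time $\mathrm{poly}(n,s(n),\epsilon^{-1},\delta^{-1},\eta^{-1})$ on input $(n,\epsilon,\delta,\eta)$, satisfies for all $n\in\mathbb N$ and $\epsilon,\delta,\eta>0$: $$\Pr_{f\sim\mu_n}\bigl[\text{with confidence }1-\delta,\text{ for every }\rho,\text{ the error of }A\text{ on }f\text{ is at most }\epsilon\bigr]\ge1-\eta .$$ $(\mathcal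 C,\mu)$ is *efficiently weakly distPAC-learnable* if there are a positive polynomial $p$ and a learner $A$, running in time $\mathrm{poly}(n,s(n),\delta^{-1},\eta^{-1})$ on input $(n,\delta,\eta)$, such that the same holds for all $n\in\mathbb N$ and $\delta,\eta>0$ with the error bound $\tfrac12-\tfrac1{p(n)}$ in place of $\epsilon$. *Claim.* Let $\phi$ be any evaluation rule whose induced class $\mathcal C$ is $s(n)$-represented, and let $\mu$ be any target distribution. In each of the senses (i) and (ii), $(\mathcal C,\mu)$ is efficiently weakly distPAC-learnable if and only if it is efficiently distPAC-learnable. -/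

import Mathlib

open MeasureTheory

namespace DistPAC

/-! ### Machine model: while-programs over binary trees, with a step count

Values are binary trees (S-expressions). A program has finitely many variables, each holding one
tree. Besides the usual control structure it can toss a fair coin and ask the example oracle for
one more labelled example. Writing a tree into a variable costs the number of its nodes, so no
value is ever larger than the input together with the running time, and running times agree with
those of (oracle, probabilistic) multitape Turing machines up to a polynomial. -/

/-- Binary trees. -/
inductive Data : Type
  | nil : Data
  | cons : Data → Data → Data

/-- Number of nodes of a tree, leaves included. -/
def Data.size : Data → ℕ
  | .nil => 1
  | .cons a b => 1 + a.size + b.size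

/-- Left subtree (`nil` for a leaf). -/
def Data.hd : Data → Data
  | .nil => .nil
  | .cons a _ => a

/-- Right subtree (`nil` for a leaf). -/
def Data.tl : Data → Data
  | .nil => .nil
  | .cons _ b => b

/-- Bits as trees: `nil` is `false`. -/
def Data.ofBool : Bool → Data
  | false => .nil
  | true => .cons .nil .nil

/-- Lists as trees. -/
def Data.ofList : List Data → Data
  | [] => .nil
  | a :: l => .cons a (Data.ofList l)

/-- Natural numbers in unary. -/
def Data.ofNat (k : ℕ) : Data := Data.ofList (List.replicate k Data.nil)

/-- Expressions over the variables `0, 1, 2, …`. -/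
inductive Expr : Type
  | nil : Expr
  | var : ℕ → Expr
  | cons : Expr → Expr → Expr
  | hd : Expr → Expr
  | tl : Expr → Expr

def Expr.eval (v : ℕ → Data) : Expr → Data
  | .nil => .nil
  | .var i => v i
  | .cons a b => .cons (a.eval v) (b.eval v)
  | .hd a => (a.eval v).hd
  | .tl a => (a.eval v).tl

/-- Programs. `flip i` stores a fair coin toss in variable `i`, `sample i` stores there a fresh
labelled example returned by the example oracle. Conditionals and loops test `variable ≠ nil`. -/
inductive Cmd : Type
  | skip : Cmd
  | assign : ℕ → Expr → Cmd
  | seq : Cmd → Cmd → Cmd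
  | ite : ℕ → Cmd → Cmd → Cmd
  | loop : ℕ → Cmd → Cmd
  | flip : ℕ → Cmd
  | sample : ℕ → Cmd

/-- The program neither tosses coins nor calls the example oracle. -/
def Cmd.Deterministic : Cmd → Prop
  | .skip => True
  | .assign _ _ => True
  | .seq c d => c.Deterministic ∧ d.Deterministic
  | .ite _ c d => c.Deterministic ∧ d.Deterministic
  | .loop _ c => c.Deterministic
  | .flip _ => False
  | .sample _ => False

/-- A state: contents of the variables, the coin tosses still to come, and the answers of the
example oracle still to come. -/
structure State where
  store : ℕ → Data
  coins : ℕ → Bool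
  examples : ℕ → Data

/-- `Exec c s t s'`: started in state `s`, the program `c` halts in state `s'` after time `t`. -/
inductive Exec : Cmd → State → ℕ → State → Prop
  | skip (s : State) : Exec .skip s 1 s
  | assign (i : ℕ) (e : Expr) (s : State) :
      Exec (.assign i e) s (1 + (e.eval s.store).size)
        { s with store := Function.update s.store i (e.eval s.store) }
  | seq {c d : Cmd} {s s' s'' : State} {t t' : ℕ} :
      Exec c s t s' → Exec d s' t' s'' → Exec (.seq c d) s (t + t') s''
  | ite_then {i : ℕ} {c d : Cmd} {s s' : State} {t : ℕ} :
      s.store i ≠ .nil → Exec c s t s' → Exec (.ite i c d) s (1 + t) s'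
  | ite_else {i : ℕ} {c d : Cmd} {s s' : State} {t : ℕ} :
      s.store i = .nil → Exec d s t s' → Exec (.ite i c d) s (1 + t) s'
  | loop_done {i : ℕ} {c : Cmd} {s : State} :
      s.store i = .nil → Exec (.loop i c) s 1 s
  | loop_step {i : ℕ} {c : Cmd} {s s' s'' : State} {t t' : ℕ} :
      s.store i ≠ .nil → Exec c s t s' → Exec (.loop i c) s' t' s'' →
        Exec (.loop i c) s (1 + t + t') s''
  | flip (i : ℕ) (s : State) :
      Exec (.flip i) s 1
        { s with
          store := Function.update s.store i (Data.ofBool (s.coins 0))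
          coins := fun k => s.coins (k + 1) }
  | sample (i : ℕ) (s : State) :
      Exec (.sample i) s (1 + (s.examples 0).size)
        { s with
          store := Function.update s.store i (s.examples 0)
          examples := fun k => s.examples (k + 1) }

/-- Initially the variables `0, 1, …` hold the inputs, in order, and all others hold `nil`. -/
def initStore (inputs : List Data) : ℕ → Data := fun i => inputs.getD i .nil

/-! ### Concept classes -/

/-- Inputs of concepts: bit strings of length `n`. -/
abbrev Point (n : ℕ) := Fin n → Bool

/-- An evaluation rule: for each `n`, a map from (representation, input) to a label. The two labels
(`-1` and `1`) are written as Booleans. -/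
abbrev EvaluationRule := (n : ℕ) → List Bool → Point n → Bool

/-- The concept class induced by an evaluation rule. -/
def EvaluationRule.inducedClass (φ : EvaluationRule) (n : ℕ) : Set (Point n → Bool) :=
  Set.range (φ n)

/-- The induced class is `s(n)`-represented: every concept on `n`-bit inputs has a representation
of length at most `s n`. -/
def EvaluationRule.IsRepresented (φ : EvaluationRule) (s : ℕ → ℕ) : Prop :=
  ∀ n, ∀ f ∈ φ.inducedClass n, ∃ π : List Bool, π.length ≤ s n ∧ φ n π = f

/-- A target distribution: for each `n`, a distribution over the concepts on `n`-bit inputs. -/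
abbrev TargetDistribution (φ : EvaluationRule) := (n : ℕ) → PMF (φ.inducedClass n)

def encodePoint {n : ℕ} (x : Point n) : Data := Data.ofList ((List.ofFn x).map Data.ofBool)

/-- The labelled example `⟨x, b⟩`. -/
def encodeExample {n : ℕ} (x : Point n) (b : Bool) : Data :=
  .cons (encodePoint x) (Data.ofBool b)

/-! ### Learning algorithms -/

/-- A learning algorithm: a probabilistic program `train` with access to the example oracle, which
outputs a description of a hypothesis, and a deterministic program `predict`, which computes the
value of a described hypothesis at a given point. -/
structure Learner where
  train : Cmd
  predict : Cmd
  predict_det : predict.Deterministic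

variable {n : ℕ}

/-- With coin tosses `r`, and the oracle returning `⟨x₀, f x₀⟩, ⟨x₁, f x₁⟩, …` in turn, the learner
halts on the given numerical inputs after time `t`, with output `σ` in variable `0`. -/
def Learner.Trains (A : Learner) (inputs : List ℕ) (f : Point n → Bool) (r : ℕ → Bool)
    (xs : ℕ → Point n) (t : ℕ) (σ : Data) : Prop :=
  ∃ s' : State,
    Exec A.train
      { store := initStore (inputs.map Data.ofNat)
        coins := r
        examples := fun k => encodeExample (xs k) (f (xs k)) } t s' ∧
    s'.store 0 = σ

/-- The hypothesis described by `σ` is computed to have the value `b` at `x`, in time `t`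
(a final content of variable `0` other than `nil` means `true`). -/
def Learner.Predicts (A : Learner) (σ : Data) (x : Point n) (t : ℕ) (b : Bool) : Prop :=
  ∃ s' : State,
    Exec A.predict
      { store := initStore [σ, encodePoint x]
        coins := fun _ => false
        examples := fun _ => .nil } t s' ∧
    (b = true ↔ s'.store 0 ≠ .nil)

/-- The event `h(x) ≠ f(x)`, for the hypothesis `h` which the learner outputs on coin tosses `r`
and oracle answers `xs` (labelled by `f`). A computation that does not halt counts as an error. -/
def Learner.Errs (A : Learner) (inputs : List ℕ) (f : Point n → Bool) (r : ℕ → Bool)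
    (xs : ℕ → Point n) (x : Point n) : Prop :=
  ¬ ∃ (t : ℕ) (σ : Data) (t' : ℕ), A.Trains inputs f r xs t σ ∧ A.Predicts σ x t' (f x)

/-- Training halts in time at most `T`, for all coin tosses and all answers of the example oracle
for `f`. -/
def Learner.TrainsInTime (A : Learner) (inputs : List ℕ) (f : Point n → Bool) (T : ℝ) : Prop :=
  ∀ (r : ℕ → Bool) (xs : ℕ → Point n), ∃ (t : ℕ) (σ : Data), A.Trains inputs f r xs t σ ∧ (t : ℝ) ≤ T

/-- Hypotheses are evaluated in time polynomial in the size of their description and in `n`. -/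
def Learner.PolyEvaluable (A : Learner) : Prop :=
  ∃ c : ℕ, ∀ (n : ℕ) (σ : Data) (x : Point n), ∃ (t : ℕ) (b : Bool),
    A.Predicts σ x t b ∧ t ≤ c * (σ.size + n + 1) ^ c

/-- The law of an infinite sequence of fair coin tosses. -/
noncomputable def coinMeasure : Measure (ℕ → Bool) :=
  Measure.infinitePi (fun _ : ℕ => (PMF.uniformOfFintype Bool).toMeasure)

/-- The law of an infinite sequence of independent draws from `ρ`. -/
noncomputable def drawMeasure (ρ : PMF (Point n)) : Measure (ℕ → Point n) :=
  Measure.infinitePi (fun _ : ℕ => ρ.toMeasure)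

/-- The two senses in which "with confidence `1 - δ`, for every example distribution the error is at
most `e`" can be taken. -/
inductive Confidence : Type
  /-- The probability `1 - δ` is over the learner's own coin tosses; every example distribution is
  considered after they are fixed, and the error probability is over the test point and the
  answers of the oracle. -/
  | coins : Confidence
  /-- For every example distribution, the probability `1 - δ` is over the coin tosses and the
  answers of the oracle jointly, and the error probability is over the test point. -/
  | joint : Confidence

/-- The learner succeeds on the concept `f`: with confidence `1 - δ`, and for every example
distribution, its error is at most `e`. -/
def Learner.Succeeds (A : Learner) : Confidence → List ℕ → (Point n → Bool) → ℝ → ℝ → Prop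
  | .coins, inputs, f, e, δ =>
      coinMeasure.real
        {r | ∀ ρ : PMF (Point n),
          ((drawMeasure ρ).prod ρ.toMeasure).real {p | A.Errs inputs f r p.1 p.2} ≤ e} ≥ 1 - δ
  | .joint, inputs, f, e, δ =>
      ∀ ρ : PMF (Point n),
        (coinMeasure.prod (drawMeasure ρ)).real
          {q | ρ.toMeasure.real {x | A.Errs inputs f q.1 q.2 x} ≤ e} ≥ 1 - δ

/-- Efficient distributional PAC-learnability. The accuracy, confidence and heuristic parameters
are handed to the learner as `⌈1/ε⌉`, `⌈1/δ⌉`, `⌈1/η⌉`. -/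
def EfficientlyDistPACLearnable (k : Confidence) (φ : EvaluationRule) (s : ℕ → ℕ)
    (μ : TargetDistribution φ) : Prop :=
  ∃ A : Learner, A.PolyEvaluable ∧ ∃ c : ℕ,
    ∀ (n : ℕ) (ε δ η : ℝ), 0 < ε → 0 < δ → 0 < η →
      (∀ f ∈ φ.inducedClass n,
        A.TrainsInTime [n, ⌈1 / ε⌉₊, ⌈1 / δ⌉₊, ⌈1 / η⌉₊] f
          (c * (n + s n + 1 / ε + 1 / δ + 1 / η + 1) ^ c)) ∧
      ((μ n).toOuterMeasure
        {f | A.Succeeds k [n, ⌈1 / ε⌉₊, ⌈1 / δ⌉₊, ⌈1 / η⌉₊] f.1 ε δ}).toReal ≥ 1 - η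

/-- Efficient weak distributional PAC-learnability: the error only has to be at most
`1/2 - 1/poly(n)`, for some polynomial. -/
def EfficientlyWeaklyDistPACLearnable (k : Confidence) (φ : EvaluationRule) (s : ℕ → ℕ)
    (μ : TargetDistribution φ) : Prop :=
  ∃ A : Learner, A.PolyEvaluable ∧ ∃ c d : ℕ, 0 < d ∧
    ∀ (n : ℕ) (δ η : ℝ), 0 < δ → 0 < η →
      (∀ f ∈ φ.inducedClass n,
        A.TrainsInTime [n, ⌈1 / δ⌉₊, ⌈1 / η⌉₊] f (c * (n + s n + 1 / δ + 1 / η + 1) ^ c)) ∧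
      ((μ n).toOuterMeasure
        {f | A.Succeeds k [n, ⌈1 / δ⌉₊, ⌈1 / η⌉₊] f.1 (1 / 2 - 1 / (d * (n + 1) ^ d)) δ}).toReal
          ≥ 1 - η

end DistPAC

/-! A strong learner run with accuracy 1/4 is a weak one. The converse is boosting by resampling,
under two constraints: in sense (i) the coins are fixed before the example distribution is chosen,
and the learner is not told `s n`, so it cannot compute in advance how many examples it needs.

Let `G = advInv d n`. Either sense of confidence, used with `δ = 1/2`, implies that under every
example distribution one run of the weak learner has error at most `1/2 - 1/(2G)` with probability
at least `1/(2G)` over coins and examples (`Learner.Succeeds.weaklyLearns`). From there on both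
senses are treated together.

Stage `q` works on the first `q ^ 2` examples. It runs the weak learner on examples drawn, by coins
alone, from a reweighted version of this sample, and keeps a hypothesis only if it passes an exact
test of its weighted error. An unsuccessful run therefore costs nothing but time. The simulated
examples are labelled by `f`, so the worst-case time bound of the weak learner covers these runs.
The weights are cubes `(a + 1) ^ 3` of integer deficits rather than exponentials. The potential `∑
(a + 1) ^ 4` grows only quadratically in the number of rounds (`potential_step`, `potential_sum`),
so weights, repetition lists and unary numbers stay polynomial, and after `rounds` accepted
hypotheses their majority is correct on the whole sample (`Reachable.majority_eq`).

The expectation of `2 ^ (hypotheses still wanted) - 1` contracts with each run, so enough runs make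
the failure probability of a stage, for one fixed sample, smaller than `2 ^ (-n q ^ 2)` by a
summable factor. A union bound over all samples of `q ^ 2` points then gives coins that are good for
every sample, hence for every distribution (`WeaklyLearns.coinMeasure_badCoins_le`). This is what
sense (i) requires.

Generalisation is Occam's razor with self-delimiting descriptions: Kraft's inequality for trees
gives a hypothesis of size `m` the weight `2 ^ (-m)`, and a consistent hypothesis is trustworthy
once its size is small against `q ^ 2 / (2 ⌈1/ε⌉)` (`drawMeasure_badDraws_le`). The size of a
stage's output is linear in `q` and the budget is quadratic, so raising `q` until the test `short`
succeeds takes polynomially many stages, without knowledge of `s n` or of the weak learner's running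
time (`HaltsWithin.short_of_le`).

The rest turns this into a program. `PolyTime` is a calculus of polynomial-time functions.
`Cmd.interp` turns a program into a tree whose mean is the true success probability, and
`Cmd.exec_embed` runs the weak learner inside the booster with a simulated oracle. -/

namespace DistPAC

/-! ### Polynomial growth -/

/-- `f` is bounded by a polynomial in `Z`. -/
def PolyIn {ι : Type*} (Z f : ι → ℕ) : Prop := ∃ k, ∀ i, f i ≤ (Z i + 2) ^ k

namespace PolyIn

variable {ι κ : Type*} {Z f g : ι → ℕ}

theorem mono (hg : PolyIn Z g) (h : ∀ i, f i ≤ g i) : PolyIn Z f :=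
  let ⟨k, hk⟩ := hg
  ⟨k, fun i => (h i).trans (hk i)⟩

theorem self : PolyIn Z Z := ⟨1, fun i => by simp⟩

/-- The base `Z + 2` is at least 2, so constant factors and summands disappear into the exponent. -/
theorem const (m : ℕ) : PolyIn Z fun _ => m :=
  ⟨m, fun i => (Nat.lt_two_pow_self).le.trans (Nat.pow_le_pow_left (by omega) m)⟩

theorem add (hf : PolyIn Z f) (hg : PolyIn Z g) : PolyIn Z fun i => f i + g i := by
  obtain ⟨a, ha⟩ := hf
  obtain ⟨b, hb⟩ := hg
  refine ⟨a + b + 1, fun i => ?_⟩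
  have h1 : (Z i + 2) ^ a ≤ (Z i + 2) ^ (a + b) := Nat.pow_le_pow_right (by omega) (by omega)
  have h2 : (Z i + 2) ^ b ≤ (Z i + 2) ^ (a + b) := Nat.pow_le_pow_right (by omega) (by omega)
  have h3 : 0 ≤ (Z i + 2) ^ (a + b) * Z i := Nat.zero_le _
  rw [pow_succ]
  nlinarith [ha i, hb i]

theorem mul (hf : PolyIn Z f) (hg : PolyIn Z g) : PolyIn Z fun i => f i * g i := by
  obtain ⟨a, ha⟩ := hf
  obtain ⟨b, hb⟩ := hg
  exact ⟨a + b, fun i => by rw [pow_add]; exact Nat.mul_le_mul (ha i) (hb i)⟩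

theorem pow (hf : PolyIn Z f) (m : ℕ) : PolyIn Z fun i => f i ^ m := by
  obtain ⟨a, ha⟩ := hf
  exact ⟨a * m, fun i => by rw [pow_mul]; exact Nat.pow_le_pow_left (ha i) m⟩

theorem comp {Y h : κ → ℕ} (hh : PolyIn Y h) (u : ι → κ) (hY : PolyIn Z fun i => Y (u i)) :
    PolyIn Z fun i => h (u i) := by
  obtain ⟨k, hk⟩ := hh
  exact ((hY.add (const 2)).pow k).mono fun i => hk (u i)

end PolyIn

/-! ### Encodings -/

/-- Types whose elements are represented by trees. -/
class Enc (α : Type) where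
  /-- the tree representing an element -/
  enc : α → Data

open Enc (enc)

instance : Enc Data := ⟨id⟩
instance : Enc Unit := ⟨fun _ => .nil⟩
instance : Enc Bool := ⟨Data.ofBool⟩
instance : Enc ℕ := ⟨Data.ofNat⟩
instance {α β : Type} [Enc α] [Enc β] : Enc (α × β) := ⟨fun p => .cons (enc p.1) (enc p.2)⟩
instance {α : Type} [Enc α] : Enc (List α) := ⟨fun l => Data.ofList (l.map enc)⟩

/-- Size of the representing tree. -/
def sz {α : Type} [Enc α] (x : α) : ℕ := (enc x).size

theorem exec_assign (i : ℕ) (a : Expr) (v : ℕ → Data) (r : ℕ → Bool) (e : ℕ → Data) :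
    Exec (.assign i a) ⟨v, r, e⟩ (1 + (a.eval v).size) ⟨Function.update v i (a.eval v), r, e⟩ :=
  Exec.assign i a ⟨v, r, e⟩

/-- Loops that run through `k` iterations, governed by an invariant that counts down. -/
theorem exec_loop {i : ℕ} {c : Cmd} {B : ℕ} (R : ℕ → State → Prop)
    (h0 : ∀ s, R 0 s → s.store i = .nil)
    (hs : ∀ k s, R (k + 1) s →
      s.store i ≠ .nil ∧ ∃ t s', Exec c s t s' ∧ t ≤ B ∧ R k s') :
    ∀ k s, R k s → ∃ t s', Exec (.loop i c) s t s' ∧ t ≤ k * (B + 1) + 1 ∧ R 0 s' := by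
  intro k
  induction k with
  | zero => exact fun s h => ⟨1, s, .loop_done (h0 s h), by simp, h⟩
  | succ k ih =>
    intro s h
    obtain ⟨hn, t, s', he, ht, hR⟩ := hs k s h
    obtain ⟨t', s'', he', ht', hR'⟩ := ih s' hR
    exact ⟨1 + t + t', s'', .loop_step hn he he', by rw [Nat.succ_mul]; omega, hR'⟩

/-! ### Functions computable in polynomial time -/

section PolyTime

variable {α β γ δ : Type} [Enc α] [Enc β] [Enc γ] [Enc δ]

/-- `f` is computed in polynomial time by programs that read and write the variable `b` and
leave the variables below `b` untouched. -/
def PolyTime (f : α → β) : Prop :=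
  ∃ (c : ℕ → Cmd) (T : α → ℕ), PolyIn sz T ∧ (∀ b, (c b).Deterministic) ∧
    ∀ b x v r e, v b = enc x → ∃ t v', Exec (c b) ⟨v, r, e⟩ t ⟨v', r, e⟩ ∧ v' b = enc (f x) ∧
      (∀ j < b, v' j = v j) ∧ t + sz (f x) ≤ T x

theorem sz_data (d : Data) : sz d = d.size := rfl
theorem enc_data (d : Data) : enc d = d := rfl
theorem enc_pair (a : α) (b : β) : enc (a, b) = .cons (enc a) (enc b) := rfl
theorem sz_pair (a : α) (b : β) : sz (a, b) = 1 + sz a + sz b := rfl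
theorem enc_nil : enc ([] : List α) = .nil := rfl
theorem enc_cons (a : α) (l : List α) : enc (a :: l) = .cons (enc a) (enc l) := rfl
theorem sz_nil : sz ([] : List α) = 1 := rfl
theorem sz_cons (a : α) (l : List α) : sz (a :: l) = 1 + sz a + sz l := rfl
theorem enc_false : enc false = .nil := rfl
theorem enc_true : enc true = .cons .nil .nil := rfl
theorem enc_nat_zero : enc 0 = .nil := rfl
theorem enc_nat_succ (n : ℕ) : enc (n + 1) = .cons .nil (enc n) := rfl

theorem Data.size_pos (d : Data) : 0 < d.size := by cases d <;> simp only [Data.size] <;> omega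

theorem sz_pos (x : α) : 0 < sz x := (enc x).size_pos

theorem sz_nat (n : ℕ) : sz n = 2 * n + 1 := by
  induction n with
  | zero => rfl
  | succ n ih =>
    have : sz (n + 1) = 1 + 1 + sz n := rfl
    omega

theorem sz_bool_le (b : Bool) : sz b ≤ 3 := by cases b <;> decide

theorem enc_list_eq_nil {l : List α} : enc l = .nil ↔ l = [] := by
  cases l <;> simp [enc_nil, enc_cons]

theorem length_le_sz (l : List α) : l.length ≤ sz l := by
  induction l with
  | nil => simp
  | cons a l ih => rw [sz_cons, List.length_cons]; omega

theorem sz_mem_le {l : List α} {a : α} (h : a ∈ l) : sz a ≤ sz l := by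
  induction l with
  | nil => simp at h
  | cons b l ih =>
    rw [sz_cons]
    rcases List.mem_cons.1 h with rfl | h
    · omega
    · have := ih h; omega

theorem sz_append (l l' : List α) : sz (l ++ l') + 1 = sz l + sz l' := by
  induction l with
  | nil => simp [sz_nil, add_comm]
  | cons a l ih => rw [List.cons_append, sz_cons, sz_cons]; omega

theorem sz_list_le {l : List α} {m : ℕ} (h : ∀ a ∈ l, sz a ≤ m) : sz l ≤ l.length * (m + 1) + 1 := by
  induction l with
  | nil => simp [sz_nil]
  | cons a l ih =>
    have h1 := h a (by simp)
    have h2 := ih fun b hb => h b (by simp [hb])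
    rw [sz_cons, List.length_cons, Nat.succ_mul]; omega

theorem sz_reverse (l : List α) : sz l.reverse = sz l := by
  induction l with
  | nil => rfl
  | cons a l ih =>
    have := sz_append l.reverse [a]
    rw [List.reverse_cons, sz_cons]
    simp only [sz_cons, sz_nil] at this
    omega

theorem PolyTime.polyIn {f : α → β} (h : PolyTime f) : PolyIn sz fun x => sz (f x) := by
  obtain ⟨c, T, hT, -, h⟩ := h
  refine hT.mono fun x => ?_
  obtain ⟨t, v', -, -, -, h⟩ := h 0 x (fun _ => enc x) (fun _ => false) (fun _ => .nil) rfl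
  omega

theorem PolyTime.polyIn_nat {f : α → ℕ} (h : PolyTime f) : PolyIn sz f :=
  h.polyIn.mono fun x => by rw [sz_nat]; omega

/-- Functions that do not change the representing tree. -/
theorem PolyTime.recode {f : α → β} (h : ∀ x, enc (f x) = enc x) : PolyTime f := by
  refine ⟨fun _ => .skip, fun x => 1 + sz x, (PolyIn.const 1).add .self, fun _ => trivial, ?_⟩
  intro b x v r e hv
  exact ⟨1, v, .skip _, by rw [h, hv], fun _ _ => rfl, by simp [sz, h]⟩

theorem PolyTime.id : PolyTime fun x : α => x := .recode fun _ => rfl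

/-- Functions given by one expression. -/
theorem PolyTime.expr {f : α → β} (a : ℕ → Expr) (h : ∀ b v x, v b = enc x → (a b).eval v = enc (f x))
    (hs : PolyIn sz fun x => sz (f x)) : PolyTime f := by
  refine ⟨fun b => .assign b (a b), fun x => (1 + sz (f x)) + sz (f x),
    ((PolyIn.const 1).add hs).add hs, fun _ => trivial, ?_⟩
  intro b x v r e hv
  have := h b v x hv
  refine ⟨_, _, exec_assign b (a b) v r e, by simp [this], fun j hj => ?_, by rw [this]; exact le_rfl⟩
  simp [hj.ne]

/-- A closed expression for a tree. -/
def Data.expr : Data → Expr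
  | .nil => .nil
  | .cons a b => .cons a.expr b.expr

theorem Data.eval_expr (d : Data) (v : ℕ → Data) : d.expr.eval v = d := by
  induction d with
  | nil => rfl
  | cons a b iha ihb => simp [Data.expr, Expr.eval, iha, ihb]

theorem PolyTime.const (y : β) : PolyTime fun _ : α => y :=
  .expr (fun _ => (enc y).expr) (fun _ v _ _ => Data.eval_expr _ v) (PolyIn.const _)

theorem PolyTime.comp {g : β → γ} {f : α → β} (hg : PolyTime g) (hf : PolyTime f) :
    PolyTime fun x => g (f x) := by
  have hfs := hf.polyIn
  obtain ⟨cf, Tf, hTf, hdf, hf⟩ := hf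
  obtain ⟨cg, Tg, hTg, hdg, hg⟩ := hg
  refine ⟨fun b => .seq (cf b) (cg b), fun x => Tf x + Tg (f x), hTf.add (hTg.comp f hfs),
    fun b => ⟨hdf b, hdg b⟩, ?_⟩
  intro b x v r e hv
  obtain ⟨t, v', h1, h2, h3, h4⟩ := hf b x v r e hv
  obtain ⟨t', v'', h1', h2', h3', h4'⟩ := hg b (f x) v' r e h2
  exact ⟨_, _, .seq h1 h1', h2', fun j hj => (h3' j hj).trans (h3 j hj), by dsimp only; omega⟩

theorem PolyTime.pair {f : α → β} {g : α → γ} (hf : PolyTime f) (hg : PolyTime g) :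
    PolyTime fun x => (f x, g x) := by
  obtain ⟨cf, Tf, hTf, hdf, hf⟩ := hf
  obtain ⟨cg, Tg, hTg, hdg, hg⟩ := hg
  refine ⟨fun b => .seq (.assign (b + 1) (.var b)) (.seq (cf (b + 1))
    (.seq (.assign (b + 2) (.var b)) (.seq (cg (b + 2))
      (.assign b (.cons (.var (b + 1)) (.var (b + 2))))))),
    fun x => 2 * Tf x + 2 * Tg x + 2 * sz x + 5,
    ((((PolyIn.const 2).mul hTf).add ((PolyIn.const 2).mul hTg)).add
      ((PolyIn.const 2).mul .self)).add (.const 5),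
    fun b => ⟨trivial, hdf _, trivial, hdg _, trivial⟩, ?_⟩
  intro b x v r e hv
  obtain ⟨t, v', h1, h2, h3, h4⟩ := hf (b + 1) x (Function.update v (b + 1) (v b)) r e (by simp [hv])
  have hb : v' b = enc x := by rw [h3 b (by omega)]; simp [hv]
  obtain ⟨t', v'', h1', h2', h3', h4'⟩ :=
    hg (b + 2) x (Function.update v' (b + 2) (v' b)) r e (by simp [hb])
  have e1 : v'' (b + 1) = enc (f x) := by rw [h3' _ (by omega)]; simp [h2]
  refine ⟨_, _, .seq (exec_assign _ _ v r e) (.seq h1 (.seq (exec_assign _ _ v' r e)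
    (.seq h1' (exec_assign _ _ v'' r e)))), ?_, fun j hj => ?_, ?_⟩
  · simp [Expr.eval, e1, h2', enc_pair]
  · rw [Function.update_of_ne (by omega), h3' _ (by omega), Function.update_of_ne (by omega),
      h3 _ (by omega), Function.update_of_ne (by omega)]
  · simp only [Expr.eval, hv, hb, e1, h2', Data.size]
    rw [sz_pair]
    simp only [sz] at *
    omega

theorem PolyTime.fst : PolyTime fun p : α × β => p.1 :=
  .expr (fun b => .hd (.var b)) (fun b v x h => by simp [Expr.eval, h]; rfl)
    (PolyIn.self.mono fun p => by obtain ⟨a, b⟩ := p; rw [sz_pair]; dsimp only; omega)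

theorem PolyTime.snd : PolyTime fun p : α × β => p.2 :=
  .expr (fun b => .tl (.var b)) (fun b v x h => by simp [Expr.eval, h]; rfl)
    (PolyIn.self.mono fun p => by obtain ⟨a, b⟩ := p; rw [sz_pair]; dsimp only; omega)

theorem PolyTime.cons {f : α → β} {g : α → List β} (hf : PolyTime f) (hg : PolyTime g) :
    PolyTime fun x => f x :: g x :=
  (PolyTime.recode (f := fun p : β × List β => p.1 :: p.2) fun _ => rfl).comp (hf.pair hg)

theorem PolyTime.tail {f : α → List β} (hf : PolyTime f) : PolyTime fun x => (f x).tail :=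
  (PolyTime.expr (f := fun l : List β => l.tail) (fun b => .tl (.var b))
    (fun b v l h => by cases l <;> simp [Expr.eval, h, enc_nil, enc_cons, Data.tl])
    (PolyIn.self.mono fun l => by cases l <;> simp [sz_cons])).comp hf

theorem PolyTime.ite {p : α → Bool} {f g : α → β} (hp : PolyTime p) (hf : PolyTime f)
    (hg : PolyTime g) : PolyTime fun x => if p x then f x else g x := by
  obtain ⟨cp, Tp, hTp, hdp, hp⟩ := hp
  obtain ⟨cf, Tf, hTf, hdf, hf⟩ := hf
  obtain ⟨cg, Tg, hTg, hdg, hg⟩ := hg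
  refine ⟨fun b => .seq (.assign (b + 1) (.var b)) (.seq (cp (b + 1))
    (.ite (b + 1) (cf b) (cg b))),
    fun x => Tp x + Tf x + Tg x + sz x + 2,
    (((hTp.add hTf).add hTg).add .self).add (.const 2),
    fun b => ⟨trivial, hdp _, hdf _, hdg _⟩, ?_⟩
  intro b x v r e hv
  obtain ⟨t, v', h1, h2, h3, h4⟩ := hp (b + 1) x (Function.update v (b + 1) (v b)) r e (by simp [hv])
  have hb : v' b = enc x := by rw [h3 b (by omega)]; simp [hv]
  cases hpx : p x with
  | true =>
    obtain ⟨t', v'', h1', h2', h3', h4'⟩ := hf b x v' r e hb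
    refine ⟨_, _, .seq (exec_assign _ _ v r e) (.seq h1 (.ite_then ?_ h1')), by simpa [hpx] using h2',
      fun j hj => ?_, ?_⟩
    · simp [h2, hpx, enc_true]
    · rw [h3' _ hj, h3 _ (by omega), Function.update_of_ne (by omega)]
    · simp only [Expr.eval, hv, hpx, if_true]
      simp only [sz] at *
      omega
  | false =>
    obtain ⟨t', v'', h1', h2', h3', h4'⟩ := hg b x v' r e hb
    refine ⟨_, _, .seq (exec_assign _ _ v r e) (.seq h1 (.ite_else ?_ h1')), by simpa [hpx] using h2',
      fun j hj => ?_, ?_⟩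
    · simp [h2, hpx, enc_false]
    · rw [h3' _ hj, h3 _ (by omega), Function.update_of_ne (by omega)]
    · simp only [Expr.eval, hv, hpx, Bool.false_eq_true, if_false]
      simp only [sz] at *
      omega

theorem PolyTime.listCases {l : α → List β} {f : α → γ} {g : α → β → List β → γ}
    (hl : PolyTime l) (hf : PolyTime f)
    (hg : PolyTime fun p : α × β × List β => g p.1 p.2.1 p.2.2) :
    PolyTime fun x => match l x with
      | [] => f x
      | a :: l' => g x a l' := by
  have hls := hl.polyIn
  obtain ⟨cl, Tl, hTl, hdl, hl⟩ := hl
  obtain ⟨cf, Tf, hTf, hdf, hf⟩ := hf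
  obtain ⟨cg, Tg, ⟨k, hTg⟩, hdg, hg⟩ := hg
  refine ⟨fun b => .seq (.assign (b + 1) (.var b)) (.seq (cl (b + 1))
    (.ite (b + 1) (.seq (.assign b (.cons (.var b) (.var (b + 1)))) (cg b)) (cf b))),
    fun x => Tl x + Tf x + (sz x + sz (l x) + 3) ^ k + 2 * sz x + sz (l x) + 4,
    ((((hTl.add hTf).add (((PolyIn.self.add hls).add (.const 3)).pow k)).add
      ((PolyIn.const 2).mul .self)).add hls).add (.const 4),
    fun b => ⟨trivial, hdl _, ⟨trivial, hdg _⟩, hdf _⟩, ?_⟩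
  intro b x v r e hv
  obtain ⟨t, v', h1, h2, h3, h4⟩ := hl (b + 1) x (Function.update v (b + 1) (v b)) r e (by simp [hv])
  have hb : v' b = enc x := by rw [h3 b (by omega)]; simp [hv]
  cases hlx : l x with
  | nil =>
    obtain ⟨t', v'', h1', h2', h3', h4'⟩ := hf b x v' r e hb
    refine ⟨_, _, .seq (exec_assign _ _ v r e) (.seq h1 (.ite_else ?_ h1')), by simpa [hlx] using h2',
      fun j hj => ?_, ?_⟩
    · simp [h2, hlx, enc_nil]
    · rw [h3' _ hj, h3 _ (by omega), Function.update_of_ne (by omega)]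
    · simp only [Expr.eval, hv, hlx]
      rw [hlx] at h4
      simp only [sz] at *
      omega
  | cons a l' =>
    obtain ⟨t', v'', h1', h2', h3', h4'⟩ :=
      hg b (x, a, l') (Function.update v' b (.cons (v' b) (v' (b + 1)))) r e
        (by simp [hb, h2, hlx, enc_pair, enc_cons])
    refine ⟨_, _, .seq (exec_assign _ _ v r e) (.seq h1 (.ite_then ?_
      (.seq (exec_assign _ _ v' r e) h1'))), by simpa [hlx] using h2', fun j hj => ?_, ?_⟩
    · simp [h2, hlx, enc_cons]
    · rw [h3' _ hj, Function.update_of_ne (by omega), h3 _ (by omega),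
        Function.update_of_ne (by omega)]
    · have h5 := hTg (x, a, l')
      have h6 : sz (x, a, l') + 2 = sz x + sz (l x) + 3 := by
        rw [hlx, sz_cons, sz_pair, sz_pair]; ring
      rw [h6] at h5
      rw [hlx] at h5 h4
      simp only [Expr.eval, hv, hb, h2, Data.size, hlx]
      simp only [sz] at *
      omega

/-- A polynomial-time step may square the accumulator each time, so polynomial time of the step is
not enough: the bound `B` on every intermediate accumulator is what keeps the loop polynomial. -/
theorem PolyTime.foldl {l : α → List β} {i : α → γ} {g : α → γ → β → γ}
    (hl : PolyTime l) (hi : PolyTime i)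
    (hg : PolyTime fun p : α × γ × β => g p.1 p.2.1 p.2.2) {B : α → ℕ} (hB : PolyIn sz B)
    (hsz : ∀ x l', l' <+: l x → sz (l'.foldl (g x) (i x)) ≤ B x) :
    PolyTime fun x => (l x).foldl (g x) (i x) := by
  have hls := hl.polyIn
  obtain ⟨cl, Tl, hTl, hdl, hl⟩ := hl
  obtain ⟨ci, Ti, hTi, hdi, hi⟩ := hi
  obtain ⟨cg, Tg, ⟨k, hTg⟩, hdg, hg⟩ := hg
  -- `S` bounds the size of the argument `(x, acc, a)` of one step, with the 2 of `PolyIn` added;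
  -- `U` bounds the time of one round, including the copying.
  let S : α → ℕ := fun x => sz x + B x + sz (l x) + 4
  let U : α → ℕ := fun x => S x ^ k + S x + B x + sz (l x) + 4
  have hS : PolyIn sz S := ((PolyIn.self.add hB).add hls).add (.const 4)
  have hU : PolyIn sz U := ((((hS.pow k).add hS).add hB).add hls).add (.const 4)
  refine ⟨fun b => .seq (.assign (b + 1) (.var b)) (.seq (cl (b + 1))
    (.seq (.assign (b + 2) (.var b)) (.seq (ci (b + 2))
    (.seq (.loop (b + 1)
      (.seq (.assign (b + 3) (.cons (.var b) (.cons (.var (b + 2)) (.hd (.var (b + 1))))))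
      (.seq (cg (b + 3)) (.seq (.assign (b + 2) (.var (b + 3)))
        (.assign (b + 1) (.tl (.var (b + 1))))))))
    (.assign b (.var (b + 2))))))),
    fun x => Tl x + Ti x + 2 * sz x + sz (l x) * (U x + 1) + 2 * B x + 4,
    ((((hTl.add hTi).add ((PolyIn.const 2).mul .self)).add (hls.mul (hU.add (.const 1)))).add
      ((PolyIn.const 2).mul hB)).add (.const 4),
    fun b => ⟨trivial, hdl _, trivial, hdi _, ⟨trivial, hdg _, trivial, trivial⟩, trivial⟩, ?_⟩
  intro b x v r e hv
  obtain ⟨t1, v1, h1, h2, h3, h4⟩ :=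
    hl (b + 1) x (Function.update v (b + 1) (v b)) r e (by simp [hv])
  have hb : v1 b = enc x := by rw [h3 b (by omega)]; simp [hv]
  obtain ⟨t2, v2, k1, k2, k3, k4⟩ :=
    hi (b + 2) x (Function.update v1 (b + 2) (v1 b)) r e (by simp [hb])
  have hb2 : v2 b = enc x := by rw [k3 b (by omega)]; simp [hb]
  have hb21 : v2 (b + 1) = enc (l x) := by rw [k3 _ (by omega)]; simp [h2]
  let R : ℕ → State → Prop := fun m s => ∃ w done rest, s = ⟨w, r, e⟩ ∧ l x = done ++ rest ∧
    rest.length = m ∧ w b = enc x ∧ w (b + 1) = enc rest ∧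
    w (b + 2) = enc (done.foldl (g x) (i x)) ∧ ∀ j < b, w j = v j
  obtain ⟨t3, s3, m1, m2, m3⟩ := exec_loop (i := b + 1) (B := U x)
    (c := (.seq (.assign (b + 3) (.cons (.var b) (.cons (.var (b + 2)) (.hd (.var (b + 1))))))
      (.seq (cg (b + 3)) (.seq (.assign (b + 2) (.var (b + 3)))
        (.assign (b + 1) (.tl (.var (b + 1)))))))) R
    (by
      rintro s ⟨w, done, rest, rfl, -, hr, -, hw, -⟩
      rw [List.length_eq_zero_iff] at hr
      simp [hw, hr, enc_nil])
    (by
      rintro m s ⟨w, done, rest, rfl, hd, hr, hw0, hw1, hw2, hlow⟩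
      obtain _ | ⟨a, rest⟩ := rest
      · simp at hr
      refine ⟨by simp [hw1, enc_cons], ?_⟩
      set acc := done.foldl (g x) (i x) with hacc
      obtain ⟨t, w', j1, j2, j3, j4⟩ := hg (b + 3) (x, acc, a)
        (Function.update w (b + 3) (.cons (w b) (.cons (w (b + 2)) (w (b + 1)).hd))) r e
        (by simp [hw0, hw1, hw2, enc_pair, enc_cons, Data.hd])
      have n0 : w' b = enc x := by rw [j3 b (by omega)]; simp [hw0]
      have n1 : w' (b + 1) = enc (a :: rest) := by rw [j3 _ (by omega)]; simp [hw1]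
      have hfold : g x acc a = (done ++ [a]).foldl (g x) (i x) := by simp [hacc]
      refine ⟨_, _, .seq (exec_assign _ _ w r e) (.seq j1 (.seq (exec_assign _ _ w' r e)
        (exec_assign _ _ _ r e))), ?_, _, done ++ [a], rest, rfl, by simp [hd],
          by simpa using hr, ?_, ?_, ?_, ?_⟩
      · have q1 : sz acc ≤ B x := hsz x done (by rw [hd]; exact List.prefix_append _ _)
        have q2 : sz (g x acc a) ≤ B x := by
          rw [hfold]; exact hsz x _ ⟨rest, by simp [hd]⟩
        have q3 : sz a + sz rest + 1 ≤ sz (l x) := by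
          have := sz_append done (a :: rest)
          rw [← hd, sz_cons] at this
          have := sz_pos done
          omega
        have q4 := hTg (x, acc, a)
        have q5 : (sz (x, acc, a) + 2) ^ k ≤ S x ^ k := Nat.pow_le_pow_left (by
          rw [sz_pair, sz_pair]; simp only [S]; omega) k
        simp [Expr.eval, hw0, hw1, hw2, j2, n1, enc_cons, Data.hd, Data.tl, Data.size]
        simp only [U, S, sz] at *
        omega
      · simp [n0]
      · simp [Expr.eval, n1, enc_cons, Data.tl]
      · simp [Expr.eval, j2, hacc]
      · intro j hj
        rw [Function.update_of_ne (by omega), Function.update_of_ne (by omega), j3 _ (by omega),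
          Function.update_of_ne (by omega), hlow j hj])
    (l x).length ⟨v2, r, e⟩ ⟨v2, [], l x, rfl, by simp, rfl, hb2, hb21, by simpa using k2,
      fun j hj => by
        rw [k3 _ (by omega), Function.update_of_ne (by omega), h3 _ (by omega),
          Function.update_of_ne (by omega)]⟩
  obtain ⟨w, done, rest, rfl, hd, hr, hw0, hw1, hw2, hlow⟩ := m3
  rw [List.length_eq_zero_iff] at hr
  subst hr
  rw [List.append_nil] at hd
  subst hd
  refine ⟨_, _, .seq (exec_assign _ _ v r e) (.seq h1 (.seq (exec_assign _ _ v1 r e) (.seq k1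
    (.seq m1 (exec_assign _ _ w r e))))), by simp [Expr.eval, hw2], fun j hj => ?_, ?_⟩
  · rw [Function.update_of_ne (by omega), hlow j hj]
  · have q1 := hsz x (l x) (List.prefix_refl _)
    have q2 : (l x).length * (U x + 1) ≤ sz (l x) * (U x + 1) :=
      Nat.mul_le_mul_right _ (length_le_sz _)
    simp only [Expr.eval, hv, hb, hw2]
    simp only [sz] at *
    omega

end PolyTime

/-! ### Unary arithmetic, lists and tree traversal in polynomial time -/

section PolyTimeLibrary

variable {α β γ δ : Type} [Enc α] [Enc β] [Enc γ] [Enc δ]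

theorem sz_prefix_le {l' l : List α} (h : l' <+: l) : sz l' ≤ sz l := by
  obtain ⟨l'', rfl⟩ := h
  have := sz_append l' l''
  have := sz_pos l''
  omega

theorem PolyTime.congr {f g : α → β} (hf : PolyTime f) (h : ∀ x, g x = f x) : PolyTime g := by
  rwa [funext h]

theorem PolyTime.not {p : α → Bool} (hp : PolyTime p) : PolyTime fun x => !p x :=
  (hp.ite (.const false) (.const true)).congr fun x => by cases p x <;> rfl

theorem PolyTime.and {p q : α → Bool} (hp : PolyTime p) (hq : PolyTime q) :
    PolyTime fun x => p x && q x :=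
  (hp.ite hq (.const false)).congr fun x => by cases p x <;> rfl

theorem PolyTime.isEmpty {l : α → List β} (hl : PolyTime l) : PolyTime fun x => (l x).isEmpty :=
  (hl.listCases (.const true) (.const false)).congr fun x => by cases l x <;> rfl

/-- A unary number and a list of units are the same tree, so arithmetic reduces to list operations
at no cost. -/
theorem enc_replicate (n : ℕ) : enc (List.replicate n ()) = enc n := by
  simp [enc, Data.ofNat]

theorem PolyTime.units {n : α → ℕ} (hn : PolyTime n) :
    PolyTime fun x => List.replicate (n x) () :=
  (PolyTime.recode enc_replicate).comp hn

theorem enc_length (l : List Unit) : enc l.length = enc l := by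
  rw [← enc_replicate, ← List.eq_replicate_of_mem fun a _ => rfl]

theorem PolyTime.iterate {n : α → ℕ} {i : α → γ} {g : α → γ → γ}
    (hn : PolyTime n) (hi : PolyTime i) (hg : PolyTime fun p : α × γ => g p.1 p.2) {B : α → ℕ}
    (hB : PolyIn sz B) (hsz : ∀ x, ∀ m ≤ n x, sz ((g x)^[m] (i x)) ≤ B x) :
    PolyTime fun x => (g x)^[n x] (i x) := by
  refine (PolyTime.foldl (g := fun x acc (_ : Unit) => g x acc) hn.units hi
    (hg.comp (PolyTime.fst.pair (.comp .fst .snd))) hB fun x l' h => ?_).congr fun x => ?_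
  · rw [List.foldl_const]
    exact hsz x _ (by simpa using h.length_le)
  · rw [List.foldl_const, List.length_replicate]

theorem PolyTime.succ {n : α → ℕ} (hn : PolyTime n) : PolyTime fun x => n x + 1 :=
  ((PolyTime.recode (f := fun l : List Unit => l.length) enc_length).comp
    ((PolyTime.const ()).cons hn.units)).congr fun x => by simp

theorem PolyTime.pred {n : α → ℕ} (hn : PolyTime n) : PolyTime fun x => n x - 1 :=
  ((PolyTime.recode (f := fun l : List Unit => l.length) enc_length).comp
    hn.units.tail).congr fun x => by simp

theorem PolyTime.add {m n : α → ℕ} (hm : PolyTime m) (hn : PolyTime n) :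
    PolyTime fun x => m x + n x := by
  have key (x : α) (k : ℕ) : (fun a => a + 1)^[k] (m x) = m x + k := by
    induction k with
    | zero => rfl
    | succ k ih => rw [Function.iterate_succ_apply', ih]; rfl
  refine (PolyTime.iterate (g := fun _ a => a + 1) hn hm (PolyTime.snd.succ)
    (((PolyIn.const 2).mul (hm.polyIn_nat.add hn.polyIn_nat)).add (.const 1))
    fun x k hk => ?_).congr fun x => (key x _).symm
  rw [key, sz_nat]
  omega

theorem PolyTime.sub {m n : α → ℕ} (hm : PolyTime m) (hn : PolyTime n) :
    PolyTime fun x => m x - n x := by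
  have key (x : α) (k : ℕ) : (fun a => a - 1)^[k] (m x) = m x - k := by
    induction k with
    | zero => rfl
    | succ k ih => rw [Function.iterate_succ_apply', ih]; omega
  refine (PolyTime.iterate (g := fun _ a => a - 1) hn hm (PolyTime.snd.pred)
    (((PolyIn.const 2).mul hm.polyIn_nat).add (.const 1))
    fun x k hk => ?_).congr fun x => (key x _).symm
  rw [key, sz_nat]
  omega

theorem PolyTime.mul {m n : α → ℕ} (hm : PolyTime m) (hn : PolyTime n) :
    PolyTime fun x => m x * n x := by
  have key (x : α) (k : ℕ) : (fun a => a + m x)^[k] 0 = m x * k := by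
    induction k with
    | zero => rfl
    | succ k ih => rw [Function.iterate_succ_apply', ih]; rfl
  refine (PolyTime.iterate (g := fun x a => a + m x) hn (.const 0)
    (PolyTime.snd.add (hm.comp .fst))
    (((PolyIn.const 2).mul (hm.polyIn_nat.mul hn.polyIn_nat)).add (.const 1))
    fun x k hk => ?_).congr fun x => (key x _).symm
  rw [key, sz_nat]
  have := Nat.mul_le_mul_left (m x) hk
  omega

theorem PolyTime.pow {m : α → ℕ} (hm : PolyTime m) (k : ℕ) : PolyTime fun x => m x ^ k := by
  induction k with
  | zero => exact (PolyTime.const 1).congr fun x => pow_zero _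
  | succ k ih => exact (ih.mul hm).congr fun x => pow_succ _ _

theorem PolyTime.le {m n : α → ℕ} (hm : PolyTime m) (hn : PolyTime n) :
    PolyTime fun x => decide (m x ≤ n x) :=
  (hm.sub hn).units.isEmpty.congr fun x => by
    rw [Bool.eq_iff_iff]; simp [Nat.sub_eq_zero_iff_le]

theorem PolyTime.mod {m n : α → ℕ} (hm : PolyTime m) (hn : PolyTime n) :
    PolyTime fun x => m x % n x := by
  -- A counter that wraps around at `n x`. For `n x = 0` it never wraps, in agreement with `k % 0 =
  -- k`.
  have key (x : α) (k : ℕ) :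
      (fun a => if decide (n x = 0) = false ∧ n x ≤ a + 1 then 0 else a + 1)^[k] 0 = k % n x := by
    induction k with
    | zero => simp
    | succ k ih =>
      rw [Function.iterate_succ_apply', ih, Nat.add_mod k 1]
      rcases Nat.eq_zero_or_pos (n x) with h | h
      · simp [h]
      · have := Nat.mod_lt k h
        rcases eq_or_ne (n x) 1 with h1 | h1
        · simp [h1, Nat.mod_one]
        · rw [Nat.mod_eq_of_lt (a := 1) (by omega)]
          split_ifs with h2
          · rw [show k % n x + 1 = n x by omega, Nat.mod_self]
          · simp only [decide_eq_false_iff_not, not_and, not_le] at h2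
            rw [Nat.mod_eq_of_lt (h2 (by omega))]
  refine (PolyTime.iterate (g := fun x a => if !decide (n x ≤ 0) && decide (n x ≤ a + 1) then 0
    else a + 1) hm (.const 0) ((((hn.comp .fst).le (.const 0)).not.and
      ((hn.comp .fst).le PolyTime.snd.succ)).ite (.const 0) PolyTime.snd.succ)
    (((PolyIn.const 2).mul hm.polyIn_nat).add (.const 1)) fun x k hk => ?_).congr fun x => ?_
  · simp only [Nat.le_zero, Bool.and_eq_true, Bool.not_eq_true', decide_eq_true_eq]
    rw [key, sz_nat]
    have := Nat.mod_le k (n x)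
    omega
  · simp only [Nat.le_zero, Bool.and_eq_true, Bool.not_eq_true', decide_eq_true_eq]
    rw [key]

theorem PolyTime.reverse {l : α → List β} (hl : PolyTime l) : PolyTime fun x => (l x).reverse := by
  refine (PolyTime.foldl (i := fun _ => ([] : List β)) (g := fun _ acc a => a :: acc) hl (.const [])
    (.cons (.comp .snd .snd) (.comp .fst .snd)) hl.polyIn fun x l' h => ?_).congr fun x => ?_
  · rw [List.foldl_flip_cons_eq_append', List.append_nil, sz_reverse]
    exact sz_prefix_le h
  · rw [List.foldl_flip_cons_eq_append', List.append_nil]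

theorem PolyTime.append {l l' : α → List β} (hl : PolyTime l) (hl' : PolyTime l') :
    PolyTime fun x => l x ++ l' x := by
  refine (PolyTime.foldl (i := l') (g := fun _ acc a => a :: acc) hl.reverse hl'
    (.cons (.comp .snd .snd) (.comp .fst .snd)) (hl.polyIn.add hl'.polyIn)
    fun x m h => ?_).congr fun x => ?_
  · rw [List.foldl_flip_cons_eq_append']
    have h1 := sz_append m.reverse (l' x)
    have h2 := sz_prefix_le h
    rw [sz_reverse] at h1 h2
    omega
  · rw [List.foldl_flip_cons_eq_append', List.reverse_reverse]

theorem PolyTime.map {l : α → List β} {g : α → β → γ} (hl : PolyTime l)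
    (hg : PolyTime fun p : α × β => g p.1 p.2) : PolyTime fun x => (l x).map (g x) := by
  have key (x : α) (l : List β) :
      l.foldl (fun acc a => g x a :: acc) [] = (l.map (g x)).reverse := by
    rw [List.foldl_flip_cons_eq_append, List.append_nil]
  obtain ⟨k, hk⟩ := hg.polyIn
  refine (PolyTime.foldl (i := fun _ => ([] : List γ)) (g := fun x acc a => g x a :: acc) hl
    (.const []) (.cons (hg.comp (PolyTime.fst.pair (.comp .snd .snd))) (.comp .fst .snd))
    (B := fun x => sz (l x) * ((sz x + sz (l x) + 3) ^ k + 1) + 1)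
    ((hl.polyIn.mul ((((PolyIn.self.add hl.polyIn).add (.const 3)).pow k).add
      (.const 1))).add (.const 1)) fun x l' h => ?_).reverse.congr fun x => ?_
  · rw [key, sz_reverse]
    refine (sz_list_le (m := (sz x + sz (l x) + 3) ^ k) fun c hc => ?_).trans ?_
    · obtain ⟨a, ha, rfl⟩ := List.mem_map.1 hc
      have h1 := sz_mem_le (h.subset ha)
      refine (hk (x, a)).trans (Nat.pow_le_pow_left ?_ k)
      rw [sz_pair]; omega
    · have h1 := (h.length_le).trans (length_le_sz (l x))
      rw [List.length_map]
      gcongr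
  · rw [key, List.reverse_reverse]

theorem PolyTime.sum {l : α → List ℕ} (hl : PolyTime l) : PolyTime fun x => (l x).sum := by
  have h0 (l : List ℕ) : 2 * l.sum + 1 ≤ sz l := by
    induction l with
    | nil => simp [sz_nil]
    | cons a l ih => rw [sz_cons, sz_nat, List.sum_cons]; omega
  have key (l : List ℕ) : l.foldl (fun acc a => acc + a) 0 = l.sum := by
    rw [List.sum_eq_foldl]
  refine (PolyTime.foldl (i := fun _ => 0) (g := fun _ acc a => acc + a) hl (.const 0)
    (.add (.comp .fst .snd) (.comp .snd .snd)) hl.polyIn fun x l' h => ?_).congr fun x => ?_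
  · rw [key, sz_nat]
    exact (h0 l').trans (sz_prefix_le h)
  · rw [key]

theorem PolyTime.length {l : α → List β} (hl : PolyTime l) : PolyTime fun x => (l x).length :=
  (hl.map (g := fun _ _ => 1) (.const 1)).sum.congr fun x => by simp

theorem PolyTime.flatten {l : α → List (List β)} (hl : PolyTime l) :
    PolyTime fun x => (l x).flatten := by
  have h0 (l : List (List β)) : sz l.flatten ≤ sz l := by
    induction l with
    | nil => simp [sz_nil]
    | cons a l ih =>
      have := sz_append a l.flatten
      rw [sz_cons, List.flatten_cons]; omega
  have key (l : List (List β)) : l.foldl (fun acc a => acc ++ a) [] = l.flatten := by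
    suffices ∀ m : List β, l.foldl (fun acc a => acc ++ a) m = m ++ l.flatten by simpa using this []
    induction l with
    | nil => simp
    | cons a l ih => intro m; rw [List.foldl_cons, ih, List.flatten_cons, List.append_assoc]
  refine (PolyTime.foldl (i := fun _ => ([] : List β)) (g := fun _ acc a => acc ++ a) hl (.const [])
    (.append (.comp .fst .snd) (.comp .snd .snd)) hl.polyIn fun x l' h => ?_).congr fun x => ?_
  · rw [key]
    exact (h0 l').trans (sz_prefix_le h)
  · rw [key]

theorem PolyTime.replicate {n : α → ℕ} {a : α → β} (hn : PolyTime n) (ha : PolyTime a) :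
    PolyTime fun x => List.replicate (n x) (a x) :=
  (hn.units.map (g := fun x _ => a x) (ha.comp .fst)).congr fun x => by simp

theorem PolyTime.getD {l : α → List β} {n : α → ℕ} (hl : PolyTime l) (hn : PolyTime n) (d : β) :
    PolyTime fun x => (l x).getD (n x) d := by
  have key (l : List β) (k : ℕ) : List.tail^[k] l = l.drop k := by
    induction k with
    | zero => rfl
    | succ k ih => rw [Function.iterate_succ_apply', ih, List.tail_drop]
  refine (PolyTime.listCases (l := fun x => List.tail^[n x] (l x)) (f := fun _ => d)
    (g := fun _ a _ => a) (PolyTime.iterate (g := fun _ l => l.tail) hn hl (PolyTime.snd.tail)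
      hl.polyIn fun x k hk => ?_) (.const d) (.comp .fst .snd)).congr fun x => ?_
  · rw [key]
    have h1 := sz_append ((l x).take k) ((l x).drop k)
    rw [List.take_append_drop] at h1
    have := sz_pos ((l x).take k)
    omega
  · rw [key]
    rw [List.getD_eq_getElem?_getD, ← List.head?_drop]
    cases (l x).drop (n x) <;> rfl

theorem PolyTime.eq {p q : α → Bool} (hp : PolyTime p) (hq : PolyTime q) :
    PolyTime fun x => p x == q x :=
  (hp.ite hq hq.not).congr fun x => by cases p x <;> cases q x <;> rfl

/-- One step of a traversal of the trees on a stack. -/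
def popTree : List Data → List Data
  | [] => []
  | .nil :: l => l
  | .cons a b :: l => a :: b :: l

/-- Each step consumes exactly one node of the trees on the stack, so the stack is empty precisely
when the number of steps has reached the total size. This makes size comparisons computable. -/
theorem popTree_iterate (k : ℕ) (l : List Data) :
    popTree^[k] l = [] ↔ (l.map Data.size).sum ≤ k := by
  induction k generalizing l with
  | zero =>
    cases l with
    | nil => simp
    | cons d l => have := d.size_pos; simp; omega
  | succ k ih =>
    rw [Function.iterate_succ_apply, ih]
    rcases l with _ | ⟨_ | ⟨a, b⟩, l⟩ <;> simp [popTree, Data.size] <;> omega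

/-- Any tree is a list of trees. -/
def Data.toList : Data → List Data
  | .nil => []
  | .cons a b => a :: b.toList

theorem Data.enc_toList (d : Data) : enc d.toList = d := by
  induction d with
  | nil => rfl
  | cons a b _ ih => rw [Data.toList, enc_cons, ih]; rfl

theorem Data.toList_enc (l : List Data) : (enc l).toList = l := by
  induction l with
  | nil => rfl
  | cons a l ih => rw [enc_cons, Data.toList, ih]; rfl

theorem PolyTime.toList {d : α → Data} (hd : PolyTime d) : PolyTime fun x => (d x).toList :=
  (PolyTime.recode Data.enc_toList).comp hd

theorem PolyTime.popTree {l : α → List Data} (hl : PolyTime l) :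
    PolyTime fun x => popTree (l x) := by
  have hc : PolyTime fun d : Data => match d.toList with
      | [] => ([] : List Data)
      | a :: t => [a, enc t] :=
    (PolyTime.listCases (f := fun _ => []) (g := fun _ a t => [a, enc t]) PolyTime.id.toList
      (.const []) (.cons (.comp .fst .snd)
        (.cons ((PolyTime.recode (f := fun t : List Data => enc t) fun _ => rfl).comp
          (.comp .snd .snd)) (.const [])))).congr fun d => by cases d.toList <;> rfl
  refine (PolyTime.listCases (f := fun _ => []) (g := fun _ a t => (match a.toList with
      | [] => ([] : List Data)
      | a :: t => [a, enc t]) ++ t) hl (.const [])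
    (.append (hc.comp (.comp .fst .snd)) (.comp .snd .snd))).congr fun x => ?_
  rcases l x with _ | ⟨_ | ⟨a, b⟩, m⟩
  · rfl
  · rfl
  · simp [DistPAC.popTree, Data.toList, Data.enc_toList]

theorem sz_popTree_le (l : List Data) : sz (popTree l) ≤ sz l := by
  rcases l with _ | ⟨_ | ⟨a, b⟩, m⟩
  · exact le_rfl
  · simp [popTree, sz_cons]
  · simp only [popTree, sz_cons, sz_data, Data.size]; omega

theorem PolyTime.sum_size_le {l : α → List Data} {m : α → ℕ} (hl : PolyTime l) (hm : PolyTime m) :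
    PolyTime fun x => decide (((l x).map Data.size).sum ≤ m x) := by
  refine (PolyTime.iterate (g := fun _ l => DistPAC.popTree l) hm hl
    PolyTime.snd.popTree hl.polyIn fun x k _ => ?_).isEmpty.congr fun x => ?_
  · induction k with
    | zero => exact le_rfl
    | succ k ih =>
      rw [Function.iterate_succ_apply']
      exact (sz_popTree_le _).trans (ih (by omega))
  · rw [Bool.eq_iff_iff, List.isEmpty_iff, popTree_iterate]
    simp

theorem PolyTime.left {f : α → β × γ} (hf : PolyTime f) : PolyTime fun x => (f x).1 := .comp .fst hf

theorem PolyTime.right {f : α → β × γ} (hf : PolyTime f) : PolyTime fun x => (f x).2 := .comp .snd hf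

end PolyTimeLibrary

/-! ### Running a program inside another one -/

theorem Exec.det {c : Cmd} {s s' : State} {t : ℕ} (h : Exec c s t s') :
    ∀ {t₂ : ℕ} {s₂ : State}, Exec c s t₂ s₂ → t = t₂ ∧ s' = s₂ := by
  induction h with
  | skip s => intro _ _ h; cases h; exact ⟨rfl, rfl⟩
  | assign i e s => intro _ _ h; cases h; exact ⟨rfl, rfl⟩
  | seq _ _ ih1 ih2 =>
    intro _ _ h
    cases h with
    | seq h1 h2 =>
      obtain ⟨rfl, rfl⟩ := ih1 h1
      obtain ⟨rfl, rfl⟩ := ih2 h2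
      exact ⟨rfl, rfl⟩
  | ite_then hn _ ih =>
    intro _ _ h
    cases h with
    | ite_then _ h1 => obtain ⟨rfl, rfl⟩ := ih h1; exact ⟨rfl, rfl⟩
    | ite_else hn' _ => exact absurd hn' hn
  | ite_else hn _ ih =>
    intro _ _ h
    cases h with
    | ite_then hn' _ => exact absurd hn hn'
    | ite_else _ h1 => obtain ⟨rfl, rfl⟩ := ih h1; exact ⟨rfl, rfl⟩
  | loop_done hn =>
    intro _ _ h
    cases h with
    | loop_done _ => exact ⟨rfl, rfl⟩
    | loop_step hn' _ _ => exact absurd hn hn'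
  | loop_step hn _ _ ih1 ih2 =>
    intro _ _ h
    cases h with
    | loop_done hn' => exact absurd hn' hn
    | loop_step _ h1 h2 =>
      obtain ⟨rfl, rfl⟩ := ih1 h1
      obtain ⟨rfl, rfl⟩ := ih2 h2
      exact ⟨rfl, rfl⟩
  | flip i s => intro _ _ h; cases h; exact ⟨rfl, rfl⟩
  | sample i s => intro _ _ h; cases h; exact ⟨rfl, rfl⟩

/-- Values grow at most linearly in the running time. -/
theorem Exec.size_le {c : Cmd} {s s' : State} {t : ℕ} (h : Exec c s t s') (i : ℕ) :
    (s'.store i).size ≤ (s.store i).size + 3 * t := by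
  -- A variable is either untouched or its final content was written by a single instruction. The
  -- factor 3 comes from `flip`, which writes up to three nodes at cost 1.
  suffices s'.store i = s.store i ∨ (s'.store i).size ≤ 3 * t by
    rcases this with h | h
    · rw [h]; omega
    · omega
  induction h with
  | skip s => exact .inl rfl
  | assign j e s =>
    by_cases hj : i = j
    · subst hj; right; simp; omega
    · left; simp [hj]
  | seq _ _ ih1 ih2 =>
    rcases ih2 with h | h
    · rw [h]; rcases ih1 with h' | h'
      · exact .inl h'
      · right; omega
    · right; omega
  | ite_then hn _ ih => rcases ih with h | h; exacts [.inl h, .inr (by omega)]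
  | ite_else hn _ ih => rcases ih with h | h; exacts [.inl h, .inr (by omega)]
  | loop_done hn => exact .inl rfl
  | loop_step hn _ _ ih1 ih2 =>
    rcases ih2 with h | h
    · rw [h]; rcases ih1 with h' | h'
      · exact .inl h'
      · right; omega
    · right; omega
  | flip j s =>
    by_cases hj : i = j
    · subst hj; right
      cases s.coins 0 <;> simp [Data.ofBool, Data.size]
    · left; simp [hj]
  | sample j s =>
    by_cases hj : i = j
    · subst hj; right; simp; omega
    · left; simp [hj]

/-- All variables are below this bound. -/
def Expr.bound : Expr → ℕ
  | .nil => 0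
  | .var i => i + 1
  | .cons a b => max a.bound b.bound
  | .hd a => a.bound
  | .tl a => a.bound

/-- All variables are below this bound. -/
def Cmd.bound : Cmd → ℕ
  | .skip => 0
  | .assign i e => max (i + 1) e.bound
  | .seq c d => max c.bound d.bound
  | .ite i c d => max (i + 1) (max c.bound d.bound)
  | .loop i c => max (i + 1) c.bound
  | .flip i => i + 1
  | .sample i => i + 1

/-- Shift the variables by `o`. -/
def Expr.shift (o : ℕ) : Expr → Expr
  | .nil => .nil
  | .var i => .var (o + i)
  | .cons a b => .cons (a.shift o) (b.shift o)
  | .hd a => .hd (a.shift o)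
  | .tl a => .tl (a.shift o)

/-- Shift the variables by `o`, and call the program `sm i` in place of the example oracle. -/
def Cmd.embed (o : ℕ) (sm : ℕ → Cmd) : Cmd → Cmd
  | .skip => .skip
  | .assign i e => .assign (o + i) (e.shift o)
  | .seq c d => .seq (c.embed o sm) (d.embed o sm)
  | .ite i c d => .ite (o + i) (c.embed o sm) (d.embed o sm)
  | .loop i c => .loop (o + i) (c.embed o sm)
  | .flip i => .flip (o + i)
  | .sample i => sm i

theorem Expr.eval_shift {o w : ℕ} {v V : ℕ → Data} (h : ∀ j < w, V (o + j) = v j) :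
    ∀ {e : Expr}, e.bound ≤ w → (e.shift o).eval V = e.eval v
  | .nil, _ => rfl
  | .var i, hw => h i hw
  | .cons a b, hw => by
    simp only [Expr.bound, sup_le_iff] at hw
    simp [Expr.shift, Expr.eval, eval_shift h hw.1, eval_shift h hw.2]
  | .hd a, hw => by simp [Expr.shift, Expr.eval, eval_shift h (e := a) hw]
  | .tl a, hw => by simp [Expr.shift, Expr.eval, eval_shift h (e := a) hw]

theorem Cmd.Deterministic.embed {o : ℕ} {sm : ℕ → Cmd} :
    ∀ {c : Cmd}, c.Deterministic → (c.embed o sm).Deterministic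
  | .skip, _ => trivial
  | .assign _ _, _ => trivial
  | .seq _ _, h => ⟨embed h.1, embed h.2⟩
  | .ite _ _ _, h => ⟨embed h.1, embed h.2⟩
  | .loop _ c, h => embed (c := c) h

theorem shift_update {o w i : ℕ} {v V : ℕ → Data} (h : ∀ j < w, V (o + j) = v j) (d : Data) :
    (∀ j < w, Function.update V (o + i) d (o + j) = Function.update v i d j) ∧
      ∀ j < o, Function.update V (o + i) d j = V j := by
  refine ⟨fun j hj => ?_, fun j hj => Function.update_of_ne (by omega) _ _⟩
  by_cases hji : j = i
  · simp [hji]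
  · rw [Function.update_of_ne (by omega), Function.update_of_ne hji, h j hj]

/-- A deterministic program never reads coins or examples, so it may be run in shifted variables
with whatever streams the host has, at the same cost. -/
theorem Exec.embed_deterministic {o w : ℕ} {sm : ℕ → Cmd} {c : Cmd} {s s' : State} {t : ℕ}
    (h : Exec c s t s') (hd : c.Deterministic) (hw : c.bound ≤ w) (V : ℕ → Data) (r : ℕ → Bool)
    (e : ℕ → Data) (hV : ∀ j < w, V (o + j) = s.store j) :
    ∃ V', Exec (c.embed o sm) ⟨V, r, e⟩ t ⟨V', r, e⟩ ∧ (∀ j < w, V' (o + j) = s'.store j) ∧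
      ∀ j < o, V' j = V j := by
  induction h generalizing V with
  | skip s => exact ⟨V, .skip _, hV, fun _ _ => rfl⟩
  | assign i a s =>
    simp only [Cmd.bound, sup_le_iff] at hw
    have := exec_assign (o + i) (a.shift o) V r e
    rw [Expr.eval_shift hV hw.2] at this
    exact ⟨_, this, shift_update hV _⟩
  | seq _ _ ih1 ih2 =>
    simp only [Cmd.bound, sup_le_iff] at hw
    obtain ⟨V1, a1, a2, a3⟩ := ih1 hd.1 hw.1 V hV
    obtain ⟨V2, b1, b2, b3⟩ := ih2 hd.2 hw.2 V1 a2
    exact ⟨V2, .seq a1 b1, b2, fun j hj => (b3 j hj).trans (a3 j hj)⟩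
  | ite_then hn _ ih =>
    simp only [Cmd.bound, sup_le_iff] at hw
    obtain ⟨V1, a1, a2, a3⟩ := ih hd.1 hw.2.1 V hV
    exact ⟨V1, .ite_then (by rwa [← hV _ hw.1] at hn) a1, a2, a3⟩
  | ite_else hn _ ih =>
    simp only [Cmd.bound, sup_le_iff] at hw
    obtain ⟨V1, a1, a2, a3⟩ := ih hd.2 hw.2.2 V hV
    exact ⟨V1, .ite_else (by rwa [← hV _ hw.1] at hn) a1, a2, a3⟩
  | loop_done hn =>
    simp only [Cmd.bound, sup_le_iff] at hw
    exact ⟨V, .loop_done (by rwa [← hV _ hw.1] at hn), hV, fun _ _ => rfl⟩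
  | loop_step hn _ _ ih1 ih2 =>
    obtain ⟨V1, a1, a2, a3⟩ := ih1 hd (by simp only [Cmd.bound, sup_le_iff] at hw; exact hw.2) V hV
    obtain ⟨V2, b1, b2, b3⟩ := ih2 hd hw V1 a2
    simp only [Cmd.bound, sup_le_iff] at hw
    exact ⟨V2, .loop_step (by rwa [← hV _ hw.1] at hn) a1 b1, b2,
      fun j hj => (b3 j hj).trans (a3 j hj)⟩
  | flip => exact hd.elim
  | sample => exact hd.elim

/-- Empty the `w` variables from `o` on. -/
def clear (o : ℕ) : ℕ → Cmd
  | 0 => .skip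
  | w + 1 => .seq (clear o w) (.assign (o + w) .nil)

theorem clear_deterministic (o w : ℕ) : (clear o w).Deterministic := by
  induction w with
  | zero => trivial
  | succ w ih => exact ⟨ih, trivial⟩

theorem exec_clear (o w : ℕ) (V : ℕ → Data) (r : ℕ → Bool) (e : ℕ → Data) :
    ∃ V', Exec (clear o w) ⟨V, r, e⟩ (2 * w + 1) ⟨V', r, e⟩ ∧ (∀ j < w, V' (o + j) = .nil) ∧
      ∀ j < o, V' j = V j := by
  induction w with
  | zero => exact ⟨V, .skip _, by simp, fun _ _ => rfl⟩
  | succ w ih =>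
    obtain ⟨V', h1, h2, h3⟩ := ih
    refine ⟨Function.update V' (o + w) (Expr.nil.eval V'), ?_, fun j hj => ?_, fun j hj => ?_⟩
    · have := Exec.seq h1 (exec_assign (o + w) .nil V' r e)
      rwa [show 2 * w + 1 + (1 + (Expr.nil.eval V').size) = 2 * (w + 1) + 1 by
        simp only [Expr.eval, Data.size]; omega] at this
    · by_cases hj' : j = w
      · simp [hj', Expr.eval]
      · rw [Function.update_of_ne (by omega), h2 j (by omega)]
    · rw [Function.update_of_ne (by omega), h3 j hj]

/-! ### Evaluation of hypotheses -/

theorem encodePoint_eq {n : ℕ} (x : Point n) : encodePoint x = enc (List.ofFn x) := rfl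

theorem enc_listBool (l : List Bool) : encodePoint l.get = enc l := by
  rw [encodePoint_eq, List.ofFn_get]

/-- The value of the hypothesis described by `σ` at the point `l`. -/
noncomputable def Learner.eval (A : Learner) (σ : Data) (l : List Bool) : Bool :=
  open Classical in decide (∃ t, A.Predicts σ l.get t true)

/-- Two lengths are allowed because a point recovered from a list `l` has type `Point l.length`,
which need not be definitionally the original `Point n`. The program sees only the encoding. -/
theorem Learner.Predicts.det {A : Learner} {σ : Data} {n m : ℕ} {x : Point n} {y : Point m}
    (hxy : encodePoint x = encodePoint y) {t t' : ℕ}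
    {b b' : Bool} (h : A.Predicts σ x t b) (h' : A.Predicts σ y t' b') : b = b' := by
  obtain ⟨s, h1, h2⟩ := h
  obtain ⟨s', h1', h2'⟩ := h'
  rw [hxy] at h1
  obtain ⟨-, rfl⟩ := h1.det h1'
  rw [Bool.eq_iff_iff, h2, h2']

theorem Learner.Predicts.eval_eq {A : Learner} {σ : Data} {n : ℕ} {x : Point n} {t : ℕ} {b : Bool}
    (h : A.Predicts σ x t b) : A.eval σ (List.ofFn x) = b := by
  have hx : encodePoint x = encodePoint (List.ofFn x).get := by rw [enc_listBool, encodePoint_eq]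
  have h' : A.Predicts σ (List.ofFn x).get t b := by
    unfold Learner.Predicts at h ⊢
    rwa [← hx]
  unfold Learner.eval
  cases b with
  | true => simp only [decide_eq_true_eq]; exact ⟨t, h'⟩
  | false =>
    simp only [decide_eq_false_iff_not]
    rintro ⟨t', h''⟩
    exact absurd (h''.det rfl h') (by simp)

theorem Learner.PolyEvaluable.exists_predicts {A : Learner} (hA : A.PolyEvaluable) {n : ℕ} (σ : Data)
    (x : Point n) : ∃ t, A.Predicts σ x t (A.eval σ (List.ofFn x)) := by
  obtain ⟨c, hc⟩ := hA
  obtain ⟨t, b, h, -⟩ := hc n σ x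
  exact ⟨t, by rwa [h.eval_eq]⟩

/-- The variables used by `predict` are cleared first, since `Predicts` speaks of runs whose other
variables are empty. The final conditional turns "not `nil`" into the canonical encoding of a
Boolean. -/
theorem Learner.PolyEvaluable.polyTime_eval {A : Learner} (hA : A.PolyEvaluable) :
    PolyTime fun p : Data × List Bool => A.eval p.1 p.2 := by
  obtain ⟨k, hk⟩ := hA
  let w := max A.predict.bound 2
  refine ⟨fun b => .seq (clear (b + 1) w) (.seq (.assign (b + 1) (.hd (.var b)))
    (.seq (.assign (b + 2) (.tl (.var b))) (.seq (A.predict.embed (b + 1) fun _ => .skip)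
      (.ite (b + 1) (.assign b (.cons .nil .nil)) (.assign b .nil))))),
    fun p => 2 * w + k * (sz p + sz p + 1) ^ k + sz p + sz p + 20,
    (((((PolyIn.const 2).mul (.const w)).add ((PolyIn.const k).mul
      (((PolyIn.self.add .self).add (.const 1)).pow k))).add .self).add .self).add (.const 20),
    fun b => ⟨clear_deterministic _ _, trivial, trivial, A.predict_det.embed, trivial, trivial⟩, ?_⟩
  rintro b ⟨σ, l⟩ v r e hv
  obtain ⟨t, bo, hp, ht⟩ := hk l.length σ l.get
  have hbo := hp.eval_eq
  rw [List.ofFn_get] at hbo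
  obtain ⟨s', h1, h2⟩ := hp
  obtain ⟨V, c1, c2, c3⟩ := exec_clear (b + 1) w v r e
  have hVb : V b = .cons σ (enc l) := by rw [c3 b (by omega), hv]; rfl
  obtain ⟨V', e1, e2, e3⟩ := h1.embed_deterministic (o := b + 1) (w := w) (sm := fun _ => .skip)
    A.predict_det (le_max_left _ _)
    (Function.update (Function.update V (b + 1) ((Expr.hd (.var b)).eval V)) (b + 2)
      ((Expr.tl (.var b)).eval (Function.update V (b + 1) ((Expr.hd (.var b)).eval V)))) r e
    (by
      intro j hj
      match j with
      | 0 => simp [Expr.eval, hVb, Data.hd, initStore]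
      | 1 => simp [Expr.eval, hVb, Data.tl, initStore, enc_listBool]
      | j + 2 =>
        rw [Function.update_of_ne (by omega), Function.update_of_ne (by omega), c2 _ hj]
        simp [initStore])
  have hw0 : V' (b + 1) = s'.store 0 := e2 0 (by omega)
  have hlow : ∀ j < b, V' j = v j := fun j hj => by
    rw [e3 _ (by omega), Function.update_of_ne (by omega), Function.update_of_ne (by omega),
      c3 _ (by omega)]
  have s1 : sz (σ, l) = 1 + σ.size + sz l := rfl
  have s2 := length_le_sz l
  have ht' : t ≤ k * (sz (σ, l) + sz (σ, l) + 1) ^ k :=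
    ht.trans (Nat.mul_le_mul_left _ (Nat.pow_le_pow_left (by omega) _))
  have pre := fun d t₁ v₁ (h : Exec d ⟨V', r, e⟩ t₁ v₁) =>
    Exec.seq c1 (.seq (exec_assign (b + 1) (.hd (.var b)) V r e)
      (.seq (exec_assign (b + 2) (.tl (.var b)) _ r e) (.seq e1 h)))
  have hsz : (enc l).size = sz l := rfl
  cases bo with
  | true =>
    refine ⟨_, _, pre _ _ _ (.ite_then (by simpa [hw0] using h2) (exec_assign _ _ _ _ _)), ?_,
      fun j hj => ?_, ?_⟩
    · simp [Expr.eval, hbo, enc_true]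
    · rw [Function.update_of_ne (by omega), hlow j hj]
    · have := sz_bool_le (A.eval σ l)
      simp [Expr.eval, hVb, Data.hd, Data.tl, Data.size]
      omega
  | false =>
    refine ⟨_, _, pre _ _ _ (.ite_else (by simpa [hw0] using h2) (exec_assign _ _ _ _ _)), ?_,
      fun j hj => ?_, ?_⟩
    · simp [Expr.eval, hbo, enc_false]
    · rw [Function.update_of_ne (by omega), hlow j hj]
    · have := sz_bool_le (A.eval σ l)
      simp [Expr.eval, hVb, Data.hd, Data.tl, Data.size]
      omega

/-! ### Sequences of independent draws -/

section Iid

variable {X : Type*} [MeasurableSpace X]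

/-- Prepend an element to a sequence. -/
def scons (x : X) (xs : ℕ → X) : ℕ → X := fun k => Nat.casesOn k x xs

/-- Drop the first element of a sequence. -/
def stail (xs : ℕ → X) : ℕ → X := fun k => xs (k + 1)

theorem measurable_stail : Measurable (stail : (ℕ → X) → ℕ → X) :=
  measurable_pi_lambda _ fun _ => measurable_pi_apply _

theorem measurable_scons : Measurable fun p : X × (ℕ → X) => scons p.1 p.2 := by
  refine measurable_pi_lambda _ fun k => ?_
  cases k with
  | zero => exact measurable_fst
  | succ k => exact (measurable_pi_apply k).comp measurable_snd

/-- The product law is determined by its values on cylinders. Padding the index set of a cylinder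
with the whole space to an initial segment makes its preimage a product of its first factor and a
shifted cylinder. -/
theorem map_scons (ν : Measure X) [IsProbabilityMeasure ν] :
    (ν.prod (Measure.infinitePi fun _ : ℕ => ν)).map (fun p => scons p.1 p.2) =
      Measure.infinitePi fun _ : ℕ => ν := by
  classical
  refine Measure.eq_infinitePi _ fun s t ht => ?_
  obtain ⟨N, hN⟩ : ∃ N, s ⊆ Finset.range (N + 1) :=
    ⟨s.sup id, fun i hi => Finset.mem_range_succ_iff.2 (Finset.le_sup (f := id) hi)⟩
  let t' : ℕ → Set X := fun i => if i ∈ s then t i else Set.univ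
  have ht' : ∀ i, MeasurableSet (t' i) := fun i => by
    by_cases h : i ∈ s <;> simp [t', h, ht]
  have hpi : Set.pi s t = Set.pi (Finset.range (N + 1)) t' := by
    ext f
    simp only [Set.mem_pi, Finset.mem_coe]
    refine ⟨fun h i _ => ?_, fun h i hi => by simpa [t', hi] using h i (hN hi)⟩
    by_cases hi : i ∈ s
    · simpa [t', hi] using h i hi
    · simp [t', hi]
  have hprod : ∏ i ∈ s, ν (t i) = ∏ i ∈ Finset.range (N + 1), ν (t' i) := by
    rw [← Finset.prod_subset hN (f := fun i => ν (t' i)) fun i _ hi => by simp [t', hi]]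
    exact Finset.prod_congr rfl fun i hi => by simp [t', hi]
  rw [hpi, hprod, Measure.map_apply measurable_scons
    (MeasurableSet.pi (Finset.countable_toSet _) fun i _ => ht' i)]
  have hpre : (fun p : X × (ℕ → X) => scons p.1 p.2) ⁻¹' (Set.pi (Finset.range (N + 1)) t') =
      t' 0 ×ˢ Set.pi (Finset.range N) fun i => t' (i + 1) := by
    ext ⟨x, f⟩
    simp only [Set.mem_preimage, Set.mem_pi, Finset.mem_coe, Finset.mem_range, Set.mem_prod]
    refine ⟨fun h => ⟨h 0 (by omega), fun i hi => h (i + 1) (by omega)⟩, fun h i hi => ?_⟩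
    cases i with
    | zero => exact h.1
    | succ i => exact h.2 i (by omega)
  rw [hpre, Measure.prod_prod, Measure.infinitePi_pi _ fun i _ => ht' (i + 1),
    Finset.prod_range_succ', mul_comm]

/-- First-step analysis: condition on the first entry, the remaining ones being an independent
sequence of the same law. All probabilities of computation trees are computed by this recursion. -/
theorem infinitePi_real_step [Fintype X] [MeasurableSingletonClass X] (ν : Measure X)
    [IsProbabilityMeasure ν] {Q : X → Set (ℕ → X)} (hQ : ∀ x, MeasurableSet (Q x)) :
    (Measure.infinitePi fun _ : ℕ => ν).real {xs | stail xs ∈ Q (xs 0)} =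
      ∑ x, ν.real {x} * (Measure.infinitePi fun _ : ℕ => ν).real (Q x) := by
  have hset : MeasurableSet {xs : ℕ → X | stail xs ∈ Q (xs 0)} := by
    have : {xs : ℕ → X | stail xs ∈ Q (xs 0)} = ⋃ x, (fun xs => xs 0) ⁻¹' {x} ∩ stail ⁻¹' Q x := by
      ext xs; simp
    rw [this]
    exact .iUnion fun x => (measurable_pi_apply 0 (measurableSet_singleton x)).inter
      (measurable_stail (hQ x))
  rw [Measure.real, ← map_scons ν, Measure.map_apply measurable_scons hset]
  have hpre : (fun p : X × (ℕ → X) => scons p.1 p.2) ⁻¹' {xs | stail xs ∈ Q (xs 0)} =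
      ⋃ x ∈ (Finset.univ : Finset X), {x} ×ˢ Q x := by
    ext ⟨x, f⟩
    simp only [Set.mem_preimage, Set.mem_ofPred_eq, Set.mem_iUnion, Set.mem_prod,
      Set.mem_singleton_iff, Finset.mem_univ, exists_prop, true_and, exists_eq_left']
    rfl
  rw [hpre, measure_biUnion_finset (fun x _ y _ hxy => Set.disjoint_left.2 fun p hp hp' =>
    hxy (hp.1.symm.trans hp'.1)) fun x _ => (measurableSet_singleton x).prod (hQ x),
    ENNReal.toReal_sum fun x _ => measure_ne_top _ _, map_scons]
  exact Finset.sum_congr rfl fun x _ => by rw [Measure.prod_prod, ENNReal.toReal_mul]; rfl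

end Iid

/-! ### Probabilities in product spaces by integrating sections -/

section Prod

variable {X Y : Type*} [MeasurableSpace X] [MeasurableSpace Y] {μ : Measure X} {ν : Measure Y}
  {s : Set (X × Y)}

theorem integrable_section [IsProbabilityMeasure μ] [IsProbabilityMeasure ν]
    (hs : MeasurableSet s) :
    Integrable (fun x => ν.real (Prod.mk x ⁻¹' s)) μ :=
  .of_bound (measurable_measure_prodMk_left hs).ennreal_toReal.aestronglyMeasurable 1
    (.of_forall fun x => by
      rw [Real.norm_of_nonneg measureReal_nonneg]; exact measureReal_le_one)

theorem integrable_section_symm [IsProbabilityMeasure μ] [IsProbabilityMeasure ν]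
    (hs : MeasurableSet s) :
    Integrable (fun y => μ.real ((fun x => (x, y)) ⁻¹' s)) ν :=
  .of_bound (measurable_measure_prodMk_right hs).ennreal_toReal.aestronglyMeasurable 1
    (.of_forall fun x => by
      rw [Real.norm_of_nonneg measureReal_nonneg]; exact measureReal_le_one)

theorem prod_real_apply [IsProbabilityMeasure ν] (hs : MeasurableSet s) :
    (μ.prod ν).real s = ∫ x, ν.real (Prod.mk x ⁻¹' s) ∂μ := by
  rw [Measure.real, Measure.prod_apply hs, ← integral_toReal
    (measurable_measure_prodMk_left hs).aemeasurable (.of_forall fun x => measure_lt_top _ _)]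
  rfl

theorem prod_real_apply_symm [IsProbabilityMeasure μ] [IsProbabilityMeasure ν] (hs : MeasurableSet s) :
    (μ.prod ν).real s = ∫ y, μ.real ((fun x => (x, y)) ⁻¹' s) ∂ν := by
  rw [Measure.real, Measure.prod_apply_symm hs, ← integral_toReal
    (measurable_measure_prodMk_right hs).aemeasurable (.of_forall fun x => measure_lt_top _ _)]
  rfl

end Prod

theorem coinMeasure_real_step {Q : Bool → Set (ℕ → Bool)} (hQ : ∀ b, MeasurableSet (Q b)) :
    coinMeasure.real {r | stail r ∈ Q (r 0)} =
      (coinMeasure.real (Q true) + coinMeasure.real (Q false)) / 2 := by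
  have h : ∀ b : Bool, (PMF.uniformOfFintype Bool).toMeasure.real {b} = 1 / 2 := fun b => by
    rw [Measure.real, PMF.toMeasure_apply_singleton _ _ (measurableSet_singleton b)]
    simp
  rw [coinMeasure, infinitePi_real_step _ hQ, Fintype.sum_bool, h, h]
  ring

instance : IsProbabilityMeasure coinMeasure := by unfold coinMeasure; infer_instance

instance {n : ℕ} (ρ : PMF (Point n)) : IsProbabilityMeasure (drawMeasure ρ) := by
  unfold drawMeasure; infer_instance

theorem drawMeasure_real_step {n : ℕ} (ρ : PMF (Point n)) {Q : Point n → Set (ℕ → Point n)}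
    (hQ : ∀ b, MeasurableSet (Q b)) :
    (drawMeasure ρ).real {xs | stail xs ∈ Q (xs 0)} =
      ∑ x, (ρ x).toReal * (drawMeasure ρ).real (Q x) := by
  rw [drawMeasure, infinitePi_real_step _ hQ]
  refine Finset.sum_congr rfl fun x _ => ?_
  rw [Measure.real, PMF.toMeasure_apply_singleton _ _ (measurableSet_singleton x)]

/-! ### Computation trees -/

/-- Computations that toss coins. -/
inductive FTree (α : Type) : Type
  | ret : α → FTree α
  | flip : (Bool → FTree α) → FTree α

/-- Computations that toss coins and draw examples. -/
inductive ITree (X α : Type) : Type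
  | ret : α → ITree X α
  | flip : (Bool → ITree X α) → ITree X α
  | sample : (X → ITree X α) → ITree X α

namespace FTree

variable {α β : Type}

/-- The outcome of a computation, and the unused coins. -/
def walk : FTree α → (ℕ → Bool) → α × (ℕ → Bool)
  | ret a, r => (a, r)
  | flip κ, r => (κ (r 0)).walk (stail r)

/-- Sequential composition. -/
def bind : FTree α → (α → FTree β) → FTree β
  | ret a, u => u a
  | flip κ, u => flip fun b => (κ b).bind u

/-- Expectation over the coins. -/
noncomputable def mean : FTree α → (α → ℝ) → ℝ
  | ret a, φ => φ a
  | flip κ, φ => ((κ true).mean φ + (κ false).mean φ) / 2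

theorem walk_bind (τ : FTree α) (u : α → FTree β) (r : ℕ → Bool) :
    (τ.bind u).walk r = (u (τ.walk r).1).walk (τ.walk r).2 := by
  induction τ generalizing r with
  | ret a => rfl
  | flip κ ih => exact ih _ _

theorem mean_bind (τ : FTree α) (u : α → FTree β) (φ : β → ℝ) :
    (τ.bind u).mean φ = τ.mean fun a => (u a).mean φ := by
  induction τ with
  | ret a => rfl
  | flip κ ih => simp [bind, mean, ih]

theorem mean_const (τ : FTree α) (c : ℝ) : (τ.mean fun _ => c) = c := by
  induction τ with
  | ret a => rfl
  | flip κ ih => simp [mean, ih]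

theorem mean_mono {τ : FTree α} {φ ψ : α → ℝ} (h : ∀ a, φ a ≤ ψ a) : τ.mean φ ≤ τ.mean ψ := by
  induction τ with
  | ret a => exact h a
  | flip κ ih => have := ih true; have := ih false; simp only [mean]; linarith

theorem measurableSet_walk (τ : FTree α) (E : Set α) : MeasurableSet {r | (τ.walk r).1 ∈ E} := by
  induction τ with
  | ret a => simp only [walk]; exact .const _
  | flip κ ih =>
    have : {r | ((flip κ).walk r).1 ∈ E} =
        ⋃ b, (fun r : ℕ → Bool => r 0) ⁻¹' {b} ∩ stail ⁻¹' {r | ((κ b).walk r).1 ∈ E} := by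
      ext r; simp [walk]
    rw [this]
    exact .iUnion fun b => (measurable_pi_apply 0 (measurableSet_singleton b)).inter
      (measurable_stail (ih b))

/-- The combinatorial mean is the true probability, although different branches may consume
different numbers of coins: each node needs only one step of first-step analysis. -/
theorem coinMeasure_real_walk (τ : FTree α) (E : Set α) :
    coinMeasure.real {r | (τ.walk r).1 ∈ E} = τ.mean (E.indicator 1) := by
  classical
  induction τ with
  | ret a =>
    by_cases h : a ∈ E <;> simp [walk, mean, h]
  | flip κ ih =>
    rw [mean, ← ih, ← ih]
    exact coinMeasure_real_step fun b => (κ b).measurableSet_walk E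

end FTree

namespace ITree

variable {n : ℕ} {X α β : Type}

/-- The outcome of a computation, and the unused coins and examples. -/
def walk : ITree X α → (ℕ → Bool) → (ℕ → X) → α × (ℕ → Bool) × (ℕ → X)
  | ret a, r, xs => (a, r, xs)
  | flip κ, r, xs => (κ (r 0)).walk (stail r) xs
  | sample κ, r, xs => (κ (xs 0)).walk r (stail xs)

/-- Sequential composition. -/
def bind : ITree X α → (α → ITree X β) → ITree X β
  | ret a, u => u a
  | flip κ, u => flip fun b => (κ b).bind u
  | sample κ, u => sample fun x => (κ x).bind u

/-- Expectation over coins and examples. -/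
noncomputable def mean (ρ : PMF (Point n)) : ITree (Point n) α → (α → ℝ) → ℝ
  | ret a, φ => φ a
  | flip κ, φ => ((κ true).mean ρ φ + (κ false).mean ρ φ) / 2
  | sample κ, φ => ∑ x, (ρ x).toReal * (κ x).mean ρ φ

theorem walk_bind (τ : ITree X α) (u : α → ITree X β) (r : ℕ → Bool) (xs : ℕ → X) :
    (τ.bind u).walk r xs = (u (τ.walk r xs).1).walk (τ.walk r xs).2.1 (τ.walk r xs).2.2 := by
  induction τ generalizing r xs with
  | ret a => rfl
  | flip κ ih => exact ih _ _ _
  | sample κ ih => exact ih _ _ _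

theorem measurableSet_walk (τ : ITree (Point n) α) (E : Set α) :
    MeasurableSet {p : (ℕ → Bool) × (ℕ → Point n) | (τ.walk p.1 p.2).1 ∈ E} := by
  induction τ with
  | ret a => simp only [walk]; exact .const _
  | flip κ ih =>
    have : {p : (ℕ → Bool) × (ℕ → Point n) | ((flip κ).walk p.1 p.2).1 ∈ E} =
        ⋃ b, (fun p => p.1 0) ⁻¹' {b} ∩ (fun p => (stail p.1, p.2)) ⁻¹'
          {p | ((κ b).walk p.1 p.2).1 ∈ E} := by
      ext r; simp [walk]
    rw [this]
    exact .iUnion fun b => (((measurable_pi_apply 0).comp measurable_fst)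
      (measurableSet_singleton b)).inter
        (((measurable_stail.comp measurable_fst).prodMk measurable_snd) (ih b))
  | sample κ ih =>
    have : {p : (ℕ → Bool) × (ℕ → Point n) | ((sample κ).walk p.1 p.2).1 ∈ E} =
        ⋃ b, (fun p => p.2 0) ⁻¹' {b} ∩ (fun p => (p.1, stail p.2)) ⁻¹'
          {p | ((κ b).walk p.1 p.2).1 ∈ E} := by
      ext r; simp [walk]
    rw [this]
    exact .iUnion fun b => (((measurable_pi_apply 0).comp measurable_snd)
      (measurableSet_singleton b)).inter
        ((measurable_fst.prodMk (measurable_stail.comp measurable_snd)) (ih b))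

theorem real_walk (τ : ITree (Point n) α) (ρ : PMF (Point n)) (E : Set α) :
    (coinMeasure.prod (drawMeasure ρ)).real {p | (τ.walk p.1 p.2).1 ∈ E} =
      τ.mean ρ (E.indicator 1) := by
  classical
  induction τ with
  | ret a =>
    by_cases h : a ∈ E <;> simp [walk, mean, h]
  | flip κ ih =>
    rw [mean, ← ih, ← ih]
    have hm := fun b => (κ b).measurableSet_walk E
    -- For a coin toss the coins are the inner variable of integration, so that the one-step formula
    -- applies to each section; in the `sample` case the draws are.
    rw [prod_real_apply_symm (measurableSet_walk _ _), prod_real_apply_symm (hm true),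
      prod_real_apply_symm (hm false), ← integral_add (integrable_section_symm (hm true))
        (integrable_section_symm (hm false)), ← integral_div]
    exact integral_congr_ae (.of_forall fun xs => coinMeasure_real_step fun b =>
      measurable_prodMk_right (hm b))
  | sample κ ih =>
    rw [mean]
    simp_rw [← ih]
    have hm := fun b => (κ b).measurableSet_walk E
    simp_rw [prod_real_apply (hm _), ← integral_const_mul]
    rw [prod_real_apply (measurableSet_walk _ _), ← integral_finsetSum _ fun x _ =>
      (integrable_section (hm x)).const_mul _]
    exact integral_congr_ae (.of_forall fun r => drawMeasure_real_step ρ fun x =>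
      measurable_prodMk_left (hm x))

end ITree

/-! ### The computation tree of a program -/

section Interp

variable {X : Type} {α β : Type}

/-- Running times and final stores of halting computations. -/
abbrev Outcome : Type := Option (ℕ × (ℕ → Data))

namespace ITree

/-- Run two computations in turn and add up the running times. -/
def andThen (τ : ITree X Outcome) (u : (ℕ → Data) → ITree X Outcome) : ITree X Outcome :=
  τ.bind fun
    | none => ret none
    | some (t, v) => (u v).bind fun
      | none => ret none
      | some (t', v') => ret (some (t + t', v'))

theorem walk_andThen {τ : ITree X Outcome} {u : (ℕ → Data) → ITree X Outcome} {r r₁ r₂ : ℕ → Bool}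
    {xs xs₁ xs₂ : ℕ → X} {t₁ t₂ : ℕ} {v₁ v₂ : ℕ → Data}
    (h₁ : τ.walk r xs = (some (t₁, v₁), r₁, xs₁)) (h₂ : (u v₁).walk r₁ xs₁ = (some (t₂, v₂), r₂, xs₂)) :
    (τ.andThen u).walk r xs = (some (t₁ + t₂, v₂), r₂, xs₂) := by
  rw [andThen, walk_bind, h₁]
  simp only
  rw [walk_bind, h₂]
  rfl

/-- At most `k` rounds of a loop. -/
def loop (i : ℕ) (body : (ℕ → Data) → ITree X Outcome) : ℕ → (ℕ → Data) → ITree X Outcome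
  | 0, _ => ret none
  | k + 1, v => match v i with
    | .nil => ret (some (1, v))
    | .cons _ _ => (ret (some (1, v))).andThen fun v => (body v).andThen (loop i body k)

end ITree

open ITree in
/-- The computation tree of a program; loops are cut off after `F` rounds, and the examples
`x` are presented as `e x`. -/
def Cmd.interp (e : X → Data) (F : ℕ) : Cmd → (ℕ → Data) → ITree X Outcome
  | .skip, v => ret (some (1, v))
  | .assign i a, v => ret (some (1 + (a.eval v).size, Function.update v i (a.eval v)))
  | .seq c d, v => (c.interp e F v).andThen (d.interp e F)
  | .ite i c d, v => (ret (some (1, v))).andThen fun v => match v i with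
    | .nil => d.interp e F v
    | .cons _ _ => c.interp e F v
  | .loop i c, v => ITree.loop i (c.interp e F) F v
  | .flip i, v => .flip fun b => ret (some (1, Function.update v i (Data.ofBool b)))
  | .sample i, v => .sample fun x => ret (some (1 + (e x).size, Function.update v i (e x)))

theorem Exec.pos {c : Cmd} {s s' : State} {t : ℕ} (h : Exec c s t s') : 0 < t := by
  induction h <;> omega

/-- Every round of a loop takes time at least 1, so a run of length at most `F` never meets the
cut-off after `F` rounds. -/
theorem Exec.interp {e : X → Data} {F : ℕ} {c : Cmd} : ∀ {s s' : State} {t : ℕ} {xs : ℕ → X},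
    Exec c s t s' → t ≤ F → (∀ k, s.examples k = e (xs k)) →
    ∃ xs', (c.interp e F s.store).walk s.coins xs = (some (t, s'.store), s'.coins, xs') ∧
      ∀ k, s'.examples k = e (xs' k) := by
  induction c with
  | skip =>
    intro s s' t xs h _ hx
    cases h
    exact ⟨xs, rfl, hx⟩
  | assign i a =>
    intro s s' t xs h _ hx
    cases h
    exact ⟨xs, rfl, hx⟩
  | seq c d ihc ihd =>
    intro s s' t xs h ht hx
    cases h with
    | seq h1 h2 =>
      obtain ⟨xs1, a1, a2⟩ := ihc h1 (by omega) hx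
      obtain ⟨xs2, b1, b2⟩ := ihd h2 (by omega) a2
      exact ⟨xs2, ITree.walk_andThen a1 b1, b2⟩
  | ite i c d ihc ihd =>
    intro s s' t xs h ht hx
    cases h with
    | ite_then hn h1 =>
      obtain ⟨xs1, a1, a2⟩ := ihc h1 (by omega) hx
      refine ⟨xs1, ITree.walk_andThen rfl ?_, a2⟩
      cases hv : s.store i with
      | nil => exact absurd hv hn
      | cons _ _ => simpa [hv] using a1
    | ite_else hn h1 =>
      obtain ⟨xs1, a1, a2⟩ := ihd h1 (by omega) hx
      refine ⟨xs1, ITree.walk_andThen rfl ?_, a2⟩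
      simpa [hn] using a1
  | loop i c ih =>
    suffices key : ∀ k, ∀ {s s' : State} {t : ℕ} {xs : ℕ → X}, Exec (.loop i c) s t s' → t ≤ F →
        t ≤ k → (∀ k, s.examples k = e (xs k)) →
        ∃ xs', (ITree.loop i (c.interp e F) k s.store).walk s.coins xs =
          (some (t, s'.store), s'.coins, xs') ∧ ∀ k, s'.examples k = e (xs' k) by
      intro s s' t xs h ht hx
      exact key F h ht ht hx
    intro k
    induction k with
    | zero => intro s s' t xs h _ hk _; have := h.pos; omega
    | succ k ihk =>
      intro s s' t xs h ht hk hx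
      cases h with
      | loop_done hn => exact ⟨xs, by simp [ITree.loop, hn, ITree.walk], hx⟩
      | loop_step hn h1 h2 =>
        obtain ⟨xs1, a1, a2⟩ := ih h1 (by omega) hx
        obtain ⟨xs2, b1, b2⟩ := ihk h2 (by omega) (by omega) a2
        refine ⟨xs2, ?_, b2⟩
        cases hv : s.store i with
        | nil => exact absurd hv hn
        | cons _ _ =>
          rw [ITree.loop, hv, add_assoc]
          exact ITree.walk_andThen rfl (ITree.walk_andThen a1 b1)
  | flip i =>
    intro s s' t xs h _ hx
    cases h
    exact ⟨xs, rfl, hx⟩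
  | sample i =>
    intro s s' t xs h _ hx
    cases h
    refine ⟨stail xs, ?_, fun k => hx (k + 1)⟩
    rw [hx 0]
    rfl

/-! ### Simulated examples -/

/-- Drop the first `k` elements of a sequence. -/
def sdrop (k : ℕ) (r : ℕ → Bool) : ℕ → Bool := fun j => r (k + j)

/-- The number with binary digits `u`, `r 0`, …, `r (k - 1)`. -/
def bits : ℕ → ℕ → (ℕ → Bool) → ℕ
  | 0, u, _ => u
  | k + 1, u, r => bits k (2 * u + (r 0).toNat) (stail r)

namespace FTree

/-- Toss `k` coins and continue with the resulting binary number. -/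
def flips : ℕ → ℕ → (ℕ → FTree α) → FTree α
  | 0, u, κ => κ u
  | k + 1, u, κ => flip fun b => flips k (2 * u + b.toNat) κ

theorem walk_flips (k u : ℕ) (κ : ℕ → FTree α) (r : ℕ → Bool) :
    (flips k u κ).walk r = (κ (bits k u r)).walk (sdrop k r) := by
  induction k generalizing u r with
  | zero =>
    rw [show sdrop 0 r = r from funext fun j => by simp [sdrop]]
    rfl
  | succ k ih =>
    rw [flips, walk, ih, bits]
    congr 1
    funext j
    simp only [sdrop, stail]
    congr 1
    omega

theorem bind_flips (k u : ℕ) (κ : ℕ → FTree α) (f : α → FTree β) :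
    (flips k u κ).bind f = flips k u fun j => (κ j).bind f := by
  induction k generalizing u with
  | zero => rfl
  | succ k ih => simp [flips, bind, ih]

theorem mean_flips (k u : ℕ) (κ : ℕ → FTree α) (φ : α → ℝ) :
    (flips k u κ).mean φ =
      (∑ j ∈ Finset.range (2 ^ k), (κ (2 ^ k * u + j)).mean φ) / 2 ^ k := by
  induction k generalizing u with
  | zero => simp [flips]
  | succ k ih =>
    rw [flips, mean, ih, ih, pow_succ, mul_two, Finset.sum_range_add]
    have h1 : ∀ j, 2 ^ k * (2 * u + true.toNat) + j = (2 ^ k + 2 ^ k) * u + (2 ^ k + j) :=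
      fun j => by simp only [Bool.toNat_true]; ring
    have h2 : ∀ j, 2 ^ k * (2 * u + false.toNat) + j = (2 ^ k + 2 ^ k) * u + j :=
      fun j => by simp only [Bool.toNat_false]; ring
    simp_rw [h1, h2]
    field_simp
    ring

end FTree

namespace ITree

/-- Replace each example by `pick u` for a random `k`-bit number `u`. -/
def expand (k : ℕ) (pick : ℕ → X) : ITree X α → FTree α
  | ret a => .ret a
  | flip κ => .flip fun b => (κ b).expand k pick
  | sample κ => .flips k 0 fun u => (κ (pick u)).expand k pick

theorem expand_bind (k : ℕ) (pick : ℕ → X) (τ : ITree X α) (u : α → ITree X β) :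
    (τ.bind u).expand k pick = (τ.expand k pick).bind fun a => (u a).expand k pick := by
  induction τ with
  | ret a => rfl
  | flip κ ih => simp [bind, expand, FTree.bind, ih]
  | sample κ ih => simp [bind, expand, FTree.bind_flips, ih]

/-- Outcomes of the simulation are possible outcomes of the computation. -/
theorem exists_walk_eq_expand (k : ℕ) (pick : ℕ → X) (τ : ITree X α) (r : ℕ → Bool) :
    ∃ r' xs', (τ.walk r' xs').1 = ((τ.expand k pick).walk r).1 := by
  induction τ generalizing r with
  | ret a => exact ⟨fun _ => false, fun _ => pick 0, rfl⟩
  | flip κ ih =>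
    obtain ⟨r', xs', h⟩ := ih (r 0) (stail r)
    exact ⟨scons (r 0) r', xs', h⟩
  | sample κ ih =>
    obtain ⟨r', xs', h⟩ := ih (pick (bits k 0 r)) (sdrop k r)
    refine ⟨r', scons (pick (bits k 0 r)) xs', ?_⟩
    rw [expand, FTree.walk_flips]
    exact h

/-- The law of `pick u` for a random `k`-bit number `u`. -/
noncomputable def pickLaw (k : ℕ) (pick : ℕ → X) : PMF X :=
  PMF.map (fun u : Fin (2 ^ k) => pick u) (PMF.uniformOfFintype (Fin (2 ^ k)))

theorem sum_pickLaw [Fintype X] (k : ℕ) (pick : ℕ → X) (g : X → ℝ) :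
    ∑ x, (pickLaw k pick x).toReal * g x =
      (∑ j ∈ Finset.range (2 ^ k), g (pick j)) / 2 ^ k := by
  classical
  have h : ∀ x, (pickLaw k pick x).toReal =
      ∑ u : Fin (2 ^ k), if x = pick u then (1 : ℝ) / 2 ^ k else 0 := fun x => by
    rw [pickLaw, PMF.map_apply, tsum_fintype, ENNReal.toReal_sum fun u _ => by
      split_ifs <;> simp]
    refine Finset.sum_congr rfl fun u _ => ?_
    split_ifs <;> simp
  simp_rw [h, Finset.sum_mul, ite_mul, zero_mul]
  rw [Finset.sum_comm, Finset.sum_div, ← Fin.sum_univ_eq_sum_range fun j => g (pick j) / 2 ^ k]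
  refine Finset.sum_congr rfl fun u _ => ?_
  rw [Finset.sum_ite_eq' Finset.univ (pick u)]
  simp [div_eq_inv_mul]

/-- The simulation introduces no error of its own: the law of `pick u` for uniform `u` is exactly
the example distribution seen by the weak learner. Only this law differs from the intended weights.
-/
theorem mean_expand {n : ℕ} (k : ℕ) (pick : ℕ → Point n) (τ : ITree (Point n) α) (φ : α → ℝ) :
    (τ.expand k pick).mean φ = τ.mean (pickLaw k pick) φ := by
  induction τ with
  | ret a => rfl
  | flip κ ih => simp [expand, FTree.mean, mean, ih]
  | sample κ ih =>
    rw [expand, FTree.mean_flips, mean, sum_pickLaw (g := fun x => (κ x).mean _ φ)]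
    simp [ih]

theorem exists_of_walk_expand_andThen {k : ℕ} {pick : ℕ → X} {τ : ITree X Outcome}
    {u : (ℕ → Data) → ITree X Outcome} {r r' : ℕ → Bool} {t : ℕ} {v' : ℕ → Data}
    (h : ((τ.andThen u).expand k pick).walk r = (some (t, v'), r')) :
    ∃ t₁ v₁ r₁ t₂, (τ.expand k pick).walk r = (some (t₁, v₁), r₁) ∧
      ((u v₁).expand k pick).walk r₁ = (some (t₂, v'), r') ∧ t = t₁ + t₂ := by
  rw [andThen, expand_bind, FTree.walk_bind] at h
  rcases h1 : (τ.expand k pick).walk r with ⟨_ | ⟨t₁, v₁⟩, r₁⟩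
  · simp [h1, expand, FTree.walk] at h
  · simp only [h1] at h
    rw [expand_bind, FTree.walk_bind] at h
    rcases h2 : ((u v₁).expand k pick).walk r₁ with ⟨_ | ⟨t₂, v₂⟩, r₂⟩
    · simp [h2, expand, FTree.walk] at h
    · simp only [h2, expand, FTree.walk, Prod.mk.injEq, Option.some.injEq] at h
      obtain ⟨⟨rfl, rfl⟩, rfl⟩ := h
      exact ⟨t₁, v₁, r₁, t₂, rfl, h2, rfl⟩

end ITree

/-- A program run with simulated examples follows its computation tree. -/
theorem Cmd.exec_embed {e : X → Data} {F o w C k : ℕ} {pick : ℕ → X} {sm : ℕ → Cmd} {V₀ : ℕ → Data}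
    {ex : ℕ → Data} (hC : 0 < C)
    (hsm : ∀ i < w, ∀ V r, (∀ j < o, V j = V₀ j) → ∃ t V', Exec (sm i) ⟨V, r, ex⟩ t ⟨V', sdrop k r, ex⟩ ∧
      t ≤ C ∧ V' (o + i) = e (pick (bits k 0 r)) ∧ (∀ j < w, j ≠ i → V' (o + j) = V (o + j)) ∧
      ∀ j < o, V' j = V₀ j) {c : Cmd} (hc : c.bound ≤ w) :
    ∀ {v V : ℕ → Data} {r r' : ℕ → Bool} {t : ℕ} {v' : ℕ → Data},
      ((c.interp e F v).expand k pick).walk r = (some (t, v'), r') →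
      (∀ j < w, V (o + j) = v j) → (∀ j < o, V j = V₀ j) →
      ∃ t' V', Exec (c.embed o sm) ⟨V, r, ex⟩ t' ⟨V', r', ex⟩ ∧ t' ≤ C * t ∧
        (∀ j < w, V' (o + j) = v' j) ∧ ∀ j < o, V' j = V₀ j := by
  have hle : ∀ t, t ≤ C * t := fun t => Nat.le_mul_of_pos_left t hC
  induction c with
  | skip =>
    intro v V r r' t v' h hv h0
    simp only [interp, ITree.expand, FTree.walk, Prod.mk.injEq, Option.some.injEq] at h
    obtain ⟨⟨rfl, rfl⟩, rfl⟩ := h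
    exact ⟨1, V, .skip _, hle _, hv, h0⟩
  | assign i a =>
    intro v V r r' t v' h hv h0
    simp only [Cmd.bound, sup_le_iff] at hc
    simp only [interp, ITree.expand, FTree.walk, Prod.mk.injEq, Option.some.injEq] at h
    obtain ⟨⟨rfl, rfl⟩, rfl⟩ := h
    have := exec_assign (o + i) (a.shift o) V r ex
    rw [Expr.eval_shift hv hc.2] at this
    obtain ⟨h1, h2⟩ := shift_update (i := i) hv (a.eval v)
    exact ⟨_, _, this, hle _, h1, fun j hj => (h2 j hj).trans (h0 j hj)⟩
  | seq c d ihc ihd =>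
    intro v V r r' t v' h hv h0
    simp only [Cmd.bound, sup_le_iff] at hc
    obtain ⟨t1, v1, r1, t2, h1, h2, rfl⟩ := ITree.exists_of_walk_expand_andThen h
    obtain ⟨s1, V1, a1, a2, a3, a4⟩ := ihc hc.1 h1 hv h0
    obtain ⟨s2, V2, b1, b2, b3, b4⟩ := ihd hc.2 h2 a3 a4
    exact ⟨_, V2, .seq a1 b1, by rw [mul_add]; omega, b3, b4⟩
  | ite i c d ihc ihd =>
    intro v V r r' t v' h hv h0
    simp only [Cmd.bound, sup_le_iff] at hc
    obtain ⟨t1, v1, r1, t2, h1, h2, rfl⟩ := ITree.exists_of_walk_expand_andThen h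
    simp only [ITree.expand, FTree.walk, Prod.mk.injEq, Option.some.injEq] at h1
    obtain ⟨⟨rfl, rfl⟩, rfl⟩ := h1
    cases hvi : v i with
    | nil =>
      simp only [hvi] at h2
      obtain ⟨s2, V2, b1, b2, b3, b4⟩ := ihd hc.2.2 h2 hv h0
      exact ⟨_, V2, .ite_else (by rw [← hvi]; exact hv i hc.1) b1, by rw [mul_add]; omega, b3, b4⟩
    | cons _ _ =>
      simp only [hvi] at h2
      obtain ⟨s2, V2, b1, b2, b3, b4⟩ := ihc hc.2.1 h2 hv h0
      exact ⟨_, V2, .ite_then (by simp [hv i hc.1, hvi]) b1, by rw [mul_add]; omega, b3, b4⟩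
  | loop i c ih =>
    simp only [Cmd.bound, sup_le_iff] at hc
    suffices key : ∀ m, ∀ {v V : ℕ → Data} {r r' : ℕ → Bool} {t : ℕ} {v' : ℕ → Data},
        ((ITree.loop i (c.interp e F) m v).expand k pick).walk r = (some (t, v'), r') →
        (∀ j < w, V (o + j) = v j) → (∀ j < o, V j = V₀ j) →
        ∃ t' V', Exec (.loop (o + i) (c.embed o sm)) ⟨V, r, ex⟩ t' ⟨V', r', ex⟩ ∧ t' ≤ C * t ∧
          (∀ j < w, V' (o + j) = v' j) ∧ ∀ j < o, V' j = V₀ j by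
      intro v V r r' t v' h hv h0
      exact key F h hv h0
    intro m
    induction m with
    | zero => intro v V r r' t v' h; simp [ITree.loop, ITree.expand, FTree.walk] at h
    | succ m ihm =>
      intro v V r r' t v' h hv h0
      rw [ITree.loop] at h
      cases hvi : v i with
      | nil =>
        simp only [hvi, ITree.expand, FTree.walk, Prod.mk.injEq, Option.some.injEq] at h
        obtain ⟨⟨rfl, rfl⟩, rfl⟩ := h
        exact ⟨1, V, .loop_done (by rw [← hvi]; exact hv i hc.1), hle _, hv, h0⟩
      | cons _ _ =>
        simp only [hvi] at h
        obtain ⟨t1, v1, r1, t2, h1, h2, rfl⟩ := ITree.exists_of_walk_expand_andThen h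
        simp only [ITree.expand, FTree.walk, Prod.mk.injEq, Option.some.injEq] at h1
        obtain ⟨⟨rfl, rfl⟩, rfl⟩ := h1
        obtain ⟨t3, v3, r3, t4, h3, h4, rfl⟩ := ITree.exists_of_walk_expand_andThen h2
        obtain ⟨s1, V1, a1, a2, a3, a4⟩ := ih hc.2 h3 hv h0
        obtain ⟨s2, V2, b1, b2, b3, b4⟩ := ihm h4 a3 a4
        exact ⟨_, V2, .loop_step (by simp [hv i hc.1, hvi]) a1 b1,
          by rw [mul_add, mul_add]; omega, b3, b4⟩
  | flip i =>
    intro v V r r' t v' h hv h0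
    simp only [interp, ITree.expand, FTree.walk, Prod.mk.injEq, Option.some.injEq] at h
    obtain ⟨⟨rfl, rfl⟩, rfl⟩ := h
    obtain ⟨h1, h2⟩ := shift_update (i := i) hv (Data.ofBool (r 0))
    exact ⟨_, _, .flip (o + i) ⟨V, r, ex⟩, hle _, h1, fun j hj => (h2 j hj).trans (h0 j hj)⟩
  | sample i =>
    intro v V r r' t v' h hv h0
    simp only [interp, ITree.expand, FTree.walk_flips, FTree.walk, Prod.mk.injEq,
      Option.some.injEq] at h
    obtain ⟨⟨rfl, rfl⟩, rfl⟩ := h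
    obtain ⟨t', V', a1, a2, a3, a4, a5⟩ := hsm i hc V r h0
    refine ⟨t', V', a1, a2.trans (Nat.le_mul_of_pos_right C (by omega)), fun j hj => ?_, a5⟩
    by_cases hji : j = i
    · subst hji; simp [a3]
    · rw [a4 j hj hji, hv j hj, Function.update_of_ne hji]

end Interp

/-! ### The boosting algorithm -/

/-- Labelled examples: a point and its label. -/
abbrev Ex : Type := List Bool × Bool

/-- The inputs `n`, `⌈1 / ε⌉`, `⌈1 / δ⌉`, `⌈1 / η⌉`. -/
abbrev Params : Type := ℕ × ℕ × ℕ × ℕ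

/-- States of a boosting stage: examples with their deficits, accepted weak hypotheses, and the
number of weak hypotheses still wanted. -/
abbrev Stage : Type := List (Ex × ℕ) × List Data × ℕ

/-- The advantage of the weak learner is `1 / advInv d n`. -/
def advInv (d n : ℕ) : ℕ := d * (n + 1) ^ d

/-- A number `k` with `m ≤ 2 ^ k`, together with `2 ^ k`. -/
def log2 (m : ℕ) : ℕ × ℕ :=
  (fun p : ℕ × ℕ => if decide (m ≤ p.1) then p else (p.1 + p.1, p.2 + 1))^[m] (1, 0)

/-- The list in which each example is repeated according to its weight. -/
def weighted (items : List (Ex × ℕ)) : List Ex :=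
  (items.map fun p => List.replicate ((p.2 + 1) ^ 3) p.1).flatten

/-- The example with number `u`, in cyclic order. -/
def cyclic (L : List Ex) (u : ℕ) : Ex := L.getD (u % L.length) ([], false)

/-- The list of examples to be sampled from, and the number of coins to be tossed. -/
def samplerData (d : ℕ) (par : Params) (st : Stage) : List Ex × ℕ :=
  (weighted st.1, (log2 ((weighted st.1).length * (4 * advInv d par.1))).2)

/-- The total weight of the examples with a given property. -/
def weightOf (P : Ex → Bool) (items : List (Ex × ℕ)) : ℕ :=
  (items.map fun p => if P p.1 then (p.2 + 1) ^ 3 else 0).sum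

/-- Change the deficits in view of the set `P` of correctly classified examples. -/
def reweight (g : ℕ) (P : Ex → Bool) (items : List (Ex × ℕ)) : List (Ex × ℕ) :=
  items.map fun p => (p.1, if P p.1 then p.2 - (g - 1) else p.2 + (g + 1))

/-- The hypothesis `h` agrees with the label. -/
noncomputable def Learner.agrees (A : Learner) (h : Data) (x : Ex) : Bool := A.eval h x.1 == x.2

/-- Accept the weak hypothesis `h` if it is wanted and accurate. -/
noncomputable def update (A : Learner) (d : ℕ) (par : Params) (st : Stage) (h : Data) : Stage :=
  if decide (1 ≤ st.2.2) && decide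
      (weightOf (fun x => !A.agrees h x) st.1 * (2 * advInv d par.1 + 1) ≤
        weightOf (A.agrees h) st.1 * (2 * advInv d par.1 - 1))
  then (reweight (2 * advInv d par.1) (A.agrees h) st.1, h :: st.2.1, st.2.2 - 1)
  else st

/-- The number of weak hypotheses used in stage `q`. -/
def rounds (d n q : ℕ) : ℕ := 5 * (2 * advInv d n + 1) ^ 2 * q + 1

/-- The number of runs of the weak learner in stage `q`. -/
def trials (d : ℕ) (par : Params) (q : ℕ) : ℕ :=
  4 * advInv d par.1 * (rounds d par.1 q + par.1 * q ^ 2 + q + 1 + par.2.2.1)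

/-- The initial state of stage `q`, and the number of trials. -/
def startStage (d : ℕ) (par : Params) (S : List Ex) (q : ℕ) : Stage × ℕ :=
  ((S.map fun x => (x, 0), [], rounds d par.1 q), trials d par q)

/-- The part of the budget of stage `q` that is not available for hypotheses. -/
def overhead (par : Params) (q : ℕ) : ℕ := 2 * par.2.1 * (q + par.2.1 + par.2.2.1 + 1)

/-- The output `H` of stage `q` is short enough. -/
def short (par : Params) (q : ℕ) (H : List Data) : Bool :=
  decide (overhead par q ≤ q ^ 2) &&
    decide (((List.replicate (2 * par.2.1) (enc H)).map Data.size).sum ≤ q ^ 2 - overhead par q)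

/-- The majority vote of weak hypotheses. -/
noncomputable def Learner.majority (A : Learner) (H : List Data) (l : List Bool) : Bool :=
  decide ((H.map fun h => if A.eval h l then 0 else 1).sum + 1 ≤
    (H.map fun h => if A.eval h l then 1 else 0).sum)

section

variable {α : Type} [Enc α]

theorem PolyTime.advInv {n : α → ℕ} (hn : PolyTime n) (d : ℕ) : PolyTime fun x => advInv d (n x) :=
  (PolyTime.const d).mul (hn.succ.pow d)

/-- Doubling takes place only while `2 ^ k < m`. The summand 1 in the upper bound covers `m = 0`,
and the alternative `k = j` shows that `m` steps suffice. -/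
theorem log2_iterate (m j : ℕ) :
    ∃ k, (fun p : ℕ × ℕ => if decide (m ≤ p.1) then p else (p.1 + p.1, p.2 + 1))^[j] (1, 0) =
      (2 ^ k, k) ∧ (m ≤ 2 ^ k ∨ k = j) ∧ 2 ^ k ≤ 2 * m + 1 := by
  induction j with
  | zero => exact ⟨0, rfl, .inr rfl, by simp⟩
  | succ j ih =>
    obtain ⟨k, h1, h2, h3⟩ := ih
    rw [Function.iterate_succ_apply', h1]
    by_cases h : m ≤ 2 ^ k
    · exact ⟨k, by simp [h], .inl h, h3⟩
    · refine ⟨k + 1, by simp [h, pow_succ, mul_two], .inr ?_, ?_⟩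
      · rcases h2 with h2 | h2
        · exact absurd h2 h
        · rw [h2]
      · rw [pow_succ]; omega

theorem le_two_pow_log2 (m : ℕ) : m ≤ 2 ^ (log2 m).2 := by
  obtain ⟨k, h1, h2, -⟩ := log2_iterate m m
  rw [log2, h1]
  rcases h2 with h2 | h2
  · exact h2
  · exact h2 ▸ Nat.lt_two_pow_self.le

theorem two_pow_log2_le (m : ℕ) : 2 ^ (log2 m).2 ≤ 2 * m + 1 := by
  obtain ⟨k, h1, -, h3⟩ := log2_iterate m m
  rw [log2, h1]
  exact h3

theorem PolyTime.log2 {m : α → ℕ} (hm : PolyTime m) : PolyTime fun x => log2 (m x) := by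
  refine PolyTime.iterate (i := fun _ => (1, 0))
    (g := fun x (p : ℕ × ℕ) => if decide (m x ≤ p.1) then p else (p.1 + p.1, p.2 + 1))
    (B := fun x => 8 * m x + 7)
    hm (.const _) (.ite (.le (hm.comp .fst) PolyTime.snd.left) .snd
      (.pair (.add PolyTime.snd.left PolyTime.snd.left) PolyTime.snd.right.succ))
    (((PolyIn.const 8).mul hm.polyIn_nat).add (.const 7)) fun x j _ => ?_
  obtain ⟨k, h1, -, h3⟩ := log2_iterate (m x) j
  rw [h1, sz_pair, sz_nat, sz_nat]
  have := (Nat.lt_two_pow_self (n := k))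
  omega

theorem PolyTime.weighted {l : α → List (Ex × ℕ)} (hl : PolyTime l) :
    PolyTime fun x => weighted (l x) := by
  have h : PolyTime fun p : α × Ex × ℕ => List.replicate ((p.2.2 + 1) ^ 3) p.2.1 :=
    PolyTime.replicate (PolyTime.snd.right.succ.pow 3) PolyTime.snd.left
  exact (hl.map (g := fun _ p => List.replicate ((p.2 + 1) ^ 3) p.1) h).flatten

theorem polyTime_cyclic : PolyTime fun p : List Ex × ℕ => cyclic p.1 p.2 :=
  PolyTime.fst.getD (PolyTime.snd.mod PolyTime.fst.length) _

theorem polyTime_samplerData (d : ℕ) :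
    PolyTime fun p : Params × Stage => samplerData d p.1 p.2 := by
  have hw : PolyTime fun p : Params × Stage => DistPAC.weighted p.2.1 := PolyTime.snd.left.weighted
  exact hw.pair ((hw.length.mul ((PolyTime.const 4).mul (PolyTime.fst.left.advInv d))).log2.right)

theorem PolyTime.weightOf {P : α → Ex → Bool} {l : α → List (Ex × ℕ)}
    (hP : PolyTime fun p : α × Ex => P p.1 p.2) (hl : PolyTime l) :
    PolyTime fun x => weightOf (P x) (l x) := by
  have h : PolyTime fun p : α × Ex × ℕ => if P p.1 p.2.1 then (p.2.2 + 1) ^ 3 else 0 :=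
    .ite (hP.comp (PolyTime.fst.pair PolyTime.snd.left)) (PolyTime.snd.right.succ.pow 3) (.const 0)
  exact (hl.map (g := fun x p => if P x p.1 then (p.2 + 1) ^ 3 else 0) h).sum

theorem PolyTime.reweight {g : α → ℕ} {P : α → Ex → Bool} {l : α → List (Ex × ℕ)} (hg : PolyTime g)
    (hP : PolyTime fun p : α × Ex => P p.1 p.2) (hl : PolyTime l) :
    PolyTime fun x => reweight (g x) (P x) (l x) := by
  have h : PolyTime fun p : α × Ex × ℕ =>
      if P p.1 p.2.1 then p.2.2 - (g p.1 - 1) else p.2.2 + (g p.1 + 1) :=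
    .ite (hP.comp (PolyTime.fst.pair PolyTime.snd.left))
      (PolyTime.snd.right.sub (hg.comp .fst).pred) (PolyTime.snd.right.add (hg.comp .fst).succ)
  exact hl.map (g := fun x p => (p.1, if P x p.1 then p.2 - (g x - 1) else p.2 + (g x + 1)))
    (PolyTime.snd.left.pair h)

theorem Learner.PolyEvaluable.polyTime_agrees {A : Learner} (hA : A.PolyEvaluable) {h : α → Data}
    (hh : PolyTime h) : PolyTime fun p : α × Ex => A.agrees (h p.1) p.2 :=
  (hA.polyTime_eval.comp ((hh.comp .fst).pair PolyTime.snd.left)).eq PolyTime.snd.right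

theorem Learner.PolyEvaluable.polyTime_update {A : Learner} (hA : A.PolyEvaluable) (d : ℕ) :
    PolyTime fun p : (Params × Stage) × Data => update A d p.1.1 p.1.2 p.2 := by
  have hP := hA.polyTime_agrees (PolyTime.snd (α := Params × Stage) (β := Data))
  have hst : PolyTime fun p : (Params × Stage) × Data => p.1.2 := PolyTime.fst.right
  have hg : PolyTime fun p : (Params × Stage) × Data => 2 * DistPAC.advInv d p.1.1.1 :=
    (PolyTime.const 2).mul (PolyTime.fst.left.left.advInv d)
  exact (((PolyTime.const 1).le hst.right.right).and
    (((hP.not.weightOf hst.left).mul hg.succ).le ((hP.weightOf hst.left).mul hg.pred))).ite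
    ((hg.reweight hP hst.left).pair ((PolyTime.snd.cons hst.right.left).pair hst.right.right.pred))
    hst

theorem PolyTime.rounds {n q : α → ℕ} (hn : PolyTime n) (hq : PolyTime q) (d : ℕ) :
    PolyTime fun x => rounds d (n x) (q x) :=
  (((PolyTime.const 5).mul (((PolyTime.const 2).mul (hn.advInv d)).succ.pow 2)).mul hq).succ

theorem polyTime_startStage (d : ℕ) :
    PolyTime fun p : Params × List Ex × ℕ => startStage d p.1 p.2.1 p.2.2 := by
  have hq : PolyTime fun p : Params × List Ex × ℕ => p.2.2 := PolyTime.snd.right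
  have hn : PolyTime fun p : Params × List Ex × ℕ => p.1.1 := PolyTime.fst.left
  have hr := hn.rounds hq d
  exact ((PolyTime.snd.left.map (g := fun _ x => (x, 0)) (PolyTime.snd.pair (.const 0))).pair
    ((PolyTime.const []).pair hr)).pair
    (((PolyTime.const 4).mul (hn.advInv d)).mul
      (((hr.add (hn.mul (hq.pow 2))).add hq).succ.add PolyTime.fst.right.right.left))

theorem polyTime_overhead : PolyTime fun p : Params × ℕ × List Data => overhead p.1 p.2.1 := by
  have hq : PolyTime fun p : Params × ℕ × List Data => p.2.1 := PolyTime.snd.left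
  have hE : PolyTime fun p : Params × ℕ × List Data => p.1.2.1 := PolyTime.fst.right.left
  exact ((PolyTime.const 2).mul hE).mul ((hq.add hE).add PolyTime.fst.right.right.left).succ

theorem polyTime_copies : PolyTime fun p : Params × ℕ × List Data =>
    List.replicate (2 * p.1.2.1) (enc p.2.2) := by
  have hE : PolyTime fun p : Params × ℕ × List Data => 2 * p.1.2.1 :=
    (PolyTime.const 2).mul PolyTime.fst.right.left
  have hH : PolyTime fun p : Params × ℕ × List Data => enc p.2.2 :=
    (PolyTime.recode (f := fun H : List Data => enc H) fun _ => rfl).comp PolyTime.snd.right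
  exact hE.replicate hH

theorem polyTime_short : PolyTime fun p : Params × ℕ × List Data => short p.1 p.2.1 p.2.2 := by
  have hq : PolyTime fun p : Params × ℕ × List Data => p.2.1 ^ 2 := PolyTime.snd.left.pow 2
  exact (polyTime_overhead.le hq).and
    (polyTime_copies.sum_size_le (hq.sub polyTime_overhead))

theorem Learner.PolyEvaluable.polyTime_majority {A : Learner} (hA : A.PolyEvaluable) :
    PolyTime fun p : Data × List Bool => A.majority p.1.toList p.2 := by
  have he : PolyTime fun p : (Data × List Bool) × Data => A.eval p.2 p.1.2 :=
    hA.polyTime_eval.comp (PolyTime.snd.pair PolyTime.fst.right)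
  have hH : PolyTime fun p : Data × List Bool => p.1.toList := PolyTime.fst.toList
  have h0 : PolyTime fun p : (Data × List Bool) × Data => if A.eval p.2 p.1.2 then 0 else 1 :=
    he.ite (.const 0) (.const 1)
  have h1 : PolyTime fun p : (Data × List Bool) × Data => if A.eval p.2 p.1.2 then 1 else 0 :=
    he.ite (.const 1) (.const 0)
  have h2 := (hH.map (g := fun p h => if A.eval h p.2 then 0 else 1) h0).sum.succ
  have h3 := (hH.map (g := fun p h => if A.eval h p.2 then 1 else 0) h1).sum
  exact h2.le h3

end

/-! ### Analysis of one boosting stage -/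

section Weights

theorem weightOf_eq_countP (P : Ex → Bool) (items : List (Ex × ℕ)) :
    weightOf P items = (weighted items).countP P := by
  induction items with
  | nil => rfl
  | cons p l ih =>
    have h1 : weightOf P (p :: l) = (if P p.1 then (p.2 + 1) ^ 3 else 0) + weightOf P l := rfl
    have h2 : weighted (p :: l) = List.replicate ((p.2 + 1) ^ 3) p.1 ++ weighted l := rfl
    rw [h1, h2, List.countP_append, ih, List.countP_replicate]

theorem weightOf_add_not (P : Ex → Bool) (items : List (Ex × ℕ)) :
    weightOf (fun x => !P x) items + weightOf P items = (weighted items).length := by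
  rw [weightOf_eq_countP, weightOf_eq_countP, List.length_eq_countP_add_countP P, add_comm]
  simp

theorem sum_cyclic_blocks (L : List Ex) (P : Ex → Bool) (j : ℕ) :
    ∑ u ∈ Finset.range (j * L.length), (if P (cyclic L u) then 1 else 0) = j * L.countP P := by
  induction j with
  | zero => simp
  | succ j ih =>
    rw [Nat.succ_mul, Finset.sum_range_add, ih, Nat.succ_mul]
    congr 1
    have h1 : ∀ u ∈ Finset.range L.length, (if P (cyclic L (j * L.length + u)) then 1 else 0) =
        if P (L.getD u ([], false)) then 1 else 0 := fun u hu => by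
      rw [cyclic, Nat.mul_add_mod', Nat.mod_eq_of_lt (Finset.mem_range.1 hu)]
    rw [Finset.sum_congr rfl h1]
    clear h1 ih
    induction L with
    | nil => rfl
    | cons a L ih =>
      rw [List.length_cons, Finset.sum_range_succ', List.countP_cons]
      simpa using ih

/-- Counting only the complete cycles among the numbers below `m` loses less than one cycle; this is
the whole rounding error of the sampler. -/
theorem mul_countP_le_sum_cyclic (L : List Ex) (P : Ex → Bool) (m : ℕ) :
    m / L.length * L.countP P ≤ ∑ u ∈ Finset.range m, (if P (cyclic L u) then 1 else 0) := by
  rw [← sum_cyclic_blocks]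
  exact Finset.sum_le_sum_of_subset (Finset.range_subset_range.2 (Nat.div_mul_le_self _ _))

/-- A hypothesis that errs rarely on the simulated examples has small total weight of errors. -/
theorem weight_le_of_sum_cyclic {items : List (Ex × ℕ)} {P : Ex → Bool} {G k : ℕ} (hG : 0 < G)
    (hk : (weighted items).length * (4 * G) ≤ 2 ^ k)
    (h : (∑ u ∈ Finset.range (2 ^ k), (if P (cyclic (weighted items) u) then (0 : ℝ) else 1)) / 2 ^ k ≤
      1 / 2 - 1 / (2 * G)) :
    weightOf (fun x => !P x) items * (2 * G + 1) ≤ weightOf P items * (2 * G - 1) := by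
  set N := (weighted items).length with hN
  set W := weightOf (fun x => !P x) items with hW
  have hsum := weightOf_add_not P items
  rw [← hN, ← hW] at hsum
  rcases Nat.eq_zero_or_pos N with h0 | h0
  · have : W = 0 := by omega
    simp [this]
  have h1 := mul_countP_le_sum_cyclic (weighted items) (fun x => !P x) (2 ^ k)
  rw [← weightOf_eq_countP, ← hN, ← hW] at h1
  have h2 : ((2 ^ k / N * W : ℕ) : ℝ) ≤
      ∑ u ∈ Finset.range (2 ^ k), (if P (cyclic (weighted items) u) then (0 : ℝ) else 1) := by
    refine (Nat.cast_le.2 h1).trans_eq ?_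
    rw [Nat.cast_sum]
    refine Finset.sum_congr rfl fun u _ => ?_
    cases P (cyclic (weighted items) u) <;> simp
  have hG' : (0 : ℝ) < G := by exact_mod_cast hG
  have h2k : (0 : ℝ) < 2 ^ k := by positivity
  rw [div_le_iff₀ h2k] at h
  have h3 := h2.trans h
  have h4 : (2 : ℝ) ^ k < ((2 ^ k / N : ℕ) + 1) * N := by
    have := Nat.lt_div_mul_add (a := 2 ^ k) h0
    rw [← Nat.succ_mul] at this
    exact_mod_cast this
  have h5 : (N : ℝ) * (4 * G) ≤ 2 ^ k := by exact_mod_cast hk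
  have hWN : (W : ℝ) ≤ N := by exact_mod_cast (by omega : W ≤ N)
  have hN0 : (0 : ℝ) < N := by exact_mod_cast h0
  push_cast at h3
  set y : ℝ := ((2 ^ k / N : ℕ) : ℝ) with hy
  -- `W / N ≤ 1 / 2 - 1 / (4 G)`
  have h6 : (W : ℝ) * (4 * G) ≤ N * (2 * G - 1) := by
    have e1 : (W : ℝ) * 2 ^ k ≤ W * ((y + 1) * N) := by gcongr
    have e2 : (N : ℝ) * (y * W) ≤ N * ((1 / 2 - 1 / (2 * G)) * 2 ^ k) := by gcongr
    -- The incomplete last cycle costs at most a fraction `1/(4G)` of the `2 ^ k` draws, which is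
    -- why the sampler takes `2 ^ k` at least `4 G N`. Half of the advantage `1/(2G)` survives.
    have e3 : (N : ℝ) * W ≤ N * (2 ^ k / (4 * G)) := by
      gcongr
      rw [le_div_iff₀ (by positivity)]
      exact (mul_le_mul_of_nonneg_right hWN (by positivity)).trans h5
    have e4 : (W : ℝ) * 2 ^ k ≤ N * (1 / 2 - 1 / (4 * G)) * 2 ^ k := by
      have : (N : ℝ) * ((1 / 2 - 1 / (2 * G)) * 2 ^ k) + N * (2 ^ k / (4 * G)) =
        N * (1 / 2 - 1 / (4 * G)) * 2 ^ k := by field_simp; ring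
      nlinarith
    have e5 := mul_le_mul_of_nonneg_right (le_of_mul_le_mul_right e4 h2k)
      (by positivity : (0 : ℝ) ≤ 4 * G)
    have e6 : (N : ℝ) * (1 / 2 - 1 / (4 * G)) * (4 * G) = N * (2 * G - 1) := by field_simp; ring
    rwa [e6] at e5
  have hc : ((weightOf P items : ℕ) : ℝ) = N - W := by
    rw [← hsum]; push_cast; ring
  have h7 : ((W * (2 * G + 1) : ℕ) : ℝ) ≤ ((weightOf P items * (2 * G - 1) : ℕ) : ℝ) := by
    rw [Nat.cast_mul, Nat.cast_mul, Nat.cast_sub (by omega), hc]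
    push_cast
    nlinarith
  exact_mod_cast h7

/-- The potential after one round. -/
theorem potential_step {b c D y δ : ℝ} (hD : 1 ≤ D) (hy : 0 < y) (hb : 1 ≤ b)
    (hδ : |δ| ≤ D) (hc : c = max 1 (b + δ)) :
    c ^ 4 ≤ b ^ 4 + 4 * (b ^ 3 * δ) + 4 * D ^ 2 * (b ^ 4 / y + y) + 3 * D ^ 4 + 1 := by
  have h1 : c ^ 4 ≤ (b + δ) ^ 4 + 1 := by
    rcases max_cases 1 (b + δ) with ⟨h, -⟩ | ⟨h, -⟩
    · rw [hc, h]; nlinarith [sq_nonneg ((b + δ) ^ 2)]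
    · rw [hc, h]; linarith
  have h2 : δ ^ 2 ≤ D ^ 2 := sq_le_sq' (by linarith [abs_le.1 hδ]) (abs_le.1 hδ).2
  -- The second-order term is linearised around `y`, the current bound on the root mean fourth
  -- power: after summation both `b ^ 4 / y` and `y` contribute at most `y` per example.
  have h3 : 2 * b ^ 2 ≤ b ^ 4 / y + y := by
    rw [← sub_nonneg]
    have : b ^ 4 / y + y - 2 * b ^ 2 = (b ^ 2 - y) ^ 2 / y := by field_simp; ring
    rw [this]; positivity
  have h4 : (b + δ) ^ 4 ≤ b ^ 4 + 4 * (b ^ 3 * δ) + 8 * (b ^ 2 * δ ^ 2) + 3 * (δ ^ 2) ^ 2 := by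
    nlinarith [sq_nonneg (b * δ - δ ^ 2)]
  have h5 : b ^ 2 * δ ^ 2 ≤ b ^ 2 * D ^ 2 := by gcongr
  have h6 : (δ ^ 2) ^ 2 ≤ (D ^ 2) ^ 2 := by gcongr
  have h7 : 2 * b ^ 2 * (4 * D ^ 2) ≤ (b ^ 4 / y + y) * (4 * D ^ 2) := by gcongr
  nlinarith

end Weights

/-! ### Deficits, potential and the majority vote -/

section Stage

variable {n : ℕ} (A : Learner) (d : ℕ) (f : Point n → Bool)

/-- The example at `x` labelled by `f`. -/
def toEx (x : Point n) : Ex := (List.ofFn x, f x)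

/-- The examples `S` with deficits `a`. -/
def itemsOf (S : List (Point n)) (a : Point n → ℕ) : List (Ex × ℕ) :=
  S.map fun x => (toEx f x, a x)

theorem weightOf_itemsOf (S : List (Point n)) (a : Point n → ℕ) (P : Ex → Bool) :
    weightOf P (itemsOf f S a) =
      (S.map fun x => if P (toEx f x) then (a x + 1) ^ 3 else 0).sum := by
  simp [weightOf, itemsOf, Function.comp_def]

theorem reweight_itemsOf (S : List (Point n)) (a : Point n → ℕ) (P : Ex → Bool) (g : ℕ) :
    reweight g P (itemsOf f S a) =
      itemsOf f S fun x => if P (toEx f x) then a x - (g - 1) else a x + (g + 1) := by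
  simp [reweight, itemsOf, Function.comp_def]

/-- The potential of the deficits `a` on the sample `S`. -/
noncomputable def potential (S : List (Point n)) (a : Point n → ℕ) : ℝ :=
  (S.map fun x => ((a x : ℝ) + 1) ^ 4).sum

/-- The state of a boosting stage is one that can be reached, with `T` weak hypotheses wanted
at the start. -/
structure Reachable (S : List (Point n)) (T : ℕ) (st : Stage) : Prop where
  count : st.2.1.length + st.2.2 = T
  exists_deficit : ∃ a : Point n → ℕ, st.1 = itemsOf f S a ∧
    potential S a ≤ S.length * (4 * (2 * advInv d n + 1) ^ 2 * st.2.1.length + 1) ^ 2 ∧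
    ∀ x, (st.2.1.length : ℤ) + 2 * advInv d n * (st.2.1.countP (fun h => !A.agrees h (toEx f x)) -
      st.2.1.countP (fun h => A.agrees h (toEx f x))) ≤ a x + 1

variable {A d f}

/-- The potential is the sum of `b ^ 4` with `b = a + 1`, so its first-order change is governed by
the weights `b ^ 3`. The acceptance test says exactly that `∑ b ^ 3 δ ≤ 0` for the increments `δ = 1
∓ 2G`. What remains is of second order and raises the bound on the root mean fourth power by `4 D ^
2` per round, where `D = 2G + 1`. -/
theorem potential_sum {S : List (Point n)} {a : Point n → ℕ} {P : Ex → Bool} {G t : ℕ} (hG : 0 < G)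
    (hw : weightOf (fun x => !P x) (itemsOf f S a) * (2 * G + 1) ≤
      weightOf P (itemsOf f S a) * (2 * G - 1))
    (hp : potential S a ≤ S.length * (4 * (2 * G + 1) ^ 2 * t + 1) ^ 2) :
    potential S (fun x => if P (toEx f x) then a x - (2 * G - 1) else a x + (2 * G + 1)) ≤
      S.length * (4 * (2 * G + 1) ^ 2 * (t + 1 : ℕ) + 1) ^ 2 := by
  have hG1 : (1 : ℝ) ≤ G := by exact_mod_cast hG
  set D : ℝ := 2 * G + 1 with hD
  set y : ℝ := 4 * D ^ 2 * t + 1 with hy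
  have hy0 : 0 < y := by positivity
  let δ : Point n → ℝ := fun x => if P (toEx f x) then 1 - 2 * G else 1 + 2 * G
  have hstep : ∀ x, (((if P (toEx f x) then a x - (2 * G - 1) else a x + (2 * G + 1) : ℕ) : ℝ)
      + 1) ^ 4 ≤ (((a x : ℝ) + 1) ^ 4 + 4 * (((a x : ℝ) + 1) ^ 3 * δ x)) +
        (4 * D ^ 2 * (((a x : ℝ) + 1) ^ 4 / y + y) + (3 * D ^ 4 + 1)) := fun x => by
    refine (potential_step (b := (a x : ℝ) + 1) (δ := δ x) (D := D) (y := y) (by linarith) hy0 (by simp) ?_ ?_).trans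
      (le_of_eq (by ring))
    · simp only [δ]
      split_ifs
      · rw [abs_le]; constructor <;> linarith
      · rw [abs_le]; constructor <;> linarith
    · simp only [δ]
      split_ifs
      · by_cases h : 2 * G - 1 ≤ a x
        · rw [Nat.cast_sub h, Nat.cast_sub (by omega), max_eq_right]
          · push_cast; ring
          · have : ((2 * G : ℕ) : ℝ) ≤ (a x + 1 : ℕ) := by exact_mod_cast (by omega)
            push_cast at this; linarith
        · rw [Nat.sub_eq_zero_of_le (by omega), max_eq_left]
          · simp
          · have : ((a x + 1 : ℕ) : ℝ) ≤ (2 * G : ℕ) := by exact_mod_cast (by omega)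
            push_cast at this; linarith
      · have : (0 : ℝ) ≤ a x := Nat.cast_nonneg _
        rw [max_eq_right (by linarith)]
        push_cast; ring
  have hsum : (S.map fun x => ((a x : ℝ) + 1) ^ 3 * δ x).sum ≤ 0 := by
    have h1 : (S.map fun x => ((a x : ℝ) + 1) ^ 3 * δ x).sum =
        ((weightOf (fun x => !P x) (itemsOf f S a) * (2 * G + 1) : ℕ) : ℝ) -
          ((weightOf P (itemsOf f S a) * (2 * G - 1) : ℕ) : ℝ) := by
      rw [weightOf_itemsOf, weightOf_itemsOf]
      push_cast [Nat.cast_sub (by omega : 1 ≤ 2 * G)]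
      clear hw hp
      induction S with
      | nil => simp
      | cons x S ih =>
        simp only [List.map_cons, List.sum_cons, ih, δ]
        cases P (toEx f x)
        · simp; ring
        · simp; ring
    rw [h1, sub_nonpos]
    exact_mod_cast hw
  rw [potential]
  refine (List.sum_le_sum fun x _ => hstep x).trans ?_
  rw [List.sum_map_add, List.sum_map_add, List.sum_map_mul_left, List.sum_map_add,
    List.sum_map_mul_left, List.sum_map_add]
  simp only [List.map_const', List.sum_replicate, nsmul_eq_mul, div_eq_mul_inv]
  rw [List.sum_map_mul_right]
  change potential S a + _ + (_ * (potential S a * _ + _) + _) ≤ _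
  have h2 : potential S a * y⁻¹ ≤ S.length * y := by
    rw [← div_eq_mul_inv, div_le_iff₀ hy0]
    linarith
  have hm : (0 : ℝ) ≤ S.length := Nat.cast_nonneg _
  have h3 : 4 * D ^ 2 * (potential S a * y⁻¹ + S.length * y) ≤
      4 * D ^ 2 * (S.length * y + S.length * y) := by gcongr
  have h4 : y + 4 * D ^ 2 = 4 * D ^ 2 * (t + 1 : ℕ) + 1 := by rw [hy]; push_cast; ring
  rw [← h4]
  -- The new sum is at most `y ^ 2 + 8 D ^ 2 y + 3 D ^ 4 + 1` per example, against `(y + 4 D ^ 2) ^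
  -- 2`; the slack is `13 D ^ 4 - 1`.
  have h5 : (1 : ℝ) ≤ D ^ 4 := one_le_pow₀ (by linarith)
  nlinarith [mul_nonneg hm (by linarith : (0:ℝ) ≤ 13 * D ^ 4 - 1)]

/-- An accepted round adds `1 - 2G` or `1 + 2G` to the vote balance of each example. Deficits change
by the same amount, except that they are cut off at 0, which only raises them and so preserves the
inequality. -/
theorem Reachable.update {S : List (Point n)} {T : ℕ} {st : Stage} (hst : Reachable A d f S T st)
    (hG : 0 < advInv d n) (par : Params) (hn : par.1 = n) (h : Data) :
    Reachable A d f S T (update A d par st h) := by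
  unfold DistPAC.update
  split_ifs with hc
  swap
  · exact hst
  rw [Bool.and_eq_true, decide_eq_true_eq, decide_eq_true_eq, hn] at hc
  obtain ⟨hc1, hc2⟩ := hc
  obtain ⟨hcount, a, ha, hpot, hvote⟩ := hst
  rw [ha] at hc2
  refine ⟨by simp only [List.length_cons]; omega, _, by rw [ha]; exact reweight_itemsOf f S a _ _, ?_, ?_⟩
  · rw [hn]
    exact potential_sum hG hc2 hpot
  · intro x
    rw [hn]
    have := hvote x
    cases hx : A.agrees h (toEx f x)
    · simp only [hx, List.length_cons, List.countP_cons]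
      push_cast
      simp
      linarith
    · have hG2 : ((advInv d n : ℕ) : ℤ) ≥ 1 := by exact_mod_cast hG
      simp only [hx, List.length_cons, List.countP_cons]
      push_cast
      simp
      have h3 : ((a x - (2 * advInv d n - 1) : ℕ) : ℤ) ≥ (a x : ℤ) - (2 * advInv d n - 1) := by omega
      linarith

theorem reachable_start (S : List (Point n)) (q : ℕ) (par : Params) (hn : par.1 = n) :
    Reachable A d f S (rounds d n q) (startStage d par (S.map (toEx f)) q).1 := by
  refine ⟨by simp [startStage, hn], fun _ => 0, ?_, ?_, fun x => ?_⟩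
  · simp [startStage, itemsOf, Function.comp_def]
  · simp [startStage, potential]
  · simp [startStage]

theorem List.countP_eq_sum_map {α : Type*} (p : α → Bool) (l : List α) :
    l.countP p = (l.map fun x => if p x then 1 else 0).sum := by
  induction l with
  | nil => rfl
  | cons a l ih => rw [List.countP_cons, ih, List.map_cons, List.sum_cons, add_comm]

/-- With `T` hypotheses the invariant reads `T + 2G (wrong - right) ≤ a x + 1`. A single deficit is
bounded through the total potential, and once `a x + 1 < T` the right votes must be in the strict
majority. -/
theorem Reachable.majority_eq {S : List (Point n)} {q : ℕ} {st : Stage}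
    (hst : Reachable A d f S (rounds d n q) st) (hG : 0 < advInv d n) (hS : S.length = q ^ 2)
    (h0 : st.2.2 = 0) {x : Point n} (hx : x ∈ S) : A.majority st.2.1 (List.ofFn x) = f x := by
  obtain ⟨hcount, a, -, hpot, hvote⟩ := hst
  have hT : st.2.1.length = rounds d n q := by omega
  have hv := hvote x
  set W := st.2.1.countP fun h => !A.agrees h (toEx f x) with hW
  set R := st.2.1.countP fun h => A.agrees h (toEx f x) with hR
  have hb : (a x : ℝ) + 1 < rounds d n q := by
    have hle : ((a x : ℝ) + 1) ^ 4 ≤ potential S a :=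
      List.single_le_sum (fun y hy => by
        obtain ⟨z, -, rfl⟩ := List.mem_map.1 hy
        positivity) _ (List.mem_map_of_mem hx)
    have h1 := hle.trans hpot
    rw [hT, hS] at h1
    set D : ℝ := 2 * advInv d n + 1 with hD
    have hD1 : 1 ≤ D := by
      have : (0 : ℝ) ≤ advInv d n := Nat.cast_nonneg _
      linarith
    set t : ℝ := ((rounds d n q : ℕ) : ℝ) with ht
    have htq : t = 5 * D ^ 2 * q + 1 := by rw [ht, rounds, hD]; push_cast; ring
    have hq : (0 : ℝ) ≤ q := Nat.cast_nonneg _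
    have ht1 : 1 ≤ t := by rw [htq]; have : 0 ≤ 5 * D ^ 2 * q := by positivity
                           linarith
    have h2 : ((a x : ℝ) + 1) ^ 4 ≤ (q * (4 * D ^ 2 * t + 1)) ^ 2 := by
      refine h1.trans_eq ?_; push_cast; ring
    -- This is what fixes `rounds = 5 D ^ 2 q + 1`: the potential contributes `4 D ^ 2 q t`, and the
    -- fifth `D ^ 2 q t` absorbs the leftover `q`.
    have h3 : q * (4 * D ^ 2 * t + 1) < t ^ 2 := by
      have : t ^ 2 = (5 * D ^ 2 * q + 1) * t := by rw [sq]; nth_rewrite 1 [htq]; rfl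
      rw [this]
      have h5 : q * 1 ≤ (q : ℝ) * (D ^ 2 * t) := by
        gcongr
        exact one_le_mul_of_one_le_of_one_le (one_le_pow₀ hD1) ht1
      nlinarith
    by_contra hcon
    rw [not_lt] at hcon
    have h4 : t ^ 4 ≤ ((a x : ℝ) + 1) ^ 4 := by gcongr
    have h5 : (q * (4 * D ^ 2 * t + 1)) ^ 2 < (t ^ 2) ^ 2 := by gcongr
    nlinarith
  -- Otherwise the vote term would be nonnegative, forcing `a x + 1` up to the number of rounds.
  have hWR : W < R := by
    by_contra hcon
    have h1 : (0 : ℤ) ≤ 2 * advInv d n * ((W : ℤ) - R) :=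
      mul_nonneg (by positivity) (by omega)
    have h2 : a x + 1 < rounds d n q := by exact_mod_cast hb
    omega
  have hag : ∀ h, A.agrees h (toEx f x) = (A.eval h (List.ofFn x) == f x) := fun h => rfl
  rw [hW, hR, List.countP_eq_sum_map, List.countP_eq_sum_map] at hWR
  simp only [hag] at hWR
  unfold Learner.majority
  cases hf : f x with
  | true =>
    simp only [decide_eq_true_eq]
    refine lt_of_eq_of_lt ?_ (hWR.trans_eq ?_)
    · congr 2; funext h; cases A.eval h (List.ofFn x) <;> simp [hf]
    · congr 2; funext h; cases A.eval h (List.ofFn x) <;> simp [hf]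
  | false =>
    simp only [decide_eq_false_iff_not, not_le, Nat.lt_succ_iff]
    refine le_of_eq_of_le ?_ (hWR.le.trans_eq ?_)
    · congr 2; funext h; cases A.eval h (List.ofFn x) <;> simp [hf]
    · congr 2; funext h; cases A.eval h (List.ofFn x) <;> simp [hf]

end Stage

/-! ### Success probability of a boosting stage -/

namespace FTree

variable {α : Type}

theorem mean_sub_mul (τ : FTree α) (c e : ℝ) (φ : α → ℝ) :
    (τ.mean fun a => c - e * φ a) = c - e * τ.mean φ := by
  induction τ with
  | ret a => rfl
  | flip κ ih => simp only [mean, ih]; ring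

theorem mean_mul (τ : FTree α) (c : ℝ) (φ : α → ℝ) :
    (τ.mean fun a => c * φ a) = c * τ.mean φ := by
  induction τ with
  | ret a => rfl
  | flip κ ih => simp only [mean, ih]; ring

end FTree

section Trials

variable {n : ℕ} (A : Learner) (d : ℕ) (f : Point n → Bool) (F : ℕ) (par : Params)

/-- The point encoded by a list of bits. -/
def toPoint (n : ℕ) (l : List Bool) : Point n := fun i => l.getD i false

theorem toPoint_ofFn (x : Point n) : toPoint n (List.ofFn x) = x := by
  funext i
  simp [toPoint]

/-- The computation tree of the weak learner, for confidence `1 / 2`. -/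
def weakTree : ITree (Point n) Outcome :=
  A.train.interp (fun x => enc (toEx f x)) F (initStore [enc n, enc 2, enc par.2.2.2])

/-- The outcomes in which the weak learner finds a hypothesis with small error under `ρ`. -/
def Accurate (ρ : PMF (Point n)) : Set Outcome :=
  {o | ∃ t v, o = some (t, v) ∧ ρ.toMeasure.real {x | A.eval (v 0) (List.ofFn x) ≠ f x} ≤
    1 / 2 - 1 / (2 * advInv d n)}

/-- The weak learner is successful on `f`. -/
def WeaklyLearns : Prop :=
  ∀ ρ : PMF (Point n), 1 / (2 * (advInv d n : ℝ)) ≤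
    (weakTree A f F par).mean ρ ((Accurate A d f ρ).indicator 1)

/-- The sampled point with number `u`. -/
def pickPoint (st : Stage) (u : ℕ) : Point n := toPoint n (cyclic (samplerData d par st).1 u).1

/-- One run of the weak learner within a boosting stage. -/
noncomputable def trial (st : Stage) : FTree Stage :=
  ((weakTree A f F par).expand (samplerData d par st).2 (pickPoint d par st)).bind fun o => .ret
    (match o with
      | none => st
      | some (_, v) => update A d par st (v 0))

/-- Several runs of the weak learner. -/
noncomputable def trialsTree : ℕ → Stage → FTree Stage
  | 0, st => .ret st
  | k + 1, st => (trial A d f F par st).bind (trialsTree k)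

variable {A d f F par}

theorem Reachable.walk_trial {S : List (Point n)} {T : ℕ} {st : Stage}
    (hst : Reachable A d f S T st) (hG : 0 < advInv d n) (hn : par.1 = n) (r : ℕ → Bool) :
    Reachable A d f S T ((trial A d f F par st).walk r).1 := by
  rw [trial, FTree.walk_bind, FTree.walk]
  split
  · exact hst
  · exact hst.update hG par hn _

theorem Reachable.walk_trialsTree {S : List (Point n)} {T : ℕ} (hG : 0 < advInv d n)
    (hn : par.1 = n) (k : ℕ) {st : Stage} (hst : Reachable A d f S T st) (r : ℕ → Bool) :
    Reachable A d f S T ((trialsTree A d f F par k st).walk r).1 := by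
  induction k generalizing st r with
  | zero => exact hst
  | succ k ih =>
    rw [trialsTree, FTree.walk_bind]
    exact ih (hst.walk_trial hG hn r) _

/-- All weights are positive, so the repetition list is nonempty and the default value of `cyclic`
is never used: the simulated oracle only returns points of the sample with their true labels. -/
theorem Reachable.cyclic_eq {S : List (Point n)} {T : ℕ} {st : Stage} (hst : Reachable A d f S T st)
    (hS : S ≠ []) (u : ℕ) : cyclic (samplerData d par st).1 u = toEx f (pickPoint d par st u) := by
  obtain ⟨-, a, ha, -⟩ := hst
  have hL : (samplerData d par st).1 = weighted (itemsOf f S a) := by rw [← ha]; rfl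
  have hne : weighted (itemsOf f S a) ≠ [] := by
    obtain ⟨x, S, rfl⟩ := List.exists_cons_of_ne_nil hS
    intro h
    have h1 : toEx f x ∈ weighted (itemsOf f (x :: S) a) :=
      List.mem_flatten.2 ⟨_, List.mem_map.2 ⟨(toEx f x, a x), by simp [itemsOf], rfl⟩,
        List.mem_replicate.2 ⟨by positivity, rfl⟩⟩
    simp [h] at h1
  have hmem : cyclic (samplerData d par st).1 u ∈ weighted (itemsOf f S a) := by
    have hlt := Nat.mod_lt u (List.length_pos_of_ne_nil hne)
    rw [cyclic, hL, List.getD_eq_getElem _ _ hlt]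
    exact List.getElem_mem hlt
  obtain ⟨l, hl, hu⟩ := List.mem_flatten.1 hmem
  obtain ⟨p, hp, rfl⟩ := List.mem_map.1 hl
  obtain ⟨x, hx, rfl⟩ := List.mem_map.1 hp
  have h := (List.mem_replicate.1 hu).2
  rw [pickPoint, h]
  simp [toEx, toPoint_ofFn]

/-- Accurate weak hypotheses for the sampling distribution are accepted. -/
theorem Reachable.update_count {S : List (Point n)} {T : ℕ} {st : Stage}
    (hst : Reachable A d f S T st) (hS : S ≠ []) (hG : 0 < advInv d n) (hn : par.1 = n)
    (hpos : 1 ≤ st.2.2) {h : Data}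
    (herr : (ITree.pickLaw (samplerData d par st).2 (pickPoint d par st)).toMeasure.real
      {x : Point n | A.eval h (List.ofFn x) ≠ f x} ≤ 1 / 2 - 1 / (2 * advInv d n)) :
    (DistPAC.update A d par st h).2.2 = st.2.2 - 1 := by
  classical
  unfold DistPAC.update
  rw [if_pos]
  rw [Bool.and_eq_true, decide_eq_true_eq, decide_eq_true_eq, hn]
  refine ⟨hpos, weight_le_of_sum_cyclic hG (k := (samplerData d par st).2) ?_ ?_⟩
  · rw [samplerData, hn]; exact le_two_pow_log2 _
  · refine le_of_eq_of_le ?_ herr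
    rw [Measure.real, PMF.toMeasure_apply_fintype, ENNReal.toReal_sum fun x _ => by
      rw [Set.indicator_apply]; split_ifs
      · exact PMF.apply_ne_top _ _
      · simp]
    have h1 := ITree.sum_pickLaw (samplerData d par st).2 (pickPoint (n := n) d par st)
      fun x => if A.eval h (List.ofFn x) ≠ f x then 1 else 0
    refine Eq.trans ?_ (h1.symm.trans (Finset.sum_congr rfl fun x _ => ?_))
    · congr 1
      refine Finset.sum_congr rfl fun u _ => ?_
      have h2 : cyclic (weighted st.1) u = toEx f (pickPoint d par st u) := hst.cyclic_eq hS u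
      rw [h2, Learner.agrees, toEx]
      by_cases h3 : A.eval h (List.ofFn (pickPoint (n := n) d par st u)) = f (pickPoint d par st u) <;>
        simp [h3]
    · rw [Set.indicator_apply]
      by_cases h3 : A.eval h (List.ofFn x) = f x <;> simp [h3]

/-- If a hypothesis is still wanted, success halves `2 ^ (number wanted)` and failure does not
increase it. Success has probability at least `1/(2G)`, whatever the current weights, because the
weak guarantee holds for every distribution. Subtracting 1 makes 0 the absorbing value. -/
theorem WeaklyLearns.mean_trial_le (hW : WeaklyLearns A d f F par) {S : List (Point n)} {T : ℕ}
    {st : Stage} (hst : Reachable A d f S T st) (hS : S ≠ []) (hG : 0 < advInv d n) (hn : par.1 = n) :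
    (trial A d f F par st).mean (fun st' => 2 ^ st'.2.2 - 1) ≤
      (1 - 1 / (4 * (advInv d n : ℝ))) * (2 ^ st.2.2 - 1) := by
  set ρ := ITree.pickLaw (samplerData d par st).2 (pickPoint (n := n) d par st) with hρ
  have hle : ∀ h : Data, (update A d par st h).2.2 ≤ st.2.2 := fun h => by
    unfold update; split_ifs
    · exact Nat.sub_le _ _
    · exact le_rfl
  rw [trial, FTree.mean_bind]
  simp only [FTree.mean]
  rcases Nat.eq_zero_or_pos st.2.2 with h0 | h0
  · rw [h0]
    refine (FTree.mean_mono (ψ := fun _ => 0) fun o => ?_).trans (by rw [FTree.mean_const]; simp)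
    split
    · simp [h0]
    · simp [Nat.le_zero.1 ((hle _).trans_eq h0)]
  · have h2 : (2 : ℝ) ^ st.2.2 = 2 * 2 ^ (st.2.2 - 1) := by
      rw [← pow_succ']; congr 1; omega
    set y : ℝ := 2 ^ (st.2.2 - 1) with hy
    have hy1 : 1 ≤ y := one_le_pow₀ (by norm_num)
    refine (FTree.mean_mono (ψ := fun o => (2 * y - 1) - y * (Accurate A d f ρ).indicator 1 o)
      fun o => ?_).trans ?_
    · by_cases ho : o ∈ Accurate A d f ρ
      · rw [Set.indicator_of_mem ho]
        obtain ⟨t, v, rfl, hv⟩ := ho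
        simp only [Pi.one_apply, mul_one]
        rw [hst.update_count hS hG hn h0 hv]
        linarith
      · rw [Set.indicator_of_notMem ho, mul_zero, sub_zero, ← h2]
        split
        · exact le_rfl
        · exact sub_le_sub_right (pow_le_pow_right₀ (by norm_num) (hle _)) _
    · rw [FTree.mean_sub_mul, ITree.mean_expand, h2]
      have h3 := hW ρ
      have hG' : (0 : ℝ) < advInv d n := by exact_mod_cast hG
      have h4 : y * (1 / (2 * (advInv d n : ℝ))) ≤
          y * (weakTree A f F par).mean ρ ((Accurate A d f ρ).indicator 1) := by gcongr
      have h5 : (1 - 1 / (4 * (advInv d n : ℝ))) * (2 * y - 1) =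
        2 * y - 1 - y * (1 / (2 * (advInv d n : ℝ))) + 1 / (4 * (advInv d n : ℝ)) := by
          field_simp; ring
      have h6 : 0 ≤ 1 / (4 * (advInv d n : ℝ)) := by positivity
      rw [h5]
      linarith

theorem WeaklyLearns.mean_trialsTree_le (hW : WeaklyLearns A d f F par) {S : List (Point n)} {T : ℕ}
    (hS : S ≠ []) (hG : 0 < advInv d n) (hn : par.1 = n) (k : ℕ) {st : Stage}
    (hst : Reachable A d f S T st) :
    (trialsTree A d f F par k st).mean (fun st' => 2 ^ st'.2.2 - 1) ≤
      (1 - 1 / (4 * (advInv d n : ℝ))) ^ k * (2 ^ st.2.2 - 1) := by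
  have hp : 0 ≤ 1 - 1 / (4 * (advInv d n : ℝ)) := by
    have : (1 : ℝ) ≤ advInv d n := by exact_mod_cast hG
    rw [sub_nonneg, div_le_one (by linarith)]; linarith
  induction k generalizing st with
  | zero => simp [trialsTree, FTree.mean]
  | succ k ih =>
    rw [trialsTree, FTree.mean_bind]
    have h1 : (trial A d f F par st).mean (fun a =>
        (trialsTree A d f F par k a).mean fun st' => 2 ^ st'.2.2 - 1) ≤
        (trial A d f F par st).mean fun a => (1 - 1 / (4 * (advInv d n : ℝ))) ^ k * (2 ^ a.2.2 - 1) := by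
      rw [trial, FTree.mean_bind, FTree.mean_bind]
      refine FTree.mean_mono fun o => ?_
      simp only [FTree.mean]
      split
      · exact ih hst
      · exact ih (hst.update hG par hn _)
    refine h1.trans ?_
    rw [FTree.mean_mul, pow_succ, mul_assoc]
    exact mul_le_mul_of_nonneg_left (hW.mean_trial_le hst hS hG hn) (pow_nonneg hp _)

/-- `(1 - 1 / N) ^ m ≤ 2 ^ (-j)` if `N j ≤ m`. -/
theorem one_sub_inv_pow_le {N m j : ℕ} (hN : 0 < N) (h : N * j ≤ m) :
    (1 - 1 / (N : ℝ)) ^ m ≤ (1 / 2) ^ j := by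
  have hN' : (1 : ℝ) ≤ N := by exact_mod_cast hN
  have h0 : 0 ≤ 1 - 1 / (N : ℝ) := by rw [sub_nonneg, div_le_one (by linarith)]; exact hN'
  have h1 : (1 - 1 / (N : ℝ)) ^ N ≤ 1 / 2 := by
    have h2 := Real.one_sub_div_pow_le_exp_neg (n := N) (t := 1) hN'
    refine h2.trans ?_
    rw [Real.exp_neg, one_div]
    gcongr
    have := Real.add_one_le_exp (1 : ℝ)
    linarith
  calc (1 - 1 / (N : ℝ)) ^ m ≤ (1 - 1 / (N : ℝ)) ^ (N * j) :=
        pow_le_pow_of_le_one h0 (by have : 0 ≤ 1 / (N : ℝ) := by positivity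
                                    linarith) h
    _ = ((1 - 1 / (N : ℝ)) ^ N) ^ j := pow_mul _ _ _
    _ ≤ (1 / 2) ^ j := by gcongr

/-- The trials of stage `q`, for the sample `S`. -/
noncomputable def stageTree (A : Learner) (d : ℕ) (f : Point n → Bool) (F : ℕ) (par : Params)
    (S : List (Point n)) (q : ℕ) : FTree Stage :=
  trialsTree A d f F par (startStage d par (S.map (toEx f)) q).2
    (startStage d par (S.map (toEx f)) q).1

/-- A wrong majority means that hypotheses are still wanted at the end. The exponent of the bound
leaves room for the `2 ^ (n q ^ 2)` possible samples, for the sum over the stages and for the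
confidence. -/
theorem WeaklyLearns.real_stageTree_le (hW : WeaklyLearns A d f F par) {S : List (Point n)} {q : ℕ}
    (hq : 0 < q) (hS : S.length = q ^ 2) (hG : 0 < advInv d n) (hn : par.1 = n) :
    (stageTree A d f F par S q).mean
      ({st | ∃ x ∈ S, A.majority st.2.1 (List.ofFn x) ≠ f x}.indicator 1) ≤
      (1 / 2) ^ (n * q ^ 2 + q + 1 + par.2.2.1) := by
  rw [← FTree.coinMeasure_real_walk]
  have hS0 : S ≠ [] := by
    rintro rfl
    have := pow_pos hq 2
    simp at hS
    omega
  have hst := reachable_start (A := A) (d := d) (f := f) S q par hn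
  have h1 : {r | ((stageTree A d f F par S q).walk r).1 ∈
        {st : Stage | ∃ x ∈ S, A.majority st.2.1 (List.ofFn x) ≠ f x}} ⊆
      {r | ((stageTree A d f F par S q).walk r).1 ∈ {st : Stage | st.2.2 ≠ 0}} := by
    rintro r ⟨x, hx, hne⟩ h0
    exact hne ((hst.walk_trialsTree hG hn _ r).majority_eq hG hS h0 hx)
  refine (measureReal_mono h1).trans ?_
  rw [FTree.coinMeasure_real_walk]
  -- Markov's inequality: `2 ^ j - 1` is at least 1 as soon as `j` is not 0.
  refine (FTree.mean_mono (ψ := fun st => 2 ^ st.2.2 - 1) fun st => ?_).trans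
    ((hW.mean_trialsTree_le hS0 hG hn _ hst).trans ?_)
  · by_cases h : st.2.2 = 0
    · simp [h]
    · rw [Set.indicator_of_mem h]
      have : (2 : ℝ) ^ 1 ≤ 2 ^ st.2.2 := pow_le_pow_right₀ (by norm_num) (Nat.one_le_iff_ne_zero.2 h)
      simp only [Pi.one_apply]
      linarith
  · change (1 - 1 / (4 * (advInv d n : ℝ))) ^ trials d par q * (2 ^ rounds d par.1 q - 1) ≤ _
    -- The contraction factor is `1 - 1/(4G)`, so each `4G` trials halve the expectation. The first
    -- `rounds` halvings cancel the initial value, the others give the bound.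
    have h2 := one_sub_inv_pow_le (N := 4 * advInv d n) (m := trials d par q) (by omega)
      (by rw [trials, hn])
    push_cast at h2
    have h3 : (1 / 2 : ℝ) ^ (rounds d n q + n * q ^ 2 + q + 1 + par.2.2.1) * 2 ^ rounds d n q =
        (1 / 2) ^ (n * q ^ 2 + q + 1 + par.2.2.1) := by
      rw [show rounds d n q + n * q ^ 2 + q + 1 + par.2.2.1 =
        rounds d n q + (n * q ^ 2 + q + 1 + par.2.2.1) by ring, pow_add, mul_right_comm, ← mul_pow]
      norm_num
    rw [← h3, hn]
    have h4 : (0 : ℝ) ≤ 2 ^ rounds d n q - 1 := by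
      have : (1 : ℝ) ≤ 2 ^ rounds d n q := one_le_pow₀ (by norm_num)
      linarith
    exact mul_le_mul h2 (by linarith) h4 (by positivity)

end Trials

/-! ### All stages together -/

/-! ### Kraft's inequality for binary trees -/

section Kraft

open scoped ENNReal

/-- Trees of bounded depth. -/
noncomputable def trees : ℕ → Finset Data
  | 0 => ∅
  | k + 1 => open Classical in
    insert .nil ((trees k ×ˢ trees k).image fun p => .cons p.1 p.2)

/-- The sum `x` over trees of bounded depth satisfies `x' = 1/2 + x ^ 2 / 2`, and this recursion
preserves `x ≤ 1`. -/
theorem sum_trees_le (k : ℕ) : ∑ d ∈ trees k, (2⁻¹ : ℝ≥0∞) ^ d.size ≤ 1 := by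
  classical
  induction k with
  | zero => simp [trees]
  | succ k ih =>
    rw [trees, Finset.sum_insert (by simp)]
    have h1 : ∑ d ∈ (trees k ×ˢ trees k).image (fun p => Data.cons p.1 p.2),
        (2⁻¹ : ℝ≥0∞) ^ d.size ≤ 2⁻¹ * ((∑ d ∈ trees k, (2⁻¹ : ℝ≥0∞) ^ d.size) *
          ∑ d ∈ trees k, (2⁻¹ : ℝ≥0∞) ^ d.size) := by
      rw [Finset.sum_image (fun p _ q _ h => by
        simp only [Data.cons.injEq] at h; exact Prod.ext h.1 h.2), Finset.sum_mul_sum,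
        ← Finset.sum_product', Finset.mul_sum]
      exact le_of_eq (Finset.sum_congr rfl fun p _ => by
        rw [Data.size, pow_add, pow_add, pow_one, mul_assoc])
    have h2 : (∑ d ∈ trees k, (2⁻¹ : ℝ≥0∞) ^ d.size) *
        ∑ d ∈ trees k, (2⁻¹ : ℝ≥0∞) ^ d.size ≤ 1 := by
      simpa using mul_le_mul' ih ih
    calc (2⁻¹ : ℝ≥0∞) ^ Data.nil.size + _ ≤ 2⁻¹ ^ Data.nil.size + 2⁻¹ * 1 :=
          add_le_add_right (h1.trans (mul_le_mul_right h2 _)) _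
      _ = 1 := by rw [Data.size, pow_one, mul_one, ENNReal.inv_two_add_inv_two]

theorem trees_mono : Monotone trees := by
  classical
  refine monotone_nat_of_le_succ fun k => ?_
  induction k with
  | zero => simp [trees]
  | succ k ih =>
    rw [trees, trees]
    exact Finset.insert_subset_insert _ (Finset.image_subset_image (Finset.product_subset_product ih ih))

theorem mem_trees_size (d : Data) : d ∈ trees d.size := by
  classical
  induction d with
  | nil => simp [trees, Data.size]
  | cons a b iha ihb =>
    rw [Data.size, show 1 + a.size + b.size = (a.size + b.size) + 1 by ring, trees]
    exact Finset.mem_insert_of_mem (Finset.mem_image.2 ⟨(a, b), Finset.mem_product.2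
      ⟨trees_mono (Nat.le_add_right _ _) iha, trees_mono (Nat.le_add_left _ _) ihb⟩, rfl⟩)

theorem tsum_size_le : ∑' d : Data, (2⁻¹ : ℝ≥0∞) ^ d.size ≤ 1 := by
  rw [ENNReal.tsum_eq_iSup_sum]
  refine iSup_le fun s => ?_
  refine (Finset.sum_le_sum_of_subset fun d hd => ?_).trans (sum_trees_le (s.sup Data.size))
  exact trees_mono (Finset.le_sup (f := Data.size) hd) (mem_trees_size d)

/-- A numbering of trees. -/
def Data.number : Data → ℕ
  | .nil => 0
  | .cons a b => Nat.pair a.number b.number + 1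

theorem Data.number_injective : Function.Injective Data.number := by
  intro d
  induction d with
  | nil => intro e h; cases e <;> simp [number] at h ⊢
  | cons a b iha ihb =>
    intro e h
    cases e with
    | nil => simp [number] at h
    | cons a' b' =>
      simp only [number, Nat.add_right_cancel_iff, Nat.pair_eq_pair] at h
      rw [iha h.1, ihb h.2]

instance : Countable Data := Data.number_injective.countable

theorem tsum_two_inv_pow_succ (m : ℕ) : ∑' q : ℕ, (2⁻¹ : ℝ≥0∞) ^ (q + 1 + m) = 2⁻¹ ^ m := by
  simp_rw [pow_add _ _ m]
  rw [ENNReal.tsum_mul_right, ENNReal.tsum_geometric_add_one, ENNReal.one_sub_inv_two, inv_inv,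
    ENNReal.inv_mul_cancel (by simp) (by simp), one_mul]

end Kraft

/-! ### Good coins, good draws and the stopping rule -/

section Stages

open scoped ENNReal

variable {n : ℕ} (A : Learner) (d : ℕ) (f : Point n → Bool) (F : ℕ) (par : Params)

/-- The first `m` examples, latest first. -/
def sampleList (xs : ℕ → Point n) : ℕ → List (Point n)
  | 0 => []
  | m + 1 => xs m :: sampleList xs m

/-- The stages up to `q`. -/
noncomputable def stagesTree (xs : ℕ → Point n) : ℕ → FTree Stage
  | 0 => .ret ([], [], 0)
  | q + 1 => (stagesTree xs q).bind fun _ =>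
    stageTree A d f F par (sampleList xs ((q + 1) ^ 2)) (q + 1)

/-- The weak hypotheses found in stage `q`. -/
noncomputable def hyps (r : ℕ → Bool) (xs : ℕ → Point n) (q : ℕ) : List Data :=
  ((stagesTree A d f F par xs q).walk r).1.2.1

/-- The stage in which the algorithm stops. -/
noncomputable def stopStage (r : ℕ → Bool) (xs : ℕ → Point n) : ℕ :=
  sInf {q | 1 ≤ q ∧ short par q (hyps A d f F par r xs q) = true}

variable {A d f F par}

theorem length_sampleList (xs : ℕ → Point n) (m : ℕ) : (sampleList xs m).length = m := by
  induction m with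
  | zero => rfl
  | succ m ih => rw [sampleList, List.length_cons, ih]

theorem mem_sampleList {xs : ℕ → Point n} {m i : ℕ} (h : i < m) : xs i ∈ sampleList xs m := by
  induction m with
  | zero => omega
  | succ m ih =>
    rw [sampleList]
    rcases Nat.lt_succ_iff_lt_or_eq.1 h with h | rfl
    · exact List.mem_cons_of_mem _ (ih h)
    · exact List.mem_cons_self

theorem sampleList_congr {xs ys : ℕ → Point n} {m : ℕ} (h : ∀ i < m, xs i = ys i) :
    sampleList xs m = sampleList ys m := by
  induction m with
  | zero => rfl
  | succ m ih => rw [sampleList, sampleList, h m (by omega), ih fun i hi => h i (by omega)]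

theorem stagesTree_congr {xs ys : ℕ → Point n} {q : ℕ} (h : ∀ i < q ^ 2, xs i = ys i) :
    stagesTree A d f F par xs q = stagesTree A d f F par ys q := by
  induction q with
  | zero => rfl
  | succ q ih =>
    rw [stagesTree, stagesTree, sampleList_congr h,
      ih fun i hi => h i (hi.trans (Nat.pow_lt_pow_left (by omega) (by omega)))]

/-- The coins for which some sample is not classified correctly. -/
def BadCoins (A : Learner) (d : ℕ) (f : Point n → Bool) (F : ℕ) (par : Params) : Set (ℕ → Bool) :=
  {r | ∃ q, ∃ xs : ℕ → Point n, ∃ x ∈ sampleList xs ((q + 1) ^ 2),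
    A.majority (hyps A d f F par r xs (q + 1)) (List.ofFn x) ≠ f x}

/-- For each stage a union bound over all finite samples; their number `(2 ^ n) ^ ((q + 1) ^ 2)`
cancels against the failure probability, and the remaining factor is summed over the stages. Thus
one set of coins serves all example sequences at once. -/
theorem WeaklyLearns.coinMeasure_badCoins_le (hW : WeaklyLearns A d f F par) (hG : 0 < advInv d n)
    (hn : par.1 = n) :
    coinMeasure (BadCoins A d f F par) ≤ 2⁻¹ ^ (1 + par.2.2.1) := by
  -- A stage looks only at finitely many points, so the union over all infinite sequences reduces to
  -- finitely many extensions by a default point.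
  let ext (q : ℕ) (ys : Fin ((q + 1) ^ 2) → Point n) : ℕ → Point n :=
    fun i => if h : i < (q + 1) ^ 2 then ys ⟨i, h⟩ else fun _ => false
  let B (q : ℕ) (ys : Fin ((q + 1) ^ 2) → Point n) : Set (ℕ → Bool) :=
    {r | ((stagesTree A d f F par (ext q ys) (q + 1)).walk r).1 ∈
      {st : Stage | ∃ x ∈ sampleList (ext q ys) ((q + 1) ^ 2),
        A.majority st.2.1 (List.ofFn x) ≠ f x}}
  have hsub : BadCoins A d f F par ⊆ ⋃ q, ⋃ ys, B q ys := by
    rintro r ⟨q, xs, x, hx, hne⟩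
    refine Set.mem_iUnion.2 ⟨q, Set.mem_iUnion.2 ⟨fun i => xs i, ?_⟩⟩
    have h : ∀ i < (q + 1) ^ 2, xs i = ext q (fun i => xs i) i := fun i hi => by simp [ext, hi]
    refine ⟨x, by rwa [← sampleList_congr h], ?_⟩
    rwa [hyps, stagesTree_congr h] at hne
  have hB : ∀ q ys, coinMeasure (B q ys) ≤ 2⁻¹ ^ (n * (q + 1) ^ 2 + (q + 1) + 1 + par.2.2.1) := by
    intro q ys
    have h1 := hW.real_stageTree_le (S := sampleList (ext q ys) ((q + 1) ^ 2)) (q := q + 1)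
      (by omega) (length_sampleList _ _) hG hn
    have h2 : coinMeasure.real (B q ys) ≤ (1 / 2) ^ (n * (q + 1) ^ 2 + (q + 1) + 1 + par.2.2.1) := by
      refine le_of_eq_of_le ?_ h1
      simp only [B]
      -- Earlier stages merely determine which coins are used next. Their outcome is discarded, so
      -- the law of this stage is unaffected by them.
      rw [FTree.coinMeasure_real_walk, stagesTree, FTree.mean_bind, FTree.mean_const]
    rw [← ENNReal.toReal_le_toReal (measure_ne_top _ _) (by simp)]
    refine h2.trans_eq ?_
    simp
  refine (measure_mono hsub).trans ((measure_iUnion_le _).trans ?_)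
  rw [← tsum_two_inv_pow_succ]
  refine ENNReal.tsum_le_tsum fun q => (measure_iUnion_le _).trans ?_
  refine (ENNReal.tsum_le_tsum (hB q)).trans ?_
  rw [tsum_fintype, Finset.sum_const, Finset.card_univ, nsmul_eq_mul, Fintype.card_fun,
    Fintype.card_fun, Fintype.card_bool, Fintype.card_fin, Fintype.card_fin, ← pow_mul,
    add_assoc, add_assoc, pow_add, ← mul_assoc]
  push_cast
  rw [← mul_pow, ENNReal.mul_inv_cancel (by simp) (by simp), one_pow, one_mul]

/-- The example sequences on which some short hypothesis is misleading. -/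
def BadDraws (A : Learner) (f : Point n → Bool) (par : Params) (ρ : PMF (Point n)) :
    Set (ℕ → Point n) :=
  {xs | ∃ q H, short par (q + 1) H = true ∧
    (∀ x ∈ sampleList xs ((q + 1) ^ 2), A.majority H (List.ofFn x) = f x) ∧
    1 / (2 * (par.2.1 : ℝ)) < ρ.toMeasure.real {x | A.majority H (List.ofFn x) ≠ f x}}

/-- The arithmetic form used in the analysis. The definition of `short` splits off the overhead so
that the program can compare the size of `2 ⌈1/ε⌉` copies of the description with a computed number.
-/
theorem short_iff (q : ℕ) (H : List Data) :
    short par q H = true ↔ 2 * par.2.1 * (sz H + q + par.2.1 + par.2.2.1 + 1) ≤ q ^ 2 := by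
  unfold short overhead
  rw [Bool.and_eq_true, decide_eq_true_eq, decide_eq_true_eq, List.map_replicate,
    List.sum_replicate, smul_eq_mul]
  have h1 : 2 * par.2.1 * (sz H + q + par.2.1 + par.2.2.1 + 1) =
    2 * par.2.1 * (q + par.2.1 + par.2.2.1 + 1) + 2 * par.2.1 * sz H := by ring
  rw [h1]
  change _ ∧ 2 * par.2.1 * sz H ≤ _ ↔ _
  omega

/-- Occam's razor. A hypothesis with error above `1/(2E)`, where `E = ⌈1/ε⌉`, is consistent with `q
^ 2` draws with probability at most `(1 - 1/(2E)) ^ (q ^ 2)`, and shortness makes this at most `2 ^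
(-size)` times summable factors. Kraft's inequality then pays for the union over all descriptions,
whatever the algorithm outputs. Both `⌈1/ε⌉` and `⌈1/δ⌉` appear in the final exponent, one for each
sense of confidence. -/
theorem drawMeasure_badDraws_le (ρ : PMF (Point n)) (hE : 0 < par.2.1) :
    drawMeasure ρ (BadDraws A f par ρ) ≤ 2⁻¹ ^ (par.2.1 + par.2.2.1 + 1) := by
  let B (q : ℕ) (D : Data) : Set (ℕ → Point n) :=
    {xs | short par (q + 1) D.toList = true ∧
      (∀ x ∈ sampleList xs ((q + 1) ^ 2), A.majority D.toList (List.ofFn x) = f x) ∧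
      1 / (2 * (par.2.1 : ℝ)) < ρ.toMeasure.real {x | A.majority D.toList (List.ofFn x) ≠ f x}}
  have hsub : BadDraws A f par ρ ⊆ ⋃ q, ⋃ D, B q D := by
    rintro xs ⟨q, H, h⟩
    exact Set.mem_iUnion.2 ⟨q, Set.mem_iUnion.2 ⟨enc H, by
      simp only [B, Data.toList_enc]; exact h⟩⟩
  have hB : ∀ q D, drawMeasure ρ (B q D) ≤
      2⁻¹ ^ D.size * 2⁻¹ ^ (q + 1 + (par.2.1 + par.2.2.1 + 1)) := by
    intro q D
    by_cases hs : short par (q + 1) D.toList = true ∧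
      1 / (2 * (par.2.1 : ℝ)) < ρ.toMeasure.real {x | A.majority D.toList (List.ofFn x) ≠ f x}
    swap
    · have : B q D = ∅ := Set.eq_empty_of_forall_notMem fun xs h => hs ⟨h.1, h.2.2⟩
      simp [this]
    obtain ⟨hs, herr⟩ := hs
    let C : Set (Point n) := {x | A.majority D.toList (List.ofFn x) = f x}
    have h1 : B q D ⊆ Set.pi (Finset.range ((q + 1) ^ 2)) fun _ => C := by
      rintro xs ⟨-, h, -⟩ i hi
      exact h _ (mem_sampleList (by simpa using hi))
    have hC : MeasurableSet C := C.toFinite.measurableSet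
    have h2 : ρ.toMeasure.real C ≤ 1 - 1 / ((2 * par.2.1 : ℕ) : ℝ) := by
      have h3 := probReal_compl_eq_one_sub (μ := ρ.toMeasure) hC
      have h4 : Cᶜ = {x | A.majority D.toList (List.ofFn x) ≠ f x} := rfl
      rw [h4] at h3
      push_cast
      linarith
    have h5 : (drawMeasure ρ).real (Set.pi (Finset.range ((q + 1) ^ 2)) fun _ => C) =
        ρ.toMeasure.real C ^ ((q + 1) ^ 2) := by
      rw [Measure.real, drawMeasure, Measure.infinitePi_pi _ fun _ _ => hC, Finset.prod_const,
        Finset.card_range, ENNReal.toReal_pow]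
      rfl
    rw [short_iff] at hs
    have h6 : sz D.toList = D.size := by rw [sz, Data.enc_toList]
    have h7 := one_sub_inv_pow_le (by omega) hs
    have h8 : (drawMeasure ρ).real (B q D) ≤
        (1 / 2) ^ (sz D.toList + (q + 1) + par.2.1 + par.2.2.1 + 1) :=
      (measureReal_mono h1).trans ((h5.trans_le (pow_le_pow_left₀ measureReal_nonneg h2 _)).trans h7)
    rw [← pow_add, ← ENNReal.toReal_le_toReal (measure_ne_top _ _) (by simp)]
    refine h8.trans_eq ?_
    rw [h6, show D.size + (q + 1) + par.2.1 + par.2.2.1 + 1 =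
      D.size + (q + 1 + (par.2.1 + par.2.2.1 + 1)) by ring]
    simp
  refine (measure_mono hsub).trans ((measure_iUnion_le _).trans ?_)
  rw [← tsum_two_inv_pow_succ]
  refine ENNReal.tsum_le_tsum fun q => (measure_iUnion_le _).trans ?_
  refine (ENNReal.tsum_le_tsum (hB q)).trans ?_
  rw [ENNReal.tsum_mul_right]
  exact mul_le_of_le_one_left' tsum_size_le

/-- The weak learner halts within time `F` and produces descriptions of size at most `B`. -/
def HaltsWithin (A : Learner) (f : Point n → Bool) (F B : ℕ) (par : Params) : Prop :=
  ∀ r xs, ∃ t v, ((weakTree A f F par).walk r xs).1 = some (t, v) ∧ t ≤ F ∧ (v 0).size ≤ B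

/-- Every simulated run is a possible run with a real oracle, so the size bound for the latter
carries over. -/
theorem HaltsWithin.walk_trialsTree {B : ℕ} (hB : HaltsWithin A f F B par) (k : ℕ) {st : Stage}
    (hst : ∀ h ∈ st.2.1, h.size ≤ B) (r : ℕ → Bool) :
    ∀ h ∈ ((trialsTree A d f F par k st).walk r).1.2.1, h.size ≤ B := by
  induction k generalizing st r with
  | zero => exact hst
  | succ k ih =>
    rw [trialsTree, FTree.walk_bind]
    refine ih ?_ _
    rw [trial, FTree.walk_bind, FTree.walk]
    obtain ⟨r', xs', h1⟩ := (weakTree A f F par).exists_walk_eq_expand (samplerData d par st).2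
      (pickPoint d par st) r
    obtain ⟨t, v, h2, -, h3⟩ := hB r' xs'
    rw [← h1, h2]
    simp only
    unfold update
    split_ifs
    · exact List.forall_mem_cons.2 ⟨h3, hst⟩
    · exact hst

/-- A bound for the number of stages. -/
def maxStage (d n B : ℕ) (par : Params) : ℕ :=
  2 * par.2.1 * (par.2.1 + par.2.2.1 + 3 + 6 * (2 * advInv d n + 1) ^ 2 * (B + 1)) + 1

theorem HaltsWithin.sz_hyps_le {B : ℕ} (hB : HaltsWithin A f F B par) (hG : 0 < advInv d n)
    (hn : par.1 = n) (r : ℕ → Bool) (xs : ℕ → Point n) (q : ℕ) :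
    sz (hyps A d f F par r xs (q + 1)) ≤ rounds d n (q + 1) * (B + 1) + 1 := by
  rw [hyps, stagesTree, FTree.walk_bind]
  set r' := ((stagesTree A d f F par xs q).walk r).2
  set S := sampleList xs ((q + 1) ^ 2)
  have h1 := (reachable_start (A := A) (d := d) (f := f) S (q + 1) par hn).walk_trialsTree
    (F := F) hG hn (startStage d par (S.map (toEx f)) (q + 1)).2 r'
  have h2 := hB.walk_trialsTree (d := d) (startStage d par (S.map (toEx f)) (q + 1)).2
    (st := (startStage d par (S.map (toEx f)) (q + 1)).1) (by simp [startStage]) r'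
  refine (sz_list_le h2).trans ?_
  have h3 := h1.count
  gcongr
  exact (Nat.le_add_right _ _).trans_eq h3

/-- The output consists of at most `rounds` descriptions of size `B`, so its size is linear in `q`,
while the budget is `q ^ 2`. `maxStage` is the resulting crossing point; only the analysis knows it,
since it depends on `B`. -/
theorem HaltsWithin.short_of_le {B : ℕ} (hB : HaltsWithin A f F B par) (hG : 0 < advInv d n)
    (hn : par.1 = n) (r : ℕ → Bool) (xs : ℕ → Point n) {q : ℕ} (hq : maxStage d n B par ≤ q) :
    1 ≤ q ∧ short par q (hyps A d f F par r xs q) = true := by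
  obtain _ | q := q
  · simp [maxStage] at hq
  refine ⟨by omega, ?_⟩
  have h := hB.sz_hyps_le hG hn r xs q
  rw [short_iff]
  set s := sz (hyps A d f F par r xs (q + 1))
  set E := par.2.1
  set δ := par.2.2.1
  set D := 2 * advInv d n + 1 with hD
  have hD1 : 1 ≤ D ^ 2 := Nat.one_le_pow _ _ (by omega)
  have h1 : s ≤ 6 * D ^ 2 * (B + 1) * (q + 1) + 1 := by
    refine h.trans ?_
    have h2 : (5 * D ^ 2 * (q + 1) + 1) ≤ 6 * D ^ 2 * (q + 1) := by nlinarith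
    calc _ ≤ (6 * D ^ 2 * (q + 1)) * (B + 1) + 1 :=
          Nat.add_le_add_right (Nat.mul_le_mul_right (B + 1) h2) 1
      _ = _ := by ring
  have h3 : s + (q + 1) + E + δ + 1 ≤ (E + δ + 3 + 6 * D ^ 2 * (B + 1)) * (q + 1) := by nlinarith
  have h4 : 2 * E * (E + δ + 3 + 6 * D ^ 2 * (B + 1)) ≤ q + 1 := by
    have : 2 * E * (E + δ + 3 + 6 * D ^ 2 * (B + 1)) + 1 ≤ q + 1 := hq
    omega
  calc 2 * E * (s + (q + 1) + E + δ + 1)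
      ≤ 2 * E * ((E + δ + 3 + 6 * D ^ 2 * (B + 1)) * (q + 1)) := Nat.mul_le_mul_left _ h3
    _ = (2 * E * (E + δ + 3 + 6 * D ^ 2 * (B + 1))) * (q + 1) := by ring
    _ ≤ (q + 1) * (q + 1) := Nat.mul_le_mul_right _ h4
    _ = (q + 1) ^ 2 := by ring

theorem HaltsWithin.stopStage_spec {B : ℕ} (hB : HaltsWithin A f F B par) (hG : 0 < advInv d n)
    (hn : par.1 = n) (r : ℕ → Bool) (xs : ℕ → Point n) :
    (1 ≤ stopStage A d f F par r xs ∧ short par (stopStage A d f F par r xs)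
      (hyps A d f F par r xs (stopStage A d f F par r xs)) = true) ∧
    stopStage A d f F par r xs ≤ maxStage d n B par :=
  have h := hB.short_of_le hG hn r xs le_rfl
  ⟨Nat.sInf_mem (s := {q | 1 ≤ q ∧ short par q (hyps A d f F par r xs q) = true}) ⟨_, h⟩,
    Nat.sInf_le h⟩

/-- The output of the algorithm. -/
noncomputable def output (A : Learner) (d : ℕ) (f : Point n → Bool) (F : ℕ) (par : Params)
    (r : ℕ → Bool) (xs : ℕ → Point n) : List Data :=
  hyps A d f F par r xs (stopStage A d f F par r xs)

/-- The stopping stage depends on the examples too, but is at most `maxStage` for either sequence,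
so agreement on `maxStage ^ 2` examples makes both runs stop at the same stage. -/
theorem HaltsWithin.output_congr {B : ℕ} (hB : HaltsWithin A f F B par) (hG : 0 < advInv d n)
    (hn : par.1 = n) (r : ℕ → Bool) {xs ys : ℕ → Point n}
    (h : ∀ i < maxStage d n B par ^ 2, xs i = ys i) :
    output A d f F par r xs = output A d f F par r ys := by
  have h1 : ∀ q ≤ maxStage d n B par, hyps A d f F par r xs q = hyps A d f F par r ys q :=
    fun q hq => by
      rw [hyps, hyps, stagesTree_congr fun i hi => h i (hi.trans_le (Nat.pow_le_pow_left hq 2))]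
  obtain ⟨a1, a2⟩ := hB.stopStage_spec hG hn r xs
  obtain ⟨b1, b2⟩ := hB.stopStage_spec hG hn r ys
  have h2 : stopStage A d f F par r xs = stopStage A d f F par r ys := by
    refine le_antisymm (Nat.sInf_le ?_) (Nat.sInf_le ?_)
    · rw [← h1 _ b2] at b1; exact b1
    · rw [h1 _ a2] at a1; exact a1
  rw [output, output, h1 _ a2, h2]

/-- For good coins and examples, the output is accurate. -/
theorem HaltsWithin.error_output_le {B : ℕ} (hB : HaltsWithin A f F B par) (hG : 0 < advInv d n)
    (hn : par.1 = n) {ρ : PMF (Point n)} {r : ℕ → Bool} (hr : r ∉ BadCoins A d f F par)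
    {xs : ℕ → Point n} (hxs : xs ∉ BadDraws A f par ρ) :
    ρ.toMeasure.real {x | A.majority (output A d f F par r xs) (List.ofFn x) ≠ f x} ≤
      1 / (2 * (par.2.1 : ℝ)) := by
  by_contra hcon
  rw [not_le] at hcon
  obtain ⟨⟨a1, a2⟩, -⟩ := hB.stopStage_spec hG hn r xs
  obtain ⟨q, hq⟩ : ∃ q, stopStage A d f F par r xs = q + 1 := ⟨_, (Nat.sub_add_cancel a1).symm⟩
  refine hxs ⟨q, output A d f F par r xs, ?_, fun x hx => ?_, hcon⟩
  · rw [output, ← hq]; exact a2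
  · by_contra hne
    exact hr ⟨q, xs, x, hx, by rwa [output, hq] at hne⟩

/-- Such a set is the preimage of a subset of a finite space. -/
theorem measurableSet_of_prefix {P : Set (ℕ → Point n)} {N : ℕ}
    (h : ∀ xs ys, (∀ i < N, xs i = ys i) → xs ∈ P → ys ∈ P) : MeasurableSet P := by
  let R : (ℕ → Point n) → Fin N → Point n := fun xs i => xs i
  have hR : Measurable R := measurable_pi_lambda _ fun i => measurable_pi_apply _
  have : P = R ⁻¹' (R '' P) := by
    refine Set.Subset.antisymm (Set.subset_preimage_image _ _) ?_
    rintro ys ⟨xs, hxs, he⟩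
    exact h xs ys (fun i hi => congrFun he ⟨i, hi⟩) hxs
  rw [this]
  exact hR (Set.toFinite _).measurableSet

/-- For good coins, the output is accurate on average over the examples. -/
theorem HaltsWithin.average_error_le {B : ℕ} (hB : HaltsWithin A f F B par) (hG : 0 < advInv d n)
    (hn : par.1 = n) (ρ : PMF (Point n)) {r : ℕ → Bool} (hr : r ∉ BadCoins A d f F par) :
    ((drawMeasure ρ).prod ρ.toMeasure).real
      {p | A.majority (output A d f F par r p.1) (List.ofFn p.2) ≠ f p.2} ≤
      (drawMeasure ρ).real (BadDraws A f par ρ) + 1 / (2 * (par.2.1 : ℝ)) := by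
  set M : Set ((ℕ → Point n) × Point n) :=
    {p | A.majority (output A d f F par r p.1) (List.ofFn p.2) ≠ f p.2}
  have hM : MeasurableSet M := by
    have h1 : M = ⋃ x : Point n,
        {xs | A.majority (output A d f F par r xs) (List.ofFn x) ≠ f x} ×ˢ {x} := by
      ext ⟨xs, x⟩; simp [M]
    rw [h1]
    refine .iUnion fun x => (measurableSet_of_prefix (N := maxStage d n B par ^ 2)
      fun xs ys h hx => ?_).prod (measurableSet_singleton x)
    change A.majority (output A d f F par r ys) (List.ofFn x) ≠ f x
    rw [← hB.output_congr hG hn r h]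
    exact hx
  have hQ : MeasurableSet {xs | 1 / (2 * (par.2.1 : ℝ)) <
      ρ.toMeasure.real {x | A.majority (output A d f F par r xs) (List.ofFn x) ≠ f x}} :=
    measurableSet_of_prefix (N := maxStage d n B par ^ 2) fun xs ys h hx => by
      change _ < ρ.toMeasure.real {x | A.majority (output A d f F par r ys) (List.ofFn x) ≠ f x}
      rw [← hB.output_congr hG hn r h]
      exact hx
  set Q := {xs | 1 / (2 * (par.2.1 : ℝ)) <
    ρ.toMeasure.real {x | A.majority (output A d f F par r xs) (List.ofFn x) ≠ f x}}
  -- `Q`, where the error really is large, is measurable by its dependence on a prefix. Integrating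
  -- over `Q` avoids any measurability question about `BadDraws`.
  have hsub : Q ⊆ BadDraws A f par ρ := fun xs hx => by
    by_contra h
    exact absurd (hB.error_output_le hG hn hr h) (not_le.2 hx)
  rw [prod_real_apply hM]
  have h0 : 0 ≤ 1 / (2 * (par.2.1 : ℝ)) := by positivity
  have hI : Integrable (Q.indicator (1 : (ℕ → Point n) → ℝ)) (drawMeasure ρ) :=
    (integrable_const (1 : ℝ)).indicator hQ
  calc ∫ xs, ρ.toMeasure.real (Prod.mk xs ⁻¹' M) ∂drawMeasure ρ
      ≤ ∫ xs, (Q.indicator 1 xs + 1 / (2 * (par.2.1 : ℝ))) ∂drawMeasure ρ := by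
        refine integral_mono (integrable_section hM)
          (hI.add (integrable_const _)) fun xs => ?_
        by_cases hx : xs ∈ Q
        · simp only [Set.indicator_of_mem hx, Pi.one_apply]
          have : ρ.toMeasure.real (Prod.mk xs ⁻¹' M) ≤ 1 := measureReal_le_one
          linarith
        · simp only [Set.indicator_of_notMem hx, zero_add]
          exact not_lt.1 hx
    _ = (drawMeasure ρ).real Q + 1 / (2 * (par.2.1 : ℝ)) := by
        rw [integral_add hI (integrable_const _),
          integral_indicator_one hQ]
        simp
    _ ≤ _ := by gcongr; exact measure_ne_top _ _

end Stages

/-! ### Programs with a time bound and a postcondition -/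

/-- Started in state `s`, the program `c` halts within time `T` in a state satisfying `Q`. -/
def Runs (c : Cmd) (s : State) (T : ℕ) (Q : State → Prop) : Prop :=
  ∃ t s', Exec c s t s' ∧ t ≤ T ∧ Q s'

section Runs

variable {c c' : Cmd} {s : State} {T T' : ℕ} {Q Q' : State → Prop}

theorem Runs.seq (h : Runs c s T Q) (h' : ∀ s', Q s' → Runs c' s' T' Q') :
    Runs (.seq c c') s (T + T') Q' := by
  obtain ⟨t, s', h1, h2, h3⟩ := h
  obtain ⟨t', s'', h1', h2', h3'⟩ := h' s' h3
  exact ⟨_, _, .seq h1 h1', Nat.add_le_add h2 h2', h3'⟩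

theorem Runs.mono (h : Runs c s T Q) (hT : T ≤ T') (hQ : ∀ s', Q s' → Q' s') : Runs c s T' Q' :=
  let ⟨t, s', h1, h2, h3⟩ := h
  ⟨t, s', h1, h2.trans hT, hQ s' h3⟩

theorem runs_assign {i : ℕ} {a : Expr} {V : ℕ → Data} {r : ℕ → Bool} {ex : ℕ → Data}
    (h : (a.eval V).size ≤ T) (hQ : Q ⟨Function.update V i (a.eval V), r, ex⟩) :
    Runs (.assign i a) ⟨V, r, ex⟩ (1 + T) Q :=
  ⟨_, _, exec_assign i a V r ex, Nat.add_le_add_left h 1, hQ⟩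

theorem runs_loop {i : ℕ} (R : ℕ → State → Prop) (h0 : ∀ s, R 0 s → s.store i = .nil)
    (hs : ∀ k s, R (k + 1) s → s.store i ≠ .nil ∧ Runs c s T (R k)) (k : ℕ) (h : R k s) :
    Runs (.loop i c) s (k * (T + 1) + 1) (R 0) :=
  exec_loop R h0 hs k s h

variable {α β : Type} [Enc α] [Enc β] {f : α → β}

/-- A program which computes `f` in polynomial time. -/
noncomputable def PolyTime.cmd (h : PolyTime f) : ℕ → Cmd := h.choose

/-- Apply `f` to the value of the expression `a`, and store the result in the variable `b`. -/
noncomputable def PolyTime.compute (h : PolyTime f) (b : ℕ) (a : Expr) : Cmd :=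
  .seq (.assign b a) (h.cmd b)

theorem PolyTime.exists_time (h : PolyTime f) : ∃ k, ∀ b x v r e, v b = enc x →
    ∃ t v', Exec (h.cmd b) ⟨v, r, e⟩ t ⟨v', r, e⟩ ∧ v' b = enc (f x) ∧ (∀ j < b, v' j = v j) ∧
      t + sz (f x) ≤ (sz x + 2) ^ k := by
  obtain ⟨T, ⟨k, hk⟩, -, h1⟩ := h.choose_spec
  refine ⟨k, fun b x v r e hv => ?_⟩
  obtain ⟨t, v', h2, h3, h4, h5⟩ := h1 b x v r e hv
  exact ⟨t, v', h2, h3, h4, h5.trans (hk x)⟩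

/-- The time taken by `PolyTime.compute` for arguments of size at most `M`. -/
noncomputable def PolyTime.time (h : PolyTime f) (M : ℕ) : ℕ :=
  1 + M + (M + 2) ^ h.exists_time.choose

theorem PolyTime.polyIn_time (h : PolyTime f) : PolyIn (fun M : ℕ => M) h.time :=
  ((PolyIn.const 1).add .self).add ((PolyIn.self.add (.const 2)).pow _)

theorem PolyTime.runs_compute (h : PolyTime f) {b M : ℕ} {a : Expr} {x : α} {V : ℕ → Data}
    {r : ℕ → Bool} {ex : ℕ → Data} (ha : a.eval V = enc x) (hx : sz x ≤ M)
    (hQ : ∀ V', V' b = enc (f x) → (∀ j < b, V' j = V j) → sz (f x) ≤ h.time M → Q ⟨V', r, ex⟩) :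
    Runs (h.compute b a) ⟨V, r, ex⟩ (h.time M) Q := by
  obtain ⟨t, v', h1, h2, h3, h4⟩ := h.exists_time.choose_spec b x
    (Function.update V b (a.eval V)) r ex (by simp [ha])
  have h5 : (sz x + 2) ^ h.exists_time.choose ≤ (M + 2) ^ h.exists_time.choose :=
    Nat.pow_le_pow_left (by omega) _
  have h6 : (a.eval V).size ≤ M := by rw [ha]; exact hx
  refine ⟨_, _, .seq (exec_assign b a V r ex) h1, ?_, hQ v' h2 (fun j hj => ?_) ?_⟩
  · unfold PolyTime.time; omega
  · rw [h3 j hj, Function.update_of_ne hj.ne]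
  · unfold PolyTime.time; omega

end Runs

/-! ### The simulated example oracle -/

theorem polyTime_snoc : PolyTime fun p : ℕ × Bool => 2 * p.1 + p.2.toNat := by
  have h : PolyTime fun p : ℕ × Bool => if p.2 then 1 else 0 := .ite .snd (.const 1) (.const 0)
  refine (((PolyTime.const 2).mul .fst).add h).congr fun p => ?_
  obtain ⟨u, b⟩ := p
  cases b <;> rfl

/-- Store in variable `o + i` a random example, by means of the variables from `z` on. The variable
`6` holds a list of examples and the number of coins to be tossed. -/
noncomputable def sampler (o z i : ℕ) : Cmd :=
  .seq (.assign z (.tl (.var 6))) <| .seq (.assign (z + 1) .nil) <|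
  .seq (.loop z (.seq (.flip (z + 2)) <|
    .seq (polyTime_snoc.compute (z + 1) (.cons (.var (z + 1)) (.var (z + 2)))) <|
      .assign z (.tl (.var z)))) <|
  .seq (polyTime_cyclic.compute z (.cons (.hd (.var 6)) (.var (z + 1)))) <|
    .assign (o + i) (.var z)

/-- A time bound for `sampler`. -/
noncomputable def samplerTime (M : ℕ) : ℕ :=
  (1 + M) + ((1 + 1) + ((M * ((1 + (polyTime_snoc.time (2 * M + 5) + (1 + M))) + 1) + 1) +
    (polyTime_cyclic.time (3 * M + 2) + (1 + polyTime_cyclic.time (3 * M + 2)))))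

theorem polyIn_samplerTime : PolyIn (fun M : ℕ => M) samplerTime := by
  have hm : ∀ a b : ℕ, PolyIn (fun M : ℕ => M) fun M => a * M + b := fun a b =>
    ((PolyIn.const a).mul .self).add (.const b)
  have h1 : PolyIn (fun M : ℕ => M) fun M => 1 + M := (PolyIn.const 1).add .self
  have h2 : PolyIn (fun M : ℕ => M) fun M => polyTime_snoc.time (2 * M + 5) :=
    polyTime_snoc.polyIn_time.comp _ (hm 2 5)
  have h3 : PolyIn (fun M : ℕ => M) fun M => polyTime_cyclic.time (3 * M + 2) :=
    polyTime_cyclic.polyIn_time.comp _ (hm 3 2)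
  exact h1.add ((PolyIn.const (1 + 1)).add (((PolyIn.self.mul
    ((((PolyIn.const 1).add (h2.add h1)).add (.const 1)))).add (.const 1)).add
      (h3.add ((PolyIn.const 1).add h3))))

/-- The loop invariant fixes the final number: with `m` coins left, the bits read so far and the
coins to come together give `bits k 0 r`. Since numbers are unary, `2 ^ k` itself has to be bounded
by `M`. -/
theorem runs_sampler {o w i k M : ℕ} {L : List Ex} {V : ℕ → Data} {r : ℕ → Bool} {ex : ℕ → Data}
    (hi : i < w) (ho : 6 < o) (hV : V 6 = enc (L, k)) (hM : sz (L, k) ≤ M) (hk : 2 ^ k ≤ M) :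
    Runs (sampler o (o + w) i) ⟨V, r, ex⟩ (samplerTime M) fun s =>
      ∃ V', s = ⟨V', sdrop k r, ex⟩ ∧ V' (o + i) = enc (cyclic L (bits k 0 r)) ∧
        (∀ j < w, j ≠ i → V' (o + j) = V (o + j)) ∧ ∀ j < o, V' j = V j := by
  set z := o + w with hz
  rw [sz_pair, sz_nat] at hM
  have hV1 : V 6 = .cons (enc L) (enc k) := hV
  let R : ℕ → State → Prop := fun m s => ∃ V' u, s = ⟨V', sdrop (k - m) r, ex⟩ ∧ m ≤ k ∧
    V' z = enc m ∧ V' (z + 1) = enc u ∧ u < 2 ^ (k - m) ∧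
    bits m u (sdrop (k - m) r) = bits k 0 r ∧ ∀ j < z, V' j = V j
  refine (runs_assign (T := M) ?_ ?_).seq (Q := fun s => ∃ V', s = ⟨V', r, ex⟩ ∧ V' z = enc k ∧
    ∀ j < z, V' j = V j) ?_
  · simp only [Expr.eval, hV1, Data.tl]
    have : (enc k).size = 2 * k + 1 := sz_nat k
    omega
  · exact ⟨_, rfl, by simp [Expr.eval, hV1, Data.tl], fun j hj => Function.update_of_ne hj.ne _ _⟩
  rintro _ ⟨V1, rfl, hV1z, hV1l⟩
  refine (runs_assign (T := 1) ?_ ?_).seq (Q := R k) ?_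
  · exact le_rfl
  · refine ⟨_, 0, by rw [Nat.sub_self]; congr; funext j; simp [sdrop], le_rfl, ?_, ?_, ?_, ?_, fun j hj => ?_⟩
    · rw [Function.update_of_ne (by omega), hV1z]
    · simp [Expr.eval, enc_nat_zero]
    · simp
    · congr; rw [Nat.sub_self]; funext j; simp [sdrop]
    · rw [Function.update_of_ne (by omega), hV1l j hj]
  intro s1 hs1
  have hloop := runs_loop (i := z) (T := 1 + (polyTime_snoc.time (2 * M + 5) + (1 + M)))
    (c := .seq (.flip (z + 2)) <|
    .seq (polyTime_snoc.compute (z + 1) (.cons (.var (z + 1)) (.var (z + 2)))) <|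
      .assign z (.tl (.var z))) R ?_ ?_ k hs1
  rotate_left
  · rintro _ ⟨V', u, rfl, -, h, -⟩
    exact h
  · rintro m _ ⟨V', u, rfl, hmk, h1, h2, h3, h4, h5⟩
    refine ⟨by change V' z ≠ _; rw [h1, enc_nat_succ]; simp, ?_⟩
    have hs : stail (sdrop (k - (m + 1)) r) = sdrop (k - m) r := by
      funext j
      simp only [stail, sdrop]
      congr 1; omega
    set b := sdrop (k - (m + 1)) r 0
    have hpow : 2 ^ (k - m) = 2 * 2 ^ (k - (m + 1)) := by
      rw [← pow_succ']; congr 1; omega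
    have hpk : 2 ^ (k - m) ≤ 2 ^ k := Nat.pow_le_pow_right (by omega) (by omega)
    refine Runs.seq (T := 1) (Q := fun s => s = ⟨Function.update V' (z + 2) (enc b),
      sdrop (k - m) r, ex⟩) ⟨1, _, .flip _ _, le_rfl, by rw [← hs]; rfl⟩ ?_
    rintro _ rfl
    refine Runs.seq (Q := fun s => ∃ V2, s = ⟨V2, sdrop (k - m) r, ex⟩ ∧
      V2 (z + 1) = enc (2 * u + b.toNat) ∧ ∀ j < z + 1, V2 j = V' j)
      (polyTime_snoc.runs_compute (x := (u, b)) ?_ ?_ ?_) ?_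
    · simp [Expr.eval, h2, enc_pair]
    · rw [sz_pair, sz_nat]
      have := sz_bool_le b
      omega
    · intro V2 e1 e2 _
      refine ⟨V2, rfl, e1, fun j hj => ?_⟩
      rw [e2 j hj, Function.update_of_ne (by omega)]
    rintro _ ⟨V2, rfl, e1, e2⟩
    have e3 : V2 z = enc (m + 1) := by rw [e2 z (by omega), h1]
    have e4 : (V2 z).tl = enc m := by rw [e3, enc_nat_succ]; rfl
    refine runs_assign ?_ ⟨_, 2 * u + b.toNat, rfl, by omega, ?_, ?_, ?_, ?_, fun j hj => ?_⟩
    · simp only [Expr.eval, e4]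
      have : (enc m).size = 2 * m + 1 := sz_nat m
      omega
    · simp [Expr.eval, e4]
    · rw [Function.update_of_ne (by omega), e1]
    · have := b.toNat_le
      omega
    · rw [← h4, bits, hs]
    · rw [Function.update_of_ne (by omega), e2 j (by omega), h5 j hj]
  refine (hloop.mono (T' := M * ((1 + (polyTime_snoc.time (2 * M + 5) + (1 + M))) + 1) + 1)
    ?_ fun _ h => h).seq ?_
  · gcongr; omega
  rintro _ ⟨V2, u, rfl, -, -, h2, h3, h4, h5⟩
  rw [Nat.sub_zero] at h3 h4 ⊢
  change u = _ at h4
  refine Runs.seq (Q := fun s => ∃ V3, s = ⟨V3, sdrop k r, ex⟩ ∧ V3 z = enc (cyclic L u) ∧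
      sz (cyclic L u) ≤ polyTime_cyclic.time (3 * M + 2) ∧ ∀ j < z, V3 j = V j)
      (polyTime_cyclic.runs_compute (x := (L, u)) ?_ ?_ ?_) ?_
  · simp [Expr.eval, h2, enc_pair, h5 6 (by omega), hV1, Data.hd]
  · rw [sz_pair, sz_nat]
    omega
  · intro V3 e1 e2 e3
    exact ⟨V3, rfl, e1, e3, fun j hj => by rw [e2 j hj, h5 j hj]⟩
  rintro _ ⟨V3, rfl, e1, e2, e3⟩
  refine runs_assign (by simp only [Expr.eval, e1]; exact e2) ⟨_, rfl, ?_, fun j hj hji => ?_, fun j hj => ?_⟩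
  · simp [Expr.eval, e1, h4]
  · rw [Function.update_of_ne (by omega), e3 _ (by omega)]
  · rw [Function.update_of_ne (by omega), e3 _ (by omega)]

/-! ### The boosting program -/

section Booster

variable {A : Learner} (hA : A.PolyEvaluable) (d : ℕ)

/-- The number of variables reserved for the weak learner. -/
def Learner.width (A : Learner) : ℕ := max A.train.bound 3

/-- One run of the weak learner: the variables `0`, `4`, `5` hold the parameters, the state of the
stage and the number of runs still to be done. -/
noncomputable def trialCmd : Cmd :=
  .seq ((polyTime_samplerData d).compute 6 (.cons (.var 0) (.var 4))) <|
  .seq (clear 7 A.width) <| .seq (.assign 7 (.hd (.var 0))) <|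
  .seq (.assign (7 + 1) (enc 2).expr) <| .seq (.assign (7 + 2) (.tl (.tl (.tl (.var 0))))) <|
  .seq (A.train.embed 7 (sampler 7 (7 + A.width))) <|
  .seq ((hA.polyTime_update d).compute 6 (.cons (.cons (.var 0) (.var 4)) (.var 7))) <|
  .seq (.assign 4 (.var 6)) (.assign 5 (.tl (.var 5)))

/-- A bound for the data of the simulated oracle. -/
noncomputable def oracleSize (M : ℕ) : ℕ :=
  (polyTime_samplerData d).time M + (2 * ((polyTime_samplerData d).time M * (4 * (d * (M + 1) ^ d))) + 1)

/-- A time bound for `trialCmd`. -/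
noncomputable def trialTime (M : ℕ) : ℕ :=
  (polyTime_samplerData d).time M + ((2 * A.width + 1) + ((1 + M) + ((1 + 5) + ((1 + M) +
    (samplerTime (oracleSize d M) * M + ((hA.polyTime_update d).time (2 * M + 1) +
      ((1 + (hA.polyTime_update d).time (2 * M + 1)) + (1 + M))))))))

theorem polyIn_trialTime : PolyIn (fun M : ℕ => M) (trialTime hA d) := by
  have h1 : PolyIn (fun M : ℕ => M) fun M => 1 + M := (PolyIn.const 1).add .self
  have h2 := (polyTime_samplerData d).polyIn_time
  have h3 : PolyIn (fun M : ℕ => M) (oracleSize d) :=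
    h2.add (((PolyIn.const 2).mul (h2.mul ((PolyIn.const 4).mul ((PolyIn.const d).mul
      ((PolyIn.self.add (.const 1)).pow d))))).add (.const 1))
  have h4 : PolyIn (fun M : ℕ => M) fun M => samplerTime (oracleSize d M) :=
    polyIn_samplerTime.comp _ h3
  have h5 : PolyIn (fun M : ℕ => M) fun M => (hA.polyTime_update d).time (2 * M + 1) :=
    (hA.polyTime_update d).polyIn_time.comp _ (((PolyIn.const 2).mul .self).add (.const 1))
  exact h2.add ((PolyIn.const _).add (h1.add ((PolyIn.const _).add (h1.add ((h4.mul .self).add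
    (h5.add (((PolyIn.const 1).add h5).add h1)))))))

variable {n : ℕ} {f : Point n → Bool} {F B M : ℕ} {par : Params}

/-- The program and the tree `trial` consume the same coins. The real oracle stream `ex` is
untouched, since all examples of the weak learner are simulated. -/
theorem runs_trialCmd (hB : HaltsWithin A f F B par) (hn : par.1 = n)
    {S : List (Point n)} {T m : ℕ} {st : Stage} (hst : Reachable A d f S T st) (hS : S ≠ [])
    {V : ℕ → Data} {r : ℕ → Bool} {ex : ℕ → Data} (h0 : V 0 = enc par) (h4 : V 4 = enc st)
    (h5 : V 5 = enc (m + 1)) (hM : sz (par, st) ≤ M) (hF : F ≤ M) (hBM : B ≤ M) (hm : 2 * m + 1 ≤ M) :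
    Runs (trialCmd hA d) ⟨V, r, ex⟩ (trialTime hA d M) fun s =>
      ∃ V', s = ⟨V', ((trial A d f F par st).walk r).2, ex⟩ ∧
        V' 4 = enc ((trial A d f F par st).walk r).1 ∧ V' 5 = enc m ∧ ∀ j < 4, V' j = V j := by
  set w := A.width
  have hw : A.train.bound ≤ w := le_max_left _ _
  have hw3 : 3 ≤ w := le_max_right _ _
  set L := (samplerData d par st).1 with hL
  set k := (samplerData d par st).2 with hk
  have hpar : sz par ≤ M := by rw [sz_pair] at hM; omega
  have hparn : sz par.1 + sz par.2.2.2 ≤ M := by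
    obtain ⟨p1, p2, p3, p4⟩ := par
    rw [sz_pair, sz_pair, sz_pair] at hpar
    dsimp only; omega
  have hnM : n ≤ M := by rw [hn, sz_nat] at hparn; omega
  refine Runs.seq (Q := fun s => ∃ V', s = ⟨V', r, ex⟩ ∧ V' 6 = enc (L, k) ∧
      sz (L, k) ≤ (polyTime_samplerData d).time M ∧ ∀ j < 6, V' j = V j)
    ((polyTime_samplerData d).runs_compute (x := (par, st)) ?_ hM fun V' a b c => ⟨V', rfl, a, c, b⟩) ?_
  · simp [Expr.eval, h0, h4, enc_pair]
  rintro _ ⟨V1, rfl, a1, a2, a3⟩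
  refine Runs.seq (T := 2 * w + 1) (Q := fun s => ∃ V', s = ⟨V', r, ex⟩ ∧ (∀ j < w, V' (7 + j) = .nil) ∧
      ∀ j < 7, V' j = V1 j) ?_ ?_
  · obtain ⟨V', b1, b2, b3⟩ := exec_clear 7 w V1 r ex
    exact ⟨_, _, b1, le_rfl, V', rfl, b2, b3⟩
  rintro _ ⟨V2, rfl, b1, b2⟩
  have hV20 : V2 0 = enc par := by rw [b2 0 (by omega), a3 0 (by omega), h0]
  have e1 : (V2 0).hd = enc n := by rw [hV20, ← hn]; rfl
  have e2 : (V2 0).tl.tl.tl = enc par.2.2.2 := by rw [hV20]; rfl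
  have s1 : (enc n).size + sz par.2.2.2 ≤ M := by rw [← hn]; exact hparn
  refine Runs.seq (runs_assign (T := M) (Q := fun s => s = ⟨Function.update V2 7 (enc n), r, ex⟩) ?_ ?_) ?_
  · simp only [Expr.eval, e1]; omega
  · simp only [Expr.eval, e1]
  rintro _ rfl
  refine Runs.seq (runs_assign (T := 5) (Q := fun s => s =
    ⟨Function.update (Function.update V2 7 (enc n)) (7 + 1) (enc 2), r, ex⟩) ?_ ?_) ?_
  · rw [Data.eval_expr]; exact (sz_nat 2).le
  · rw [Data.eval_expr]
  rintro _ rfl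
  refine Runs.seq (runs_assign (T := M) (Q := fun s => s = ⟨Function.update (Function.update
    (Function.update V2 7 (enc n)) (7 + 1) (enc 2)) (7 + 2) (enc par.2.2.2), r, ex⟩) ?_ ?_) ?_
  · simp [Expr.eval, e2]; exact (Nat.le_add_left _ _).trans s1
  · simp [Expr.eval, e2]
  rintro _ rfl
  set V3 := Function.update (Function.update
    (Function.update V2 7 (enc n)) (7 + 1) (enc 2)) (7 + 2) (enc par.2.2.2) with hV3
  have hV3l : ∀ j < 7, V3 j = V1 j := fun j hj => by
    rw [hV3, Function.update_of_ne (by omega), Function.update_of_ne (by omega),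
      Function.update_of_ne (by omega), b2 j hj]
  have hV3h : ∀ j < w, V3 (7 + j) = initStore [enc n, enc 2, enc par.2.2.2] j := fun j hj => by
    obtain _ | _ | _ | j := j
    · simp [hV3, initStore]
    · simp [hV3, initStore]
    · simp [hV3, initStore]
    · rw [hV3, Function.update_of_ne (by omega), Function.update_of_ne (by omega),
        Function.update_of_ne (by omega), b1 _ hj]
      rfl
  -- the weak learner
  obtain ⟨ow, r', hwalk⟩ : ∃ ow r', ((weakTree A f F par).expand k (pickPoint d par st)).walk r =
    (ow, r') := ⟨_, _, rfl⟩
  -- The simulated run has the outcome of some genuine run, so it is not cut off and obeys the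
  -- bounds of `HaltsWithin`.
  obtain ⟨r₀, xs₀, hex⟩ := (weakTree A f F par).exists_walk_eq_expand k (pickPoint d par st) r
  obtain ⟨t, v, c1, c2, c3⟩ := hB r₀ xs₀
  rw [hex, hwalk] at c1
  change ow = _ at c1
  subst c1
  have hk2 : 2 ^ k ≤ oracleSize d M := by
    refine (two_pow_log2_le _).trans ?_
    have h1 : (weighted st.1).length ≤ (polyTime_samplerData d).time M := by
      refine (length_le_sz _).trans (le_trans ?_ a2)
      rw [sz_pair]
      exact (Nat.le_add_left _ 1).trans (Nat.le_add_right _ _)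
    have h2 : advInv d par.1 ≤ d * (M + 1) ^ d := by rw [hn, advInv]; gcongr
    refine le_trans ?_ (Nat.le_add_left _ _)
    gcongr
  have hLk : sz (L, k) ≤ oracleSize d M := a2.trans (Nat.le_add_right _ _)
  have hemb := Cmd.exec_embed (e := fun x => enc (toEx f x)) (F := F) (o := 7) (w := w) (k := k)
    (C := samplerTime (oracleSize d M)) (pick := pickPoint d par st) (sm := sampler 7 (7 + w))
    (V₀ := V3) (ex := ex) (by unfold samplerTime; omega) (fun i hi V r hV => by
      obtain ⟨t, s', g1, g2, V', rfl, g3, g4, g5⟩ := runs_sampler (V := V) (r := r) (ex := ex) hi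
        (by omega : 6 < 7) (by rw [hV 6 (by omega), hV3l 6 (by omega), a1]) hLk hk2
      exact ⟨t, V', g1, g2, by rw [g3, hL, hst.cyclic_eq hS], g4, fun j hj => by
        rw [g5 j hj, hV j hj]⟩) hw hwalk hV3h fun j _ => rfl
  refine Runs.seq (T := samplerTime (oracleSize d M) * M) (Q := fun s => ∃ V', s = ⟨V', r', ex⟩ ∧
    V' 7 = v 0 ∧ ∀ j < 7, V' j = V1 j) ?_ ?_
  · obtain ⟨t', V', g1, g2, g3, g4⟩ := hemb
    exact ⟨t', _, g1, g2.trans (Nat.mul_le_mul_left _ (c2.trans hF)), V', rfl, g3 0 (by omega),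
      fun j hj => by rw [g4 j hj, hV3l j hj]⟩
  rintro _ ⟨V4, rfl, g1, g2⟩
  have htrial : (trial A d f F par st).walk r = (update A d par st (v 0), r') := by
    rw [trial, FTree.walk_bind, hwalk]
    rfl
  rw [htrial]
  refine Runs.seq (Q := fun s => ∃ V', s = ⟨V', r', ex⟩ ∧ V' 6 = enc (update A d par st (v 0)) ∧
      sz (update A d par st (v 0)) ≤ (hA.polyTime_update d).time (2 * M + 1) ∧ ∀ j < 6, V' j = V j)
    ((hA.polyTime_update d).runs_compute (x := ((par, st), v 0)) ?_ ?_
      fun V' a b c => ⟨V', rfl, a, c, fun j hj => ?_⟩) ?_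
  · simp [Expr.eval, g1, g2 0 (by omega), g2 4 (by omega), a3, h0, h4, enc_pair, enc_data]
  · rw [sz_pair, sz_data]; omega
  · rw [b j hj, g2 j (by omega), a3 j hj]
  rintro _ ⟨V5, rfl, g3, g4, g5⟩
  refine Runs.seq (runs_assign (Q := fun s => ∃ V', s = ⟨V', r', ex⟩ ∧
    V' 4 = enc (update A d par st (v 0)) ∧ V' 5 = enc (m + 1) ∧ ∀ j < 4, V' j = V j) ?_
    ⟨_, rfl, ?_, ?_, fun j hj => ?_⟩) ?_
  · simp only [Expr.eval, g3]; exact g4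
  · simp [Expr.eval, g3]
  · rw [Function.update_of_ne (by omega), g5 5 (by omega), h5]
  · rw [Function.update_of_ne (by omega), g5 j (by omega)]
  rintro _ ⟨V6, rfl, g6, g7, g8⟩
  have g9 : (V6 5).tl = enc m := by rw [g7, enc_nat_succ]; rfl
  refine runs_assign ?_ ⟨_, rfl, ?_, ?_, fun j hj => ?_⟩
  · simp only [Expr.eval, g9]; exact (sz_nat m).trans_le hm
  · rw [Function.update_of_ne (by omega), g6]
  · simp [Expr.eval, g9]
  · rw [Function.update_of_ne (by omega), g8 j hj]

end Booster

/-! ### The program for one stage -/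

section Booster

variable {A : Learner} (hA : A.PolyEvaluable) (d : ℕ)

theorem polyTime_odd : PolyTime fun q : ℕ => 2 * q + 1 := ((PolyTime.const 2).mul .id).succ

theorem polyTime_not_short :
    PolyTime fun p : Params × ℕ × List Data => !short p.1 p.2.1 p.2.2 := polyTime_short.not

/-- Ask for the examples of the next stage. -/
def sampleCmd : Cmd :=
  .loop 4 (.seq (.sample 5) (.seq (.assign 1 (.cons (.var 5) (.var 1))) (.assign 4 (.tl (.var 4)))))

/-- One stage: the variables `0`, `1`, `2` hold the parameters, the examples and the number of the
last stage. Afterwards `3` tells whether another stage is needed. -/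
noncomputable def stageCmd : Cmd :=
  .seq (polyTime_odd.compute 4 (.var 2)) <| .seq sampleCmd <|
  .seq (.assign 2 (.cons .nil (.var 2))) <|
  .seq ((polyTime_startStage d).compute 4 (.cons (.var 0) (.cons (.var 1) (.var 2)))) <|
  .seq (.assign 5 (.tl (.var 4))) <| .seq (.assign 4 (.hd (.var 4))) <|
  .seq (.loop 5 (trialCmd hA d)) <|
  .seq (polyTime_not_short.compute 6 (.cons (.var 0) (.cons (.var 2) (.hd (.tl (.var 4)))))) <|
    .assign 3 (.var 6)

/-- A bound for the initial data of a stage. -/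
noncomputable def startSize (M : ℕ) : ℕ := (polyTime_startStage d).time (3 * M + 2)

/-- A time bound for `stageCmd`. -/
noncomputable def stageTime (M : ℕ) : ℕ :=
  polyTime_odd.time M + ((M * (((1 + M) + ((1 + M) + (1 + M))) + 1) + 1) + ((1 + M) + (startSize d M +
    ((1 + startSize d M) + ((1 + startSize d M) +
      (((startSize d M + M) * (trialTime hA d (startSize d M + M) + 1) + 1) +
        (polyTime_not_short.time (3 * M + 2) + (1 + 3))))))))

theorem polyIn_stageTime : PolyIn (fun M : ℕ => M) (stageTime hA d) := by
  have h1 : PolyIn (fun M : ℕ => M) fun M => 1 + M := (PolyIn.const 1).add .self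
  have hm : PolyIn (fun M : ℕ => M) fun M => 3 * M + 2 := ((PolyIn.const 3).mul .self).add (.const 2)
  have h2 : PolyIn (fun M : ℕ => M) (startSize d) := (polyTime_startStage d).polyIn_time.comp _ hm
  have h3 : PolyIn (fun M : ℕ => M) fun M => polyTime_not_short.time (3 * M + 2) :=
    polyTime_not_short.polyIn_time.comp _ hm
  have h4 : PolyIn (fun M : ℕ => M) fun M => startSize d M + M := h2.add .self
  have h5 : PolyIn (fun M : ℕ => M) fun M => trialTime hA d (startSize d M + M) :=
    (polyIn_trialTime hA d).comp _ h4
  exact polyTime_odd.polyIn_time.add (((PolyIn.self.mul ((h1.add (h1.add h1)).add (.const 1))).add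
    (.const 1)).add (h1.add (h2.add (((PolyIn.const 1).add h2).add (((PolyIn.const 1).add h2).add
      (((h4.mul (h5.add (.const 1))).add (.const 1)).add (h3.add (.const (1 + 3)))))))))

variable {n : ℕ} {f : Point n → Bool} {F B M : ℕ} {par : Params}

theorem sz_toEx_le (x : Point n) : sz (toEx f x) ≤ 4 * n + 5 := by
  have h1 : sz (List.ofFn x) ≤ (List.ofFn x).length * (3 + 1) + 1 :=
    sz_list_le fun b _ => sz_bool_le b
  have h2 := sz_bool_le (f x)
  rw [List.length_ofFn] at h1
  rw [toEx, sz_pair]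
  omega

theorem sz_map_toEx_le (S : List (Point n)) : sz (S.map (toEx f)) ≤ S.length * (4 * n + 6) + 1 := by
  have h : ∀ a ∈ S.map (toEx f), sz a ≤ 4 * n + 5 := fun a ha => by
    obtain ⟨x, -, rfl⟩ := List.mem_map.1 ha
    exact sz_toEx_le x
  have := sz_list_le h
  rwa [List.length_map] at this

/-- The answers of the oracle after the first `j` ones. -/
def answers (f : Point n → Bool) (xs : ℕ → Point n) (j : ℕ) : ℕ → Data :=
  fun k => enc (toEx f (xs (j + k)))

theorem runs_sampleCmd {xs : ℕ → Point n} {j m : ℕ} {V : ℕ → Data} {r : ℕ → Bool}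
    (h1 : V 1 = enc ((sampleList xs j).map (toEx f))) (h4 : V 4 = enc m)
    (hM : (j + m) * (4 * n + 6) + 1 ≤ M) (hm : 2 * m + 1 ≤ M) :
    Runs sampleCmd ⟨V, r, answers f xs j⟩ (M * (((1 + M) + ((1 + M) + (1 + M))) + 1) + 1) fun s =>
      ∃ V', s = ⟨V', r, answers f xs (j + m)⟩ ∧ V' 1 = enc ((sampleList xs (j + m)).map (toEx f)) ∧
        ∀ i < 4, i ≠ 1 → V' i = V i := by
  have h := runs_loop (i := 4) (T := (1 + M) + ((1 + M) + (1 + M)))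
    (c := .seq (.sample 5) (.seq (.assign 1 (.cons (.var 5) (.var 1))) (.assign 4 (.tl (.var 4)))))
    (fun k s => ∃ V' i, s = ⟨V', r, answers f xs i⟩ ∧ i + k = j + m ∧ k ≤ m ∧ V' 4 = enc k ∧
      V' 1 = enc ((sampleList xs i).map (toEx f)) ∧ ∀ i < 4, i ≠ 1 → V' i = V i)
    ?_ ?_ m ⟨V, j, rfl, rfl, le_rfl, h4, h1, fun _ _ _ => rfl⟩
  · refine h.mono ?_ ?_
    · gcongr; omega
    · rintro _ ⟨V', i, rfl, h5, -, -, h6, h7⟩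
      obtain rfl : i = j + m := h5
      exact ⟨V', rfl, h6, h7⟩
  · rintro _ ⟨V', i, rfl, -, -, h5, -⟩
    exact h5
  · rintro k _ ⟨V', i, rfl, a1, a2, a3, a4, a5⟩
    refine ⟨by change V' 4 ≠ _; rw [a3, enc_nat_succ]; simp, ?_⟩
    have hsz : sz ((sampleList xs (i + 1)).map (toEx f)) ≤ M := by
      refine (sz_map_toEx_le _).trans (le_trans ?_ hM)
      rw [length_sampleList]
      exact Nat.add_le_add_right (Nat.mul_le_mul_right _ (by omega)) 1
    have hsz' : 1 + (enc (toEx f (xs i))).size + (enc ((sampleList xs i).map (toEx f))).size ≤ M := hsz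
    refine Runs.seq (T := 1 + M) (Q := fun s => s =
      ⟨Function.update V' 5 (enc (toEx f (xs i))), r, answers f xs (i + 1)⟩)
      ⟨_, _, .sample _ _, ?_, ?_⟩ ?_
    · change 1 + (enc (toEx f (xs i))).size ≤ _
      omega
    · have : (fun k => answers f xs i (k + 1)) = answers f xs (i + 1) := by
        funext k; simp only [answers]; congr 3; omega
      rw [← this]
      rfl
    rintro _ rfl
    refine Runs.seq (runs_assign (T := M) (Q := fun s => ∃ V2, s = ⟨V2, r, answers f xs (i + 1)⟩ ∧
      V2 4 = enc (k + 1) ∧ V2 1 = enc ((sampleList xs (i + 1)).map (toEx f)) ∧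
      ∀ i < 4, i ≠ 1 → V2 i = V i) ?_ ⟨_, rfl, ?_, ?_, fun l hl hl1 => ?_⟩) ?_
    · simpa [Expr.eval, a4, Data.size] using hsz'
    · simpa using a3
    · simp [Expr.eval, a4, sampleList, enc_cons]
    · rw [Function.update_of_ne hl1, Function.update_of_ne (by omega), a5 l hl hl1]
    rintro _ ⟨V2, rfl, b1, b2, b3⟩
    have e : (V2 4).tl = enc k := by rw [b1, enc_nat_succ]; rfl
    refine runs_assign ?_ ⟨_, i + 1, rfl, by omega, by omega, ?_, ?_, fun l hl hl1 => ?_⟩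
    · simp only [Expr.eval, e]
      exact (sz_nat k).trans_le (by omega)
    · simp [Expr.eval, e]
    · simpa using b2
    · rw [Function.update_of_ne (by omega), b3 l hl hl1]

theorem HaltsWithin.walk_trial (hB : HaltsWithin A f F B par) {st : Stage}
    (hst : ∀ h ∈ st.2.1, h.size ≤ B) (r : ℕ → Bool) :
    ∀ h ∈ ((trial A d f F par st).walk r).1.2.1, h.size ≤ B := by
  have h := hB.walk_trialsTree (d := d) 1 hst r
  rwa [trialsTree, FTree.walk_bind] at h

theorem runs_trials (hB : HaltsWithin A f F B par) (hG : 0 < advInv d n) (hn : par.1 = n)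
    {S : List (Point n)} {T K : ℕ} {st : Stage} (hst : Reachable A d f S T st) (hS : S ≠ [])
    (hstB : ∀ h ∈ st.2.1, h.size ≤ B)
    (hM : ∀ st, Reachable A d f S T st → (∀ h ∈ st.2.1, h.size ≤ B) → sz (par, st) ≤ M)
    {V : ℕ → Data} {r : ℕ → Bool} {ex : ℕ → Data} (h0 : V 0 = enc par) (h4 : V 4 = enc st)
    (h5 : V 5 = enc K) (hF : F ≤ M) (hBM : B ≤ M) (hK : 2 * K + 1 ≤ M) :
    Runs (.loop 5 (trialCmd hA d)) ⟨V, r, ex⟩ (M * (trialTime hA d M + 1) + 1) fun s =>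
      ∃ V', s = ⟨V', ((trialsTree A d f F par K st).walk r).2, ex⟩ ∧
        V' 4 = enc ((trialsTree A d f F par K st).walk r).1 ∧ ∀ j < 4, V' j = V j := by
  have h := runs_loop (i := 5) (T := trialTime hA d M) (c := trialCmd hA d)
    (fun k s => ∃ V' r' st', s = ⟨V', r', ex⟩ ∧ k ≤ K ∧ V' 5 = enc k ∧ V' 4 = enc st' ∧
      Reachable A d f S T st' ∧ (∀ h ∈ st'.2.1, h.size ≤ B) ∧
      (trialsTree A d f F par k st').walk r' = (trialsTree A d f F par K st).walk r ∧
      ∀ j < 4, V' j = V j)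
    ?_ ?_ K ⟨V, r, st, rfl, le_rfl, h5, h4, hst, hstB, rfl, fun _ _ => rfl⟩
  · refine h.mono ?_ ?_
    · gcongr; omega
    · rintro _ ⟨V', r', st', rfl, -, -, a1, -, -, a2, a3⟩
      rw [← a2]
      exact ⟨V', rfl, a1, a3⟩
  · rintro _ ⟨V', r', st', rfl, -, a1, -⟩
    exact a1
  · rintro k _ ⟨V', r', st', rfl, a1, a2, a3, a4, a5, a6, a7⟩
    refine ⟨by change V' 5 ≠ _; rw [a2, enc_nat_succ]; simp, ?_⟩
    refine (runs_trialCmd hA d hB hn a4 hS (by rw [a7 0 (by omega), h0]) a3 a2 (hM st' a4 a5) hF hBM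
      (by omega : 2 * k + 1 ≤ M)).mono le_rfl ?_
    rintro _ ⟨V2, rfl, b1, b2, b3⟩
    refine ⟨V2, _, _, rfl, by omega, b2, b1, a4.walk_trial hG hn r', hB.walk_trial d a5 r', ?_,
      fun j hj => by rw [b3 j hj, a7 j hj]⟩
    rw [← a6, trialsTree, FTree.walk_bind]

theorem runs_stageCmd (hB : HaltsWithin A f F B par) (hG : 0 < advInv d n) (hn : par.1 = n)
    {xs : ℕ → Point n} {q : ℕ}
    (hM : ∀ st, Reachable A d f (sampleList xs ((q + 1) ^ 2)) (rounds d n (q + 1)) st →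
      (∀ h ∈ st.2.1, h.size ≤ B) → sz (par, st) ≤ M)
    (hSM : (q + 1) ^ 2 * (4 * n + 6) + 1 ≤ M) (hqM : 4 * q + 3 ≤ M) (hF : F ≤ M) (hBM : B ≤ M)
    {V : ℕ → Data} {r : ℕ → Bool} (h0 : V 0 = enc par)
    (h1 : V 1 = enc ((sampleList xs (q ^ 2)).map (toEx f))) (h2 : V 2 = enc q) :
    Runs (stageCmd hA d) ⟨V, r, answers f xs (q ^ 2)⟩ (stageTime hA d M) fun s =>
      ∃ V' st', s = ⟨V', ((stageTree A d f F par (sampleList xs ((q + 1) ^ 2)) (q + 1)).walk r).2,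
        answers f xs ((q + 1) ^ 2)⟩ ∧
        st' = ((stageTree A d f F par (sampleList xs ((q + 1) ^ 2)) (q + 1)).walk r).1 ∧
        V' 0 = enc par ∧ V' 1 = enc ((sampleList xs ((q + 1) ^ 2)).map (toEx f)) ∧
        V' 2 = enc (q + 1) ∧ V' 3 = enc (!short par (q + 1) st'.2.1) ∧ V' 4 = enc st' ∧
        sz st' ≤ M := by
  -- The examples of earlier stages are kept, so stage `q + 1` asks for only `2 q + 1` new ones.
  have hq1 : q ^ 2 + (2 * q + 1) = (q + 1) ^ 2 := by ring
  have hreach := reachable_start (A := A) (d := d) (f := f) (sampleList xs ((q + 1) ^ 2)) (q + 1) par hn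
  have hparM : sz par ≤ M := by
    have := hM _ hreach (by simp [startStage])
    rw [sz_pair] at this
    omega
  refine Runs.seq (polyTime_odd.runs_compute (x := q) (M := M) (Q := fun s => ∃ V',
    s = ⟨V', r, answers f xs (q ^ 2)⟩ ∧ V' 4 = enc (2 * q + 1) ∧ ∀ j < 4, V' j = V j) ?_ ?_
    fun V' a b _ => ⟨V', rfl, a, b⟩) ?_
  · simpa [Expr.eval] using h2
  · rw [sz_nat]; omega
  rintro _ ⟨V1, rfl, a1, a2⟩
  refine Runs.seq (runs_sampleCmd (M := M) (f := f) (by rw [a2 1 (by omega), h1]) a1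
    (by rw [hq1]; exact hSM) (by omega)) ?_
  rw [hq1]
  rintro _ ⟨V2, rfl, b1, b2⟩
  have b3 : ∀ i < 4, i ≠ 1 → V2 i = V i := fun i hi hi1 => by rw [b2 i hi hi1, a2 i hi]
  set S := sampleList xs ((q + 1) ^ 2) with hSdef
  have hlen : S.length = (q + 1) ^ 2 := length_sampleList _ _
  have hS : S ≠ [] := fun h => by
    rw [h] at hlen
    exact (pow_pos q.succ_pos 2).ne hlen
  have hSsz : sz (S.map (toEx f)) ≤ M := (sz_map_toEx_le S).trans (by rw [hlen]; exact hSM)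
  refine Runs.seq (runs_assign (T := M) (Q := fun s => ∃ V', s = ⟨V', r, answers f xs ((q + 1) ^ 2)⟩ ∧
    V' 0 = enc par ∧ V' 1 = enc (S.map (toEx f)) ∧ V' 2 = enc (q + 1)) ?_ ⟨_, rfl, ?_, ?_, ?_⟩) ?_
  · simp only [Expr.eval, b3 2 (by omega) (by omega), h2]
    exact (sz_nat (q + 1)).trans_le (by omega)
  · simp [b3, h0]
  · simp [b1]
  · simp [Expr.eval, b3, h2, enc_nat_succ]
  rintro _ ⟨V3, rfl, c0, c1, c2⟩
  refine Runs.seq ((polyTime_startStage d).runs_compute (x := (par, S.map (toEx f), q + 1))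
    (M := 3 * M + 2) (Q := fun s => ∃ V', s = ⟨V', r, answers f xs ((q + 1) ^ 2)⟩ ∧
      V' 4 = enc (startStage d par (S.map (toEx f)) (q + 1)) ∧
      sz (startStage d par (S.map (toEx f)) (q + 1)) ≤ startSize d M ∧ ∀ j < 4, V' j = V3 j)
    ?_ ?_ fun V' a b c => ⟨V', rfl, a, c, b⟩) ?_
  · simp [Expr.eval, c0, c1, c2, enc_pair]
  · rw [sz_pair par, sz_pair _ (q + 1), sz_nat]; omega
  rintro _ ⟨V4, rfl, d1, d2, d3⟩
  rcases hsK : startStage d par (S.map (toEx f)) (q + 1) with ⟨st, K⟩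
  rw [hsK] at d1 d2
  rw [sz_pair, sz_nat] at d2
  have d4 : V4 4 = .cons (enc st) (enc K) := d1
  refine Runs.seq (runs_assign (T := startSize d M) (Q := fun s => ∃ V', s = ⟨V', r, answers f xs ((q + 1) ^ 2)⟩ ∧
    V' 4 = .cons (enc st) (enc K) ∧ V' 5 = enc K ∧ ∀ j < 4, V' j = V3 j) ?_ ⟨_, rfl, ?_, ?_, fun j hj => ?_⟩) ?_
  · simp only [Expr.eval, d4, Data.tl]
    exact (sz_nat K).trans_le (by omega)
  · simpa using d4
  · simp [Expr.eval, d4, Data.tl]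
  · rw [Function.update_of_ne (by omega), d3 j hj]
  rintro _ ⟨V5, rfl, e1, e2, e3⟩
  refine Runs.seq (runs_assign (T := startSize d M) (Q := fun s => ∃ V', s = ⟨V', r, answers f xs ((q + 1) ^ 2)⟩ ∧
    V' 4 = enc st ∧ V' 5 = enc K ∧ ∀ j < 4, V' j = V3 j) ?_ ⟨_, rfl, ?_, ?_, fun j hj => ?_⟩) ?_
  · simp only [Expr.eval, e1, Data.hd]
    change sz st ≤ _
    omega
  · simp [Expr.eval, e1, Data.hd]
  · simpa using e2
  · rw [Function.update_of_ne (by omega), e3 j hj]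
  rintro _ ⟨V6, rfl, f1, f2, f3⟩
  have hst : Reachable A d f S (rounds d n (q + 1)) st := by rw [hsK] at hreach; exact hreach
  have hstB : ∀ h ∈ st.2.1, h.size ≤ B := by
    have : st = (startStage d par (S.map (toEx f)) (q + 1)).1 := by rw [hsK]
    rw [this]; simp [startStage]
  have htree : stageTree A d f F par S (q + 1) = trialsTree A d f F par K st := by
    rw [stageTree, hsK]
  rw [htree]
  refine Runs.seq (runs_trials hA d hB hG hn (M := startSize d M + M) hst hS hstB
    (fun st h h' => (hM st h h').trans (Nat.le_add_left _ _)) (by rw [f3 0 (by omega), c0]) f1 f2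
    (by omega) (by omega) (by omega)) ?_
  rintro _ ⟨V7, rfl, g1, g2⟩
  set st' := ((trialsTree A d f F par K st).walk r).1 with hst'
  have hst'M : sz (par, st') ≤ M := hM st' (hst.walk_trialsTree hG hn K r) (hB.walk_trialsTree K hstB r)
  have g3 : V7 4 = .cons (enc st'.1) (.cons (enc st'.2.1) (enc st'.2.2)) := g1
  have hsz : sz st' = 1 + sz st'.1 + (1 + sz st'.2.1 + sz st'.2.2) := rfl
  rw [sz_pair] at hst'M
  have g4 : V7 0 = enc par := by rw [g2 0 (by omega), f3 0 (by omega), c0]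
  have g5 : V7 2 = enc (q + 1) := by rw [g2 2 (by omega), f3 2 (by omega), c2]
  have g6 : V7 1 = enc (S.map (toEx f)) := by rw [g2 1 (by omega), f3 1 (by omega), c1]
  refine Runs.seq (polyTime_not_short.runs_compute (x := (par, q + 1, st'.2.1)) (M := 3 * M + 2)
    (Q := fun s => ∃ V', s = ⟨V', ((trialsTree A d f F par K st).walk r).2, answers f xs ((q + 1) ^ 2)⟩ ∧
      V' 6 = enc (!short par (q + 1) st'.2.1) ∧ ∀ j < 6, V' j = V7 j) ?_ ?_
    fun V' a b _ => ⟨V', rfl, a, b⟩) ?_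
  · simp [Expr.eval, g3, g4, g5, Data.hd, Data.tl, enc_pair]
  · rw [sz_pair par, sz_pair (q + 1), sz_nat]; omega
  rintro _ ⟨V8, rfl, k1, k2⟩
  refine runs_assign ?_ ⟨_, st', rfl, rfl, ?_, ?_, ?_, ?_, ?_, by omega⟩
  · simp only [Expr.eval, k1]; exact sz_bool_le _
  · simp [k2, g4]
  · simp [k2, g6]
  · simp [k2, g5]
  · simp [Expr.eval, k1]
  · simp [k2, g1]

end Booster

/-! ### The complete boosting program and its running time -/

section Booster

variable {A : Learner} (hA : A.PolyEvaluable) (d : ℕ)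

/-- The boosting algorithm. -/
noncomputable def boosterTrain : Cmd :=
  .seq (.assign 0 (.cons (.var 0) (.cons (.var 1) (.cons (.var 2) (.var 3))))) <|
  .seq (.assign 1 .nil) <| .seq (.assign 2 .nil) <| .seq (.assign 3 (.cons .nil .nil)) <|
  .seq (.loop 3 (stageCmd hA d)) (.assign 0 (.hd (.tl (.var 4))))

/-- A time bound for `boosterTrain`. -/
noncomputable def boosterTime (M : ℕ) : ℕ :=
  (1 + M) + ((1 + 1) + ((1 + 1) + ((1 + 3) + ((M * (stageTime hA d M + 1) + 1) + (1 + M)))))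

theorem polyIn_boosterTime : PolyIn (fun M : ℕ => M) (boosterTime hA d) := by
  have h1 : PolyIn (fun M : ℕ => M) fun M => 1 + M := (PolyIn.const 1).add .self
  exact h1.add ((PolyIn.const (1 + 1)).add ((PolyIn.const (1 + 1)).add ((PolyIn.const (1 + 3)).add
    (((PolyIn.self.mul ((polyIn_stageTime hA d).add (.const 1))).add (.const 1)).add h1))))

/-- A bound for the deficits. -/
def deficitBound (d n m T : ℕ) : ℕ := m * (4 * (2 * advInv d n + 1) ^ 2 * T + 1) ^ 2

/-- A bound for the size of the data of all stages. -/
def stateSize (d : ℕ) (par : Params) (F B : ℕ) : ℕ :=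
  let n := par.1
  let N := maxStage d n B par
  let T := rounds d n N
  sz par + F + B + 4 * N + 10 + N ^ 2 * (4 * n + 6) +
    N ^ 2 * (4 * n + 8 + 2 * deficitBound d n (N ^ 2) T) + T * (B + 1) + 2 * T

theorem polyIn_stateSize :
    PolyIn sz fun p : Params × ℕ × ℕ => stateSize d p.1 p.2.1 p.2.2 := by
  have hpar : PolyTime fun p : Params × ℕ × ℕ => p.1 := .fst
  have hn : PolyIn sz fun p : Params × ℕ × ℕ => p.1.1 := hpar.left.polyIn_nat
  have hE : PolyIn sz fun p : Params × ℕ × ℕ => p.1.2.1 := hpar.right.left.polyIn_nat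
  have hD : PolyIn sz fun p : Params × ℕ × ℕ => p.1.2.2.1 := hpar.right.right.left.polyIn_nat
  have hF : PolyIn sz fun p : Params × ℕ × ℕ => p.2.1 := PolyTime.snd.left.polyIn_nat
  have hB : PolyIn sz fun p : Params × ℕ × ℕ => p.2.2 := PolyTime.snd.right.polyIn_nat
  have hG : PolyIn sz fun p : Params × ℕ × ℕ => 2 * advInv d p.1.1 + 1 :=
    ((PolyIn.const 2).mul ((PolyIn.const d).mul ((hn.add (.const 1)).pow d))).add (.const 1)
  have hN : PolyIn sz fun p : Params × ℕ × ℕ => maxStage d p.1.1 p.2.2 p.1 :=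
    (((PolyIn.const 2).mul hE).mul (((hE.add hD).add (.const 3)).add
      (((PolyIn.const 6).mul (hG.pow 2)).mul (hB.add (.const 1))))).add (.const 1)
  have hT : PolyIn sz fun p : Params × ℕ × ℕ => rounds d p.1.1 (maxStage d p.1.1 p.2.2 p.1) :=
    (((PolyIn.const 5).mul (hG.pow 2)).mul hN).add (.const 1)
  have hn4 : ∀ a, PolyIn sz fun p : Params × ℕ × ℕ => 4 * p.1.1 + a := fun a =>
    ((PolyIn.const 4).mul hn).add (.const a)
  have hdef := (hN.pow 2).mul (((((PolyIn.const 4).mul (hG.pow 2)).mul hT).add (.const 1)).pow 2)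
  exact (((((((hpar.polyIn.add hF).add hB).add ((PolyIn.const 4).mul hN)).add (.const 10)).add
    ((hN.pow 2).mul (hn4 6))).add ((hN.pow 2).mul ((hn4 8).add ((PolyIn.const 2).mul hdef)))).add
      (hT.mul (hB.add (.const 1)))).add ((PolyIn.const 2).mul hT)

variable {n : ℕ} {f : Point n → Bool} {F B : ℕ} {par : Params} {d}

/-- The potential bounds each deficit polynomially, so the unary deficits fit into polynomial space.
-/
theorem Reachable.sz_le {S : List (Point n)} {T : ℕ} {st : Stage} (hst : Reachable A d f S T st)
    (hB : ∀ h ∈ st.2.1, h.size ≤ B) :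
    sz st ≤ S.length * (4 * n + 8 + 2 * deficitBound d n S.length T) + T * (B + 1) + 2 * T + 5 := by
  obtain ⟨hcount, a, ha, hpot, -⟩ := hst
  have h1 : sz st = 1 + sz st.1 + (1 + sz st.2.1 + sz st.2.2) := rfl
  have h2 : sz st.2.1 ≤ T * (B + 1) + 1 := by
    refine (sz_list_le hB).trans ?_
    gcongr; omega
  have h3 : sz st.2.2 = 2 * st.2.2 + 1 := sz_nat _
  have h4 : sz st.1 ≤ S.length * (4 * n + 7 + 2 * deficitBound d n S.length T + 1) + 1 := by
    have h5 : st.1.length = S.length := by rw [ha]; simp [itemsOf]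
    rw [← h5]
    refine sz_list_le fun p hp => ?_
    rw [ha] at hp
    obtain ⟨x, hx, rfl⟩ := List.mem_map.1 hp
    have h6 := sz_toEx_le (f := f) x
    have h7 : ((a x : ℝ) + 1) ^ 4 ≤ potential S a :=
      List.single_le_sum (fun y hy => by
        obtain ⟨z, -, rfl⟩ := List.mem_map.1 hy
        positivity) _ (List.mem_map_of_mem hx)
    have h8 : (a x + 1) ^ 4 ≤ S.length * (4 * (2 * advInv d n + 1) ^ 2 * st.2.1.length + 1) ^ 2 := by
      exact_mod_cast h7.trans hpot
    have h9 : a x ≤ deficitBound d n S.length T := by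
      refine (Nat.le_self_pow (by norm_num : 4 ≠ 0) _).trans
        ((Nat.pow_le_pow_left (Nat.le_succ _) 4).trans (h8.trans ?_))
      unfold deficitBound
      gcongr; omega
    rw [sz_pair, sz_nat, h5]
    omega
  have h5 : S.length * (4 * n + 7 + 2 * deficitBound d n S.length T + 1) =
    S.length * (4 * n + 8 + 2 * deficitBound d n S.length T) := by ring
  omega

variable (d)

/-- The number of stages is not computed beforehand: variable 3 is rewritten after each stage by the
test `short`, and `stopStage` is by definition the first stage that passes it. -/
theorem runs_boosterTrain (hB : HaltsWithin A f F B par) (hG : 0 < advInv d n) (hn : par.1 = n)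
    (r : ℕ → Bool) (xs : ℕ → Point n) :
    Runs (boosterTrain hA d)
      ⟨initStore [enc par.1, enc par.2.1, enc par.2.2.1, enc par.2.2.2], r, answers f xs 0⟩
      (boosterTime hA d (stateSize d par F B))
      fun s => s.store 0 = enc (output A d f F par r xs) := by
  set M := stateSize d par F B with hM
  set N := maxStage d n B par with hN
  have hMeq : M = sz par + F + B + 4 * N + 10 + N ^ 2 * (4 * n + 6) +
    N ^ 2 * (4 * n + 8 + 2 * deficitBound d n (N ^ 2) (rounds d n N)) + rounds d n N * (B + 1) +
      2 * rounds d n N := by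
    rw [hM, stateSize, hn]
  obtain ⟨⟨hN1, hN2⟩, hN3⟩ := hB.stopStage_spec hG hn r xs
  set N₀ := stopStage A d f F par r xs with hN₀
  have hlt : ∀ q, 1 ≤ q → q < N₀ → short par q (hyps A d f F par r xs q) = false := fun q h1 h2 => by
    by_contra h
    exact Nat.notMem_of_lt_sInf h2 ⟨h1, by simpa using h⟩
  have hstM : ∀ q < N, ∀ st, Reachable A d f (sampleList xs ((q + 1) ^ 2)) (rounds d n (q + 1)) st →
      (∀ h ∈ st.2.1, h.size ≤ B) → sz (par, st) ≤ M := fun q hq st h h' => by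
    have h1 := h.sz_le h'
    rw [length_sampleList] at h1
    have hq2 : (q + 1) ^ 2 ≤ N ^ 2 := Nat.pow_le_pow_left hq 2
    have hr : rounds d n (q + 1) ≤ rounds d n N := by
      unfold rounds; gcongr; exact hq
    have hdef : deficitBound d n ((q + 1) ^ 2) (rounds d n (q + 1)) ≤
        deficitBound d n (N ^ 2) (rounds d n N) := by
      unfold deficitBound; gcongr
    have h2 : (q + 1) ^ 2 * (4 * n + 8 + 2 * deficitBound d n ((q + 1) ^ 2) (rounds d n (q + 1))) ≤
        N ^ 2 * (4 * n + 8 + 2 * deficitBound d n (N ^ 2) (rounds d n N)) := by gcongr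
    have h3 : rounds d n (q + 1) * (B + 1) ≤ rounds d n N * (B + 1) := Nat.mul_le_mul_right _ hr
    rw [sz_pair]
    omega
  obtain ⟨p1, p2, p3, p4⟩ := par
  refine Runs.seq (runs_assign (T := M) (Q := fun s => ∃ V', s = ⟨V', r, answers f xs 0⟩ ∧
    V' 0 = enc (p1, p2, p3, p4)) ?_ ⟨_, rfl, ?_⟩) ?_
  · change sz (p1, p2, p3, p4) ≤ M
    omega
  · simp only [Function.update_self]; rfl
  rintro _ ⟨V1, rfl, a0⟩
  refine Runs.seq (runs_assign (T := 1) (Q := fun s => ∃ V', s = ⟨V', r, answers f xs 0⟩ ∧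
    V' 0 = enc (p1, p2, p3, p4) ∧ V' 1 = .nil) le_rfl ⟨_, rfl, by simpa using a0, by simp [Expr.eval]⟩) ?_
  rintro _ ⟨V2, rfl, b0, b1⟩
  refine Runs.seq (runs_assign (T := 1) (Q := fun s => ∃ V', s = ⟨V', r, answers f xs 0⟩ ∧
    V' 0 = enc (p1, p2, p3, p4) ∧ V' 1 = .nil ∧ V' 2 = .nil) le_rfl
    ⟨_, rfl, by simpa using b0, by simpa using b1, by simp [Expr.eval]⟩) ?_
  rintro _ ⟨V3, rfl, c0, c1, c2⟩
  refine Runs.seq (runs_assign (T := 3) (Q := fun s => ∃ V', s = ⟨V', r, answers f xs 0⟩ ∧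
    V' 0 = enc (p1, p2, p3, p4) ∧ V' 1 = .nil ∧ V' 2 = .nil ∧ V' 3 ≠ .nil) le_rfl
    ⟨_, rfl, by simpa using c0, by simpa using c1, by simpa using c2, by simp [Expr.eval]⟩) ?_
  rintro _ ⟨V4, rfl, d0, d1, d2, d3⟩
  set par : Params := (p1, p2, p3, p4)
  -- The invariant counts down `m = stopStage - q`. The flag is nonempty exactly while `m` is not 0,
  -- and the link between variable 4 and `hyps` is needed only at `m = 0`, because variable 4 is
  -- meaningless before the first stage.
  have hloop := runs_loop (i := 3) (T := stageTime hA d M) (c := stageCmd hA d)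
    (fun m s => ∃ V' q, s = ⟨V', ((stagesTree A d f F par xs q).walk r).2, answers f xs (q ^ 2)⟩ ∧
      m + q = N₀ ∧ V' 0 = enc par ∧ V' 1 = enc ((sampleList xs (q ^ 2)).map (toEx f)) ∧ V' 2 = enc q ∧
      (m ≠ 0 → V' 3 ≠ .nil) ∧ (m = 0 → V' 3 = .nil ∧ ∃ st : Stage, V' 4 = enc st ∧
        st.2.1 = hyps A d f F par r xs q ∧ sz st ≤ M))
    ?_ ?_ N₀ ⟨V4, 0, rfl, rfl, d0, by simp [d1, sampleList, enc_nil], d2, fun _ => d3, fun h => by omega⟩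
  · refine Runs.seq (hloop.mono (T' := M * (stageTime hA d M + 1) + 1) ?_ fun _ h => h) ?_
    · gcongr; omega
    rintro _ ⟨V', q, rfl, e1, -, -, -, -, e2⟩
    obtain ⟨-, st, e3, e4, e5⟩ := e2 rfl
    have e6 : V' 4 = .cons (enc st.1) (.cons (enc st.2.1) (enc st.2.2)) := e3
    have hsz : sz st = 1 + sz st.1 + (1 + sz st.2.1 + sz st.2.2) := rfl
    refine runs_assign ?_ ?_
    · simp only [Expr.eval, e6, Data.hd, Data.tl]
      change sz st.2.1 ≤ M
      omega
    · simp only [Expr.eval, e6, Data.hd, Data.tl, Function.update_self]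
      rw [e4, output, ← hN₀, ← e1, Nat.zero_add]
  · rintro _ ⟨V', q, rfl, -, -, -, -, -, h⟩
    exact (h rfl).1
  · rintro m _ ⟨V', q, rfl, e1, e2, e3, e4, e5, -⟩
    have hqN : q + 1 ≤ N := by omega
    have hSM : (q + 1) ^ 2 * (4 * n + 6) ≤ N ^ 2 * (4 * n + 6) :=
      Nat.mul_le_mul_right _ (Nat.pow_le_pow_left hqN 2)
    refine ⟨e5 (by omega), (runs_stageCmd hA d hB hG hn (M := M) (hstM q hqN) (by omega) (by omega)
      (by omega) (by omega) e2 e3 e4).mono le_rfl ?_⟩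
    rintro _ ⟨V2, st, rfl, g1, g2, g3, g4, g5, g6, g7⟩
    have hst : st.2.1 = hyps A d f F par r xs (q + 1) := by
      rw [g1, hyps, stagesTree, FTree.walk_bind]
    refine ⟨V2, q + 1, by rw [stagesTree, FTree.walk_bind], by omega, g2, g3, g4, fun hm => ?_,
      fun hm => ⟨?_, st, g6, hst, g7⟩⟩
    · rw [g5, hst, hlt (q + 1) (by omega) (by omega)]
      simp [enc_true]
    · have : q + 1 = N₀ := by omega
      rw [g5, hst, this, hN2]
      rfl

/-- The running time of the boosting algorithm. -/
theorem exists_time_boosterTrain : ∃ K, ∀ (n : ℕ) (f : Point n → Bool) (F B : ℕ) (par : Params),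
    HaltsWithin A f F B par → 0 < advInv d n → par.1 = n → ∀ (r : ℕ → Bool) (xs : ℕ → Point n),
    Runs (boosterTrain hA d)
      ⟨initStore [enc par.1, enc par.2.1, enc par.2.2.1, enc par.2.2.2], r, answers f xs 0⟩
      ((sz (par, F, B) + 2) ^ K) fun s => s.store 0 = enc (output A d f F par r xs) := by
  have h : PolyIn sz fun p : Params × ℕ × ℕ => boosterTime hA d (stateSize d p.1 p.2.1 p.2.2) :=
    (polyIn_boosterTime hA d).comp _ (polyIn_stateSize d)
  obtain ⟨K, hK⟩ := h
  exact ⟨K, fun n f F B par hB hG hn r xs =>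
    (runs_boosterTrain hA d hB hG hn r xs).mono (hK (par, F, B)) fun _ h => h⟩

end Booster

/-! ### From the weak learner to its computation tree -/

section Weak

variable {n : ℕ} {A : Learner} {d : ℕ} {f : Point n → Bool} {F : ℕ} {par : Params}

/-- For fixed coins and examples the run is deterministic, so the existential quantifiers in `Errs`
have only one candidate for the hypothesis. -/
theorem Learner.Trains.errs_iff (hA : A.PolyEvaluable) {inputs : List ℕ} {r : ℕ → Bool}
    {xs : ℕ → Point n} {t : ℕ} {σ : Data} (h : A.Trains inputs f r xs t σ) (x : Point n) :
    A.Errs inputs f r xs x ↔ A.eval σ (List.ofFn x) ≠ f x := by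
  unfold Learner.Errs
  refine not_congr ⟨?_, fun he => ?_⟩
  · rintro ⟨t₁, σ₁, t', ⟨s₁, h1, rfl⟩, h2⟩
    obtain ⟨s, h3, rfl⟩ := h
    obtain ⟨-, rfl⟩ := h1.det h3
    exact h2.eval_eq
  · obtain ⟨t', h'⟩ := hA.exists_predicts σ x
    exact ⟨t, σ, t', h, he ▸ h'⟩

theorem Learner.Trains.walk_weakTree (hn : par.1 = n) {r : ℕ → Bool} {xs : ℕ → Point n} {t : ℕ}
    {σ : Data} (h : A.Trains [par.1, 2, par.2.2.2] f r xs t σ) (ht : t ≤ F) :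
    ∃ v, ((weakTree A f F par).walk r xs).1 = some (t, v) ∧ v 0 = σ ∧ σ.size ≤ 2 * n + 1 + 3 * F := by
  obtain ⟨s, h1, rfl⟩ := h
  obtain ⟨xs', h2, -⟩ := h1.interp (e := fun x => enc (toEx f x)) (xs := xs) ht fun k => rfl
  rw [hn] at h1 h2
  refine ⟨s.store, ?_, rfl, ?_⟩
  · rw [weakTree]
    exact congrArg Prod.fst h2
  · have h3 := h1.size_le 0
    have h4 : (initStore ([n, 2, par.2.2.2].map Data.ofNat) 0).size = 2 * n + 1 := sz_nat n
    rw [h4] at h3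
    omega

theorem Learner.TrainsInTime.exists_trains {inputs : List ℕ} {T : ℝ} (h : A.TrainsInTime inputs f T)
    (r : ℕ → Bool) (xs : ℕ → Point n) : ∃ t σ, A.Trains inputs f r xs t σ ∧ t ≤ ⌊T⌋₊ :=
  let ⟨t, σ, h1, h2⟩ := h r xs
  ⟨t, σ, h1, Nat.le_floor h2⟩

theorem Learner.TrainsInTime.haltsWithin {T : ℝ} (hn : par.1 = n)
    (h : A.TrainsInTime [par.1, 2, par.2.2.2] f T) :
    HaltsWithin A f ⌊T⌋₊ (2 * n + 1 + 3 * ⌊T⌋₊) par := fun r xs => by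
  obtain ⟨t, σ, h1, h2⟩ := h.exists_trains r xs
  obtain ⟨v, h3, rfl, h4⟩ := h1.walk_weakTree hn h2
  exact ⟨t, v, h3, h2, h4⟩

theorem Learner.TrainsInTime.mem_accurate (hA : A.PolyEvaluable) {T : ℝ} (hn : par.1 = n)
    (h : A.TrainsInTime [par.1, 2, par.2.2.2] f T) (ρ : PMF (Point n)) (r : ℕ → Bool)
    (xs : ℕ → Point n) : ((weakTree A f ⌊T⌋₊ par).walk r xs).1 ∈ Accurate A d f ρ ↔
      ρ.toMeasure.real {x | A.Errs [par.1, 2, par.2.2.2] f r xs x} ≤ 1 / 2 - 1 / (2 * advInv d n) := by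
  obtain ⟨t, σ, h1, h2⟩ := h.exists_trains r xs
  obtain ⟨v, h3, rfl, -⟩ := h1.walk_weakTree hn h2
  simp only [h1.errs_iff hA, h3, Accurate]
  constructor
  · rintro ⟨t', v', h4, h5⟩
    obtain ⟨rfl, rfl⟩ := Prod.mk.inj (Option.some.inj h4)
    exact h5
  · exact fun h5 => ⟨t, v, rfl, h5⟩

theorem Learner.TrainsInTime.measurableSet_errs (hA : A.PolyEvaluable) {T : ℝ} (hn : par.1 = n)
    (h : A.TrainsInTime [par.1, 2, par.2.2.2] f T) (r : ℕ → Bool) :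
    MeasurableSet {p : (ℕ → Point n) × Point n | A.Errs [par.1, 2, par.2.2.2] f r p.1 p.2} := by
  let E (x : Point n) : Set Outcome := {o | ∃ t v, o = some (t, v) ∧ A.eval (v 0) (List.ofFn x) ≠ f x}
  have : {p : (ℕ → Point n) × Point n | A.Errs [par.1, 2, par.2.2.2] f r p.1 p.2} =
      ⋃ x, (Prod.mk r ⁻¹' {p | ((weakTree A f ⌊T⌋₊ par).walk p.1 p.2).1 ∈ E x}) ×ˢ {x} := by
    ext ⟨xs, x⟩
    obtain ⟨t, σ, h1, h2⟩ := h.exists_trains r xs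
    obtain ⟨v, h3, rfl, -⟩ := h1.walk_weakTree hn h2
    simp [h1.errs_iff hA, h3, E]
  rw [this]
  exact .iUnion fun x => (measurable_prodMk_left (ITree.measurableSet_walk _ _)).prod
    (measurableSet_singleton x)

theorem advInv_pos (hd : 0 < d) : 0 < advInv d n := Nat.mul_pos hd (pow_pos n.succ_pos d)

/-- Both senses are reduced to a common weaker statement about one run. Halving the advantage leaves
room for an averaging argument in sense (i), where the error bound holds only on average over the
examples. -/
theorem Learner.Succeeds.weaklyLearns (hA : A.PolyEvaluable) {T : ℝ} (hd : 0 < d) (hn : par.1 = n)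
    (hT : A.TrainsInTime [par.1, 2, par.2.2.2] f T) {k : Confidence}
    (h : A.Succeeds k [par.1, 2, par.2.2.2] f (1 / 2 - 1 / (d * (n + 1) ^ d)) (1 / 2)) :
    WeaklyLearns A d f ⌊T⌋₊ par := by
  intro ρ
  have hcast : ((d : ℝ) * (n + 1) ^ d) = advInv d n := by rw [advInv]; push_cast; rfl
  rw [hcast] at h
  set Γ : ℝ := ((advInv d n : ℕ) : ℝ) with hΓ
  have hΓ1 : 1 ≤ Γ := by
    rw [hΓ]
    exact_mod_cast advInv_pos (n := n) hd
  have hγ : 1 / (2 * Γ) = 1 / Γ / 2 := by field_simp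
  have hγ0 : 0 < 1 / Γ := by positivity
  have hγ1 : 1 / Γ ≤ 1 := by rw [div_le_one (by linarith)]; exact hΓ1
  rw [← ITree.real_walk]
  have hM := ITree.measurableSet_walk (weakTree A f ⌊T⌋₊ par) (Accurate A d f ρ)
  set M : Set ((ℕ → Bool) × (ℕ → Point n)) :=
    {p | ((weakTree A f ⌊T⌋₊ par).walk p.1 p.2).1 ∈ Accurate A d f ρ} with hMdef
  have hmem : ∀ r xs, (r, xs) ∈ M ↔ ρ.toMeasure.real {x | A.Errs [par.1, 2, par.2.2.2] f r xs x} ≤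
      1 / 2 - 1 / (2 * Γ) := fun r xs => hT.mem_accurate hA hn ρ r xs
  cases k with
  | joint =>
    -- In sense (ii) a run already succeeds with probability 1/2, which is at least `1/(2G)`.
    refine le_trans (by linarith) ((h ρ).trans (measureReal_mono fun q hq => (hmem q.1 q.2).2 ?_))
    exact le_trans hq (by linarith)
  | coins =>
    rw [prod_real_apply hM]
    have hmark := mul_meas_ge_le_integral_of_nonneg (μ := coinMeasure)
      (f := fun r => (drawMeasure ρ).real (Prod.mk r ⁻¹' M)) (.of_forall fun _ => measureReal_nonneg)
      (integrable_section hM) (1 / Γ)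
    refine le_trans ?_ hmark
    have hS : 1 - 1 / 2 ≤ coinMeasure.real {r | 1 / Γ ≤ (drawMeasure ρ).real (Prod.mk r ⁻¹' M)} := by
      refine le_trans h (measureReal_mono fun r hr => ?_)
      have hr := hr ρ
      have hE := hT.measurableSet_errs hA hn r
      rw [prod_real_apply hE] at hr
      have hMr : MeasurableSet (Prod.mk r ⁻¹' M) := measurable_prodMk_left hM
      have hI : Integrable ((Prod.mk r ⁻¹' M).indicator (1 : (ℕ → Point n) → ℝ)) (drawMeasure ρ) :=
        (integrable_const (1 : ℝ)).indicator hMr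
      -- Markov's inequality for fixed good coins: if `p` is the probability of an accurate
      -- hypothesis, then `(1/2 - 1/(2G)) (1 - p) ≤ 1/2 - 1/G`, hence `p ≥ 1/G`. Good coins have
      -- probability at least 1/2, which gives `1/(2G)` in total.
      have h1 : ∫ xs, (1 / 2 - 1 / (2 * Γ)) * (1 - (Prod.mk r ⁻¹' M).indicator 1 xs) ∂drawMeasure ρ ≤
          1 / 2 - 1 / Γ := by
        refine le_trans (integral_mono (((integrable_const (1 : ℝ)).sub hI).const_mul _)
          (integrable_section hE) fun xs => ?_) hr
        by_cases hx : xs ∈ Prod.mk r ⁻¹' M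
        · simp only [Set.indicator_of_mem hx, Pi.one_apply, sub_self, mul_zero]
          exact measureReal_nonneg
        · simp only [Set.indicator_of_notMem hx, sub_zero, mul_one]
          exact (not_le.1 fun h => hx ((hmem r xs).2 h)).le
      rw [integral_const_mul, integral_sub (integrable_const _) hI, integral_indicator_one hMr] at h1
      simp only [integral_const, probReal_univ, smul_eq_mul, mul_one] at h1
      change 1 / Γ ≤ (drawMeasure ρ).real (Prod.mk r ⁻¹' M)
      have h0 : 0 ≤ (drawMeasure ρ).real (Prod.mk r ⁻¹' M) := measureReal_nonneg
      rw [hγ] at h1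
      nlinarith
    rw [hγ]
    nlinarith

end Weak

/-! ### The booster -/

section Booster

variable {A : Learner} (hA : A.PolyEvaluable) (d : ℕ)

theorem PolyTime.deterministic_cmd {α β : Type} [Enc α] [Enc β] {f : α → β} (h : PolyTime f) (b : ℕ) :
    (h.cmd b).Deterministic := h.choose_spec.choose_spec.2.1 b

/-- The boosting algorithm, together with majority voting. -/
noncomputable def booster : Learner where
  train := boosterTrain hA d
  predict := hA.polyTime_majority.compute 0 (.cons (.var 0) (.var 1))
  predict_det := ⟨trivial, hA.polyTime_majority.deterministic_cmd 0⟩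

theorem booster_predicts {n : ℕ} (σ : Data) (x : Point n) :
    ∃ t ≤ hA.polyTime_majority.time (σ.size + 4 * n + 2),
      (booster hA d).Predicts σ x t (A.majority σ.toList (List.ofFn x)) := by
  have h1 : sz (List.ofFn x) ≤ (List.ofFn x).length * (3 + 1) + 1 :=
    sz_list_le fun b _ => sz_bool_le b
  rw [List.length_ofFn] at h1
  obtain ⟨t, s', h2, h3, h4⟩ := hA.polyTime_majority.runs_compute (b := 0)
    (M := σ.size + 4 * n + 2) (a := .cons (.var 0) (.var 1)) (x := (σ, List.ofFn x))
    (V := initStore [σ, encodePoint x]) (r := fun _ => false) (ex := fun _ => .nil)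
    (Q := fun s => s.store 0 = enc (A.majority σ.toList (List.ofFn x))) rfl
    (by rw [sz_pair, sz_data]; omega) fun V' h _ _ => h
  refine ⟨t, h3, s', h2, ?_⟩
  rw [h4]
  cases A.majority σ.toList (List.ofFn x) <;> simp [enc_true, enc_false]

theorem booster_eval {n : ℕ} (H : List Data) (x : Point n) :
    (booster hA d).eval (enc H) (List.ofFn x) = A.majority H (List.ofFn x) := by
  obtain ⟨t, -, h⟩ := booster_predicts hA d (enc H) x
  rw [h.eval_eq, Data.toList_enc]

theorem booster_polyEvaluable : (booster hA d).PolyEvaluable := by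
  obtain ⟨k, hk⟩ := hA.polyTime_majority.polyIn_time
  -- A single constant serves as factor and as exponent, so the two are added.
  refine ⟨4 ^ k + k, fun n σ x => ?_⟩
  obtain ⟨t, ht, h⟩ := booster_predicts hA d σ x
  refine ⟨t, _, h, ht.trans ((hk _).trans ?_)⟩
  calc (σ.size + 4 * n + 2 + 2) ^ k ≤ (4 * (σ.size + n + 1)) ^ k := Nat.pow_le_pow_left (by omega) k
    _ = 4 ^ k * (σ.size + n + 1) ^ k := mul_pow _ _ _
    _ ≤ (4 ^ k + k) * (σ.size + n + 1) ^ (4 ^ k + k) :=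
      Nat.mul_le_mul (Nat.le_add_right _ _) (Nat.pow_le_pow_right (by omega) (Nat.le_add_left _ _))

theorem exists_booster_trains : ∃ K, ∀ (n : ℕ) (f : Point n → Bool) (F B : ℕ) (par : Params),
    HaltsWithin A f F B par → 0 < advInv d n → par.1 = n → ∀ (r : ℕ → Bool) (xs : ℕ → Point n),
    ∃ t ≤ (sz (par, F, B) + 2) ^ K,
      (booster hA d).Trains [par.1, par.2.1, par.2.2.1, par.2.2.2] f r xs t
        (enc (output A d f F par r xs)) := by
  obtain ⟨K, hK⟩ := exists_time_boosterTrain hA d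
  refine ⟨K, fun n f F B par hB hG hn r xs => ?_⟩
  obtain ⟨t, s', h1, h2, h3⟩ := hK n f F B par hB hG hn r xs
  refine ⟨t, h2, s', ?_, h3⟩
  have : answers f xs 0 = fun k => encodeExample (xs k) (f (xs k)) := by
    funext k
    simp only [answers, Nat.zero_add]
    rfl
  rw [this] at h1
  exact h1

/-- Needs only subadditivity, so it applies to the success events without any proof of
measurability. -/
theorem one_sub_measureReal_le {Ω : Type*} [MeasurableSpace Ω] {P : Measure Ω} [IsProbabilityMeasure P]
    {S T : Set Ω} (h : Sᶜ ⊆ T) : 1 - P.real T ≤ P.real S := by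
  have h1 := measureReal_union_le (μ := P) S Sᶜ
  rw [Set.union_compl_self, probReal_univ] at h1
  linarith [measureReal_mono (μ := P) h]

theorem real_le_half_of_le {Ω : Type*} [MeasurableSpace Ω] {P : Measure Ω} {S : Set Ω} {m : ℕ} {e : ℝ}
    (h : P S ≤ 2⁻¹ ^ (m + 1)) (he : 0 < e) (hm : 1 / e ≤ m) : P.real S ≤ e / 2 := by
  have h1 : P.real S ≤ (1 / 2) ^ (m + 1) := by
    have := ENNReal.toReal_mono (by simp) h
    simpa [Measure.real] using this
  have h2 : (m : ℝ) < 2 ^ m := by exact_mod_cast Nat.lt_two_pow_self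
  have h3 : (1 / 2 : ℝ) ^ m ≤ e := by
    rw [div_pow, one_pow, div_le_iff₀ (by positivity)]
    rw [div_le_iff₀ he] at hm
    nlinarith
  rw [pow_succ] at h1
  linarith

/-- The same two bad events serve both senses. In sense (i) bad coins use up `δ / 2`, and bad draws
are counted as error: `ε / 2` for them and `1/(2E) ≤ ε / 2` otherwise. In sense (ii) bad coins and
bad draws use up `δ / 2` each. -/
theorem booster_succeeds {n : ℕ} {f : Point n → Bool} {F B : ℕ} {par : Params} {ε δ : ℝ} (k : Confidence)
    (hB : HaltsWithin A f F B par) (hW : WeaklyLearns A d f F par) (hG : 0 < advInv d n)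
    (hn : par.1 = n) (hε : 0 < ε) (hδ : 0 < δ) (hE : 1 / ε ≤ par.2.1) (hD : 1 / δ ≤ par.2.2.1) :
    (booster hA d).Succeeds k [par.1, par.2.1, par.2.2.1, par.2.2.2] f ε δ := by
  obtain ⟨K, hK⟩ := exists_booster_trains hA d
  have herr : ∀ r xs x, (booster hA d).Errs [par.1, par.2.1, par.2.2.1, par.2.2.2] f r xs x ↔
      A.majority (output A d f F par r xs) (List.ofFn x) ≠ f x := fun r xs x => by
    obtain ⟨t, -, h⟩ := hK n f F B par hB hG hn r xs
    rw [h.errs_iff (booster_polyEvaluable hA d), booster_eval]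
  have hE0 : (0 : ℝ) < par.2.1 := lt_of_lt_of_le (by positivity) hE
  have hE0' : 0 < par.2.1 := by exact_mod_cast hE0
  have hE2 : 1 / (2 * (par.2.1 : ℝ)) ≤ ε / 2 := by
    rw [div_le_iff₀ hε] at hE
    rw [div_le_div_iff₀ (by positivity) (by norm_num)]
    linarith
  have hbc : coinMeasure.real (BadCoins A d f F par) ≤ δ / 2 := by
    have h := hW.coinMeasure_badCoins_le hG hn
    rw [add_comm] at h
    exact real_le_half_of_le h hδ hD
  have hbd := fun ρ : PMF (Point n) => drawMeasure_badDraws_le (A := A) (f := f) (par := par) ρ hE0'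
  cases k with
  | coins =>
    refine le_trans ?_ (one_sub_measureReal_le (T := BadCoins A d f F par) fun r hr => ?_)
    · linarith
    · by_contra hrb
      refine hr fun ρ => ?_
      simp only [herr]
      have h1 := real_le_half_of_le (hbd ρ) hε (by push_cast; linarith [Nat.cast_nonneg (α := ℝ) par.2.2.1])
      linarith [hB.average_error_le hG hn ρ hrb]
  | joint =>
    intro ρ
    have h1 := real_le_half_of_le (hbd ρ) hδ (by push_cast; linarith)
    refine le_trans ?_ (one_sub_measureReal_le
      (T := BadCoins A d f F par ×ˢ Set.univ ∪ Set.univ ×ˢ BadDraws A f par ρ) fun q hq => ?_)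
    · have h2 := measureReal_union_le (μ := coinMeasure.prod (drawMeasure ρ))
        (BadCoins A d f F par ×ˢ Set.univ) (Set.univ ×ˢ BadDraws A f par ρ)
      rw [measureReal_prod_prod, measureReal_prod_prod, probReal_univ, probReal_univ, mul_one, one_mul] at h2
      linarith
    · by_contra hqb
      simp only [Set.mem_union, Set.mem_prod, Set.mem_univ, and_true, true_and, not_or] at hqb
      refine hq ?_
      change _ ≤ ε
      simp only [herr]
      linarith [hB.error_output_le hG hn (ρ := ρ) hqb.1 hqb.2]

end Booster

theorem toReal_toOuterMeasure_mono {α : Type*} (p : PMF α) {S T : Set α} (h : S ⊆ T) :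
    (p.toOuterMeasure S).toReal ≤ (p.toOuterMeasure T).toReal := by
  refine ENNReal.toReal_mono (ne_top_of_le_ne_top ?_ (measure_mono (Set.subset_univ T))) (measure_mono h)
  rw [(p.toOuterMeasure_apply_eq_one_iff Set.univ).2 (Set.subset_univ _)]
  exact ENNReal.one_ne_top

variable {φ : EvaluationRule} {s : ℕ → ℕ} {μ : TargetDistribution φ} {k : Confidence}

/-! ### Weak learners from strong ones -/

/-- Call a strong learner with accuracy `1 / 4`. -/
def Learner.weaken (A : Learner) : Learner where
  train := .seq (.assign 3 (.var 2)) <| .seq (.assign 2 (.var 1)) <|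
    .seq (.assign 1 (Data.ofNat 4).expr) A.train
  predict := A.predict
  predict_det := A.predict_det

theorem Learner.Trains.weaken {A : Learner} {n : ℕ} {p₁ p₂ p₃ : ℕ} {f : Point n → Bool}
    {r : ℕ → Bool} {xs : ℕ → Point n} {t : ℕ} {σ : Data} (h : A.Trains [p₁, 4, p₂, p₃] f r xs t σ) :
    A.weaken.Trains [p₁, p₂, p₃] f r xs (2 * p₂ + 2 * p₃ + t + 14) σ := by
  obtain ⟨s', h1, h2⟩ := h
  refine ⟨s', ?_, h2⟩
  let v₀ := initStore ([p₁, p₂, p₃].map Data.ofNat)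
  let ex : ℕ → Data := fun k => encodeExample (xs k) (f (xs k))
  have e1 := exec_assign 3 (.var 2) v₀ r ex
  set v₁ := Function.update v₀ 3 ((Expr.var 2).eval v₀) with hv₁
  have e2 := exec_assign 2 (.var 1) v₁ r ex
  set v₂ := Function.update v₁ 2 ((Expr.var 1).eval v₁) with hv₂
  have e3 := exec_assign 1 (Data.ofNat 4).expr v₂ r ex
  have hv : Function.update v₂ 1 ((Data.ofNat 4).expr.eval v₂) =
      initStore ([p₁, 4, p₂, p₃].map Data.ofNat) := by
    rw [Data.eval_expr]
    funext j
    obtain _ | _ | _ | _ | j := j <;> simp [hv₂, hv₁, v₀, initStore, Expr.eval]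
  rw [hv] at e3
  have h3 := Exec.seq e1 (Exec.seq e2 (Exec.seq e3 h1))
  have t1 : ((Expr.var 2).eval v₀).size = 2 * p₃ + 1 := sz_nat p₃
  have t2 : ((Expr.var 1).eval v₁).size = 2 * p₂ + 1 := sz_nat p₂
  have t3 : ((Data.ofNat 4).expr.eval v₂).size = 9 := by rw [Data.eval_expr]; exact sz_nat 4
  rw [t1, t2, t3] at h3
  have ht : 2 * p₂ + 2 * p₃ + t + 14 =
      1 + (2 * p₃ + 1) + (1 + (2 * p₂ + 1) + (1 + 9 + t)) := by omega
  rw [ht]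
  exact h3

theorem Learner.weaken_errs {A : Learner} {n : ℕ} {p₁ p₂ p₃ : ℕ} {f : Point n → Bool}
    {r : ℕ → Bool} {xs : ℕ → Point n} {x : Point n} (h : A.weaken.Errs [p₁, p₂, p₃] f r xs x) :
    A.Errs [p₁, 4, p₂, p₃] f r xs x := by
  rintro ⟨t, σ, t', h1, h2⟩
  exact h ⟨_, σ, t', h1.weaken, h2⟩

theorem Learner.weaken_succeeds {A : Learner} {n : ℕ} {p₁ p₂ p₃ : ℕ} {f : Point n → Bool} {e e' δ : ℝ}
    (he : e ≤ e') (h : A.Succeeds k [p₁, 4, p₂, p₃] f e δ) :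
    A.weaken.Succeeds k [p₁, p₂, p₃] f e' δ := by
  cases k with
  | coins =>
    exact h.trans (measureReal_mono fun r hr ρ =>
      (measureReal_mono fun p hp => Learner.weaken_errs hp).trans ((hr ρ).trans he))
  | joint =>
    exact fun ρ => (h ρ).trans (measureReal_mono fun q hq =>
      (measureReal_mono fun p hp => Learner.weaken_errs hp).trans (le_trans hq he))

theorem EfficientlyDistPACLearnable.weakly (h : EfficientlyDistPACLearnable k φ s μ) :
    EfficientlyWeaklyDistPACLearnable k φ s μ := by
  obtain ⟨A, hA, c, hc⟩ := h
  -- `5 ^ c` comes from `n + s n + 4 + 1/δ + 1/η + 1 ≤ 5 X`, and 18 covers moving the inputs and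
  -- rounding up. The last `c` ensures that the exponent is at least `c`.
  obtain ⟨D, hD⟩ : ∃ D, D = c * 5 ^ c + 18 + c := ⟨_, rfl⟩
  -- With `d = 4` the allowed error `1/2 - 1/(4 (n + 1) ^ 4)` is at least 1/4.
  refine ⟨A.weaken, hA, D, 4, by norm_num, fun n δ η hδ hη => ?_⟩
  obtain ⟨h1, h2⟩ := hc n (1 / 4) δ η (by norm_num) hδ hη
  have h4 : ⌈1 / (1 / 4 : ℝ)⌉₊ = 4 := by norm_num
  rw [h4] at h1 h2
  have hδ' : 0 < 1 / δ := by positivity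
  have hη' : 0 < 1 / η := by positivity
  refine ⟨fun f hf r xs => ?_, h2.trans (toReal_toOuterMeasure_mono _ fun f hf => ?_)⟩
  · obtain ⟨t, σ, h5, h6⟩ := h1 f hf r xs
    refine ⟨_, σ, h5.weaken, ?_⟩
    set X : ℝ := n + s n + 1 / δ + 1 / η + 1 with hX
    have hn0 : (0 : ℝ) ≤ n := Nat.cast_nonneg _
    have hs0 : (0 : ℝ) ≤ s n := Nat.cast_nonneg _
    have hX1 : 1 ≤ X := by linarith
    have h7 : (t : ℝ) ≤ c * (5 * X) ^ c := by
      refine h6.trans ?_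
      gcongr
      linarith
    have h8 : (⌈1 / δ⌉₊ : ℝ) ≤ 1 / δ + 1 := (Nat.ceil_lt_add_one hδ'.le).le
    have h9 : (⌈1 / η⌉₊ : ℝ) ≤ 1 / η + 1 := (Nat.ceil_lt_add_one hη'.le).le
    have hp1 : X ^ c ≤ X ^ (D) := pow_le_pow_right₀ hX1 (by omega)
    have hp2 : X ≤ X ^ (D) := le_self_pow₀ hX1 (by omega)
    rw [mul_pow] at h7
    push_cast
    calc 2 * (⌈1 / δ⌉₊ : ℝ) + 2 * ⌈1 / η⌉₊ + t + 14 ≤ 18 * X + c * (5 ^ c * X ^ c) := by linarith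
      _ ≤ 18 * X ^ (D) + c * (5 ^ c * X ^ (D)) := by gcongr
      _ ≤ 18 * X ^ (D) + c * (5 ^ c * X ^ (D)) +
          c * X ^ (D) := le_add_of_nonneg_right (by positivity)
      _ = (c * 5 ^ c + 18 + c) * X ^ D := by ring
      _ = _ := by rw [hD]; push_cast; rfl
  · refine Learner.weaken_succeeds ?_ hf
    have : (1 : ℝ) ≤ ((n : ℝ) + 1) ^ 4 := one_le_pow₀ (by linarith [Nat.cast_nonneg (α := ℝ) n])
    have h5 : 1 / (((4 : ℕ) : ℝ) * ((n : ℝ) + 1) ^ 4) ≤ 1 / 4 := by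
      push_cast
      exact one_div_le_one_div_of_le (by norm_num) (by linarith)
    linarith

/-! ### Strong learners from weak ones -/

theorem sz_params (p₁ p₂ p₃ p₄ F B : ℕ) :
    sz ((p₁, p₂, p₃, p₄), F, B) = 2 * (p₁ + p₂ + p₃ + p₄ + F + B) + 11 := by
  simp only [sz_pair, sz_nat]
  ring

/-- The parameter `η` is passed on unchanged: the booster succeeds on every concept on which the
weak learner does, so the probability over `f` carries over by inclusion. -/
theorem EfficientlyWeaklyDistPACLearnable.strongly (h : EfficientlyWeaklyDistPACLearnable k φ s μ) :
    EfficientlyDistPACLearnable k φ s μ := by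
  obtain ⟨A, hA, c, d, hd, hc⟩ := h
  obtain ⟨K, hK⟩ := exists_booster_trains hA d
  -- The description bound is `B = 2n + 1 + 3F`, so `F` and `B` together contribute `2 (F + 3F) =
  -- 8F` to the input size, with `F ≤ c 3 ^ c X ^ (c + 1)`; everything else is at most `40 X`.
  let C := 40 + 8 * (c * 3 ^ c)
  refine ⟨booster hA d, booster_polyEvaluable hA d, C ^ K + (c + 1) * K, fun n ε δ η hε hδ hη => ?_⟩
  obtain ⟨h1, h2⟩ := hc n (1 / 2) η (by norm_num) hη
  have h4 : ⌈1 / (1 / 2 : ℝ)⌉₊ = 2 := by norm_num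
  rw [h4] at h1 h2
  have hε' : 0 < 1 / ε := by positivity
  have hδ' : 0 < 1 / δ := by positivity
  have hη' : 0 < 1 / η := by positivity
  let par : Params := (n, ⌈1 / ε⌉₊, ⌈1 / δ⌉₊, ⌈1 / η⌉₊)
  set T : ℝ := c * (n + s n + 1 / (1 / 2) + 1 / η + 1) ^ c with hT
  have hW : ∀ f ∈ φ.inducedClass n, A.TrainsInTime [par.1, 2, par.2.2.2] f T := h1
  refine ⟨fun f hf r xs => ?_, h2.trans (toReal_toOuterMeasure_mono _ fun f hf => ?_)⟩
  · obtain ⟨t, h5, h6⟩ := hK n f _ _ par ((hW f hf).haltsWithin rfl) (advInv_pos hd) rfl r xs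
    refine ⟨t, _, h6, ?_⟩
    set X : ℝ := n + s n + 1 / ε + 1 / δ + 1 / η + 1 with hX
    have hn0 : (0 : ℝ) ≤ n := Nat.cast_nonneg _
    have hs0 : (0 : ℝ) ≤ s n := Nat.cast_nonneg _
    have hX1 : 1 ≤ X := by linarith
    have hF : (⌊T⌋₊ : ℝ) ≤ c * 3 ^ c * X ^ (c + 1) := by
      refine (Nat.floor_le (by positivity)).trans ?_
      rw [hT, mul_assoc]
      gcongr
      calc ((n : ℝ) + s n + 1 / (1 / 2) + 1 / η + 1) ^ c ≤ (3 * X) ^ c := by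
            gcongr
            linarith
        _ = 3 ^ c * X ^ c := mul_pow _ _ _
        _ ≤ 3 ^ c * X ^ (c + 1) := by
            gcongr
            exact Nat.le_succ c
    have hX2 : X ≤ X ^ (c + 1) := le_self_pow₀ hX1 (by omega)
    have e1 : (⌈1 / ε⌉₊ : ℝ) ≤ 1 / ε + 1 := (Nat.ceil_lt_add_one hε'.le).le
    have e2 : (⌈1 / δ⌉₊ : ℝ) ≤ 1 / δ + 1 := (Nat.ceil_lt_add_one hδ'.le).le
    have e3 : (⌈1 / η⌉₊ : ℝ) ≤ 1 / η + 1 := (Nat.ceil_lt_add_one hη'.le).le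
    have h7 : (t : ℝ) ≤ (C * X ^ (c + 1)) ^ K := by
      refine (Nat.cast_le.2 h5).trans ?_
      rw [sz_params]
      push_cast
      gcongr
      simp only [C]
      push_cast
      linarith
    refine h7.trans ?_
    rw [mul_pow, ← pow_mul]
    push_cast
    gcongr
    · linarith [show (0 : ℝ) ≤ ((c : ℝ) + 1) * K by positivity]
    · exact Nat.le_add_left _ _
  · exact booster_succeeds hA d k ((hW f f.2).haltsWithin rfl)
      (Learner.Succeeds.weaklyLearns hA hd (par := par) rfl (hW f f.2) hf) (advInv_pos hd) rfl hε hδ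
      (Nat.le_ceil _) (Nat.le_ceil _)

end DistPAC

theorem mainTheorem10 (φ : DistPAC.EvaluationRule) (s : ℕ → ℕ) (hs : φ.IsRepresented s)
    (μ : DistPAC.TargetDistribution φ) (k : DistPAC.Confidence) :
    DistPAC.EfficientlyWeaklyDistPACLearnable k φ s μ ↔
      DistPAC.EfficientlyDistPACLearnable k φ s μ :=
  ⟨fun h => h.strongly, fun h => h.weakly⟩
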